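/- Let $n\ge 3$. For $E\subset\mathbb R^n$ let $\gamma(E)=(2\pi)^{-n/2}\int_E e^{-|x|^2/2}\,dx$, let $B_r$ be the ball of radius $r$ centered at the origin, and let $\psi(s)=\frac1{\sqrt{2\pi}}\int_{-\infty}^s e^{-t^2/2}\,dt$ (the Gaussian volume of a half-space $\{x_1\le s\}$). A set $E$ is of class $C^2$ (respectively $C^{1,1}$) if near each of its boundary points it is, in suitable orthonormal coordinates, the subgraph of a function $u:\mathbb R^{n-1}\to\mathbb R$ that is $C^2$ (respectively $C^1$ with Lipschitz gradient). For such a set, $\nu=\nu_{\partial E}$ denotes the exterior unit normal and $H_{\partial E}=\operatorname{div}_\tau\nu_{\partial E}$ the mean curvature of $\partial E$ (the sum of the principal curvatures, defined $\mathcal H^{n-1}$-almost everywhere on $\partial E$ if $E$ is only $C^{1,1}$), and $$\mathcal H(E)=\int_{\partial E}H_{\partial E}\,e^{-|x|^2/2}\,d\mathcal H^{n-1}.$$ (i) Let $M>0$ and $m\ge\max\{\psi(2M),\psi(\sqrt{n-2})\}$. If $E$ is a convex set of class $C^2$ containing the origin with $\gamma(E)=\gamma(B_r)=m$ and $\|H_{\partial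 E}\|_{L^\infty(\partial E)}\le M$, then $\mathcal H(E)$ is finite and $$\mathcal H(E)\le\mathcal H(B_r).$$ (ii) Let $m\ge\psi(\sqrt{n-2})$. If $E$ is a convex set of class $C^{1,1}$ containing the origin with $\gamma(E)=\gamma(B_r)=m$ and $\mathcal H(E)<\infty$, then $$\int_{\partial E}\frac{\langle x,\nu\rangle}{|x|}\,H_{\partial E}\,e^{-|x|^2/2}\,d\mathcal H^{n-1}\le\int_{\partial B_r}\frac{\langle x,\nu\rangle}{|x|}\,H_{\partial B_r}\,e^{-|x|^2/2}\,d\mathcal H^{n-1},$$ where the integral on the left converges absolutely. -/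

import Mathlib

open MeasureTheory Set Filter Topology

noncomputable section

namespace GaussianCurvature

/-- `ℝⁿ` with its Euclidean norm. -/
abbrev Space (n : ℕ) : Type := EuclideanSpace ℝ (Fin n)

/-- The Gaussian volume `γ(E) = (2π)^{-n/2} ∫_E e^{-|x|²/2} dx`. -/
def gaussianVolume {n : ℕ} (E : Set (Space n)) : ℝ :=
  1 / (2 * Real.pi) ^ ((n : ℝ) / 2) * ∫ x in E, Real.exp (-‖x‖ ^ 2 / 2)

/-- The Gaussian volume `ψ(s) = (2π)^{-1/2} ∫_{-∞}^s e^{-t²/2} dt` of the half-space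
`{x₁ ≤ s}`. -/
def psi (s : ℝ) : ℝ :=
  1 / Real.sqrt (2 * Real.pi) * ∫ t in Iic s, Real.exp (-t ^ 2 / 2)

/-- Near the point `x₀`, the set `E` is the subgraph in direction `e` of the function `u`, which
is defined on the hyperplane orthogonal to `e`: in some neighbourhood of `x₀` the interior of `E`
is the set strictly below the graph and the boundary of `E` is the graph. -/
def IsSubgraphNear {n : ℕ} (E : Set (Space n)) (x₀ e : Space n)
    (u : (Submodule.span ℝ {e})ᗮ → ℝ) : Prop :=
  ∀ᶠ y in 𝓝 x₀,
    (y ∈ interior E ↔ inner ℝ e y < u ((Submodule.span ℝ {e})ᗮ.orthogonalProjectionOnto y)) ∧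
    (y ∈ frontier E ↔ inner ℝ e y = u ((Submodule.span ℝ {e})ᗮ.orthogonalProjectionOnto y))

/-- Sets of class `C²`: locally at each boundary point the subgraph, in a suitable direction, of a
`C²` function on a hyperplane. -/
def IsClassC2 {n : ℕ} (E : Set (Space n)) : Prop :=
  ∀ x₀ ∈ frontier E, ∃ e : Space n, ‖e‖ = 1 ∧ ∃ u : (Submodule.span ℝ {e})ᗮ → ℝ,
    ContDiff ℝ 2 u ∧ IsSubgraphNear E x₀ e u

/-- Sets of class `C^{1,1}`: locally at each boundary point the subgraph, in a suitable direction,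
of a `C¹` function with Lipschitz derivative on a hyperplane. The Lipschitz constant may depend on
the boundary point. -/
def IsClassC11 {n : ℕ} (E : Set (Space n)) : Prop :=
  ∀ x₀ ∈ frontier E, ∃ e : Space n, ‖e‖ = 1 ∧ ∃ u : (Submodule.span ℝ {e})ᗮ → ℝ,
    (ContDiff ℝ 1 u ∧ ∃ K : NNReal, LipschitzWith K (fderiv ℝ u)) ∧ IsSubgraphNear E x₀ e u

/-- `v` is an exterior unit normal to `E` at `x`: close to `x`, the set `E` contains every cone
`⟨y - x, v⟩ < -ε |y - x|` and misses every cone `⟨y - x, v⟩ > ε |y - x|`. Such a `v` is unique,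
and it exists at each boundary point of a set whose boundary is locally a `C¹` subgraph. -/
def IsExteriorNormal {n : ℕ} (E : Set (Space n)) (x v : Space n) : Prop :=
  ‖v‖ = 1 ∧ ∀ ε : ℝ, 0 < ε → ∀ᶠ y in 𝓝 x,
    (inner ℝ (y - x) v < -ε * ‖y - x‖ → y ∈ E) ∧
    (ε * ‖y - x‖ < inner ℝ (y - x) v → y ∉ E)

open Classical in
/-- The exterior unit normal `ν_{∂E}` (with value `0` at points without a normal). -/
def normal {n : ℕ} (E : Set (Space n)) (x : Space n) : Space n :=
  if h : ∃ v, IsExteriorNormal E x v then h.choose else 0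

/-- The tangential divergence `div_τ X = ∑ᵢ ⟨∇_{τᵢ} X, τᵢ⟩` on `∂E`, where `(τᵢ)` is an orthonormal
basis of the tangent space, the orthogonal complement of the normal. The derivative is taken along
`∂E`; its values on tangent vectors do not depend on how `X` is extended off `∂E`. -/
def tangentialDiv {n : ℕ} (E : Set (Space n)) (X : Space n → Space n) (x : Space n) : ℝ :=
  ∑ i, inner ℝ
    (fderivWithin ℝ X (frontier E) x
      (stdOrthonormalBasis ℝ (Submodule.span ℝ {normal E x})ᗮ i : Space n))
    (stdOrthonormalBasis ℝ (Submodule.span ℝ {normal E x})ᗮ i : Space n)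

/-- The mean curvature `H_{∂E} = div_τ ν_{∂E}`, the sum of the principal curvatures. For a set of
class `C^{1,1}` the normal is differentiable along `∂E` almost everywhere, and there this is
`-div (Du / √(1 + |Du|²))` in terms of a local graph function `u`. -/
def meanCurvature {n : ℕ} (E : Set (Space n)) (x : Space n) : ℝ :=
  tangentialDiv E (normal E) x

/-- The measure `ℋ^{n-1}` on `∂E`. -/
def boundaryMeasure {n : ℕ} (E : Set (Space n)) : Measure (Space n) :=
  (Measure.euclideanHausdorffMeasure (n - 1)).restrict (frontier E)

/-- The integrand `H_{∂E} e^{-|x|²/2}`. -/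
def curvatureDensity {n : ℕ} (E : Set (Space n)) (x : Space n) : ℝ :=
  meanCurvature E x * Real.exp (-‖x‖ ^ 2 / 2)

/-- The functional `ℋ(E) = ∫_{∂E} H_{∂E} e^{-|x|²/2} dℋ^{n-1}`. -/
def curvatureEnergy {n : ℕ} (E : Set (Space n)) : ℝ :=
  ∫ x, curvatureDensity E x ∂(boundaryMeasure E)

/-- The integrand `(⟨x, ν⟩ / |x|) H_{∂E} e^{-|x|²/2}`. -/
def radialDensity {n : ℕ} (E : Set (Space n)) (x : Space n) : ℝ :=
  inner ℝ x (normal E x) / ‖x‖ * curvatureDensity E x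

/-- The integral `∫_{∂E} (⟨x, ν⟩ / |x|) H_{∂E} e^{-|x|²/2} dℋ^{n-1}`. -/
def radialEnergy {n : ℕ} (E : Set (Space n)) : ℝ :=
  ∫ x, radialDensity E x ∂(boundaryMeasure E)

end GaussianCurvature

end

/-! On `∂E` write `p = ⟨x, ν⟩`, `t = |x|`. A convex `E` lies in the half-space bounded by each of
its tangent planes, and that half-space has Gaussian volume `psi p`. So `psi a ≤ γ(E)` forces `p ≥
a` at every boundary point (`HasDefiningFunctions.le_inner_normal`). Hence `p² ≥ n - 2`, and in (i)
also `H ≤ M ≤ p ≤ t`.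

Two identities then remove the curvature. The tangential divergence theorem for the field `e^{-t²/2}
x / t` turns the radial energy into the integral of `((n-1)/t - (1/t + 1/t³)(t² - p²)) e^{-t²/2}`
(`IsRegularConvex.radialEnergy_eq`). The Gauss-Green formula for `e^{-t²/2} x / t²` shows that the
boundary integral of `p/t² e^{-t²/2}` is the integral over `E` of `((n-2)/t² - 1) e^{-t²/2}`
(`IsRegularConvex.integral_inner_div_sq`). Relative to the Gaussian this last density decreases in
`t`, so centered balls maximize it at fixed Gaussian volume; for a ball, `n - 1` times it is both
energies. What remains is pointwise: `(n-1) p/t²` minus the bracket of the first identity is `(t -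
p)((t² + 1)(t + p) - (n-1) t)/t³ ≥ 0`. In (i) the full energy exceeds the radial one by the integral
of `(1 - p/t) H e^{-t²/2}`, which the same factor `t - p` absorbs because `H ≤ t`.

Since `E` is at worst `C^{1,1}` and may be unbounded, surface integrals are obtained from Lebesgue
integrals on `ℝⁿ`. The projection `x ↦ x / gauge E x` pushes Lebesgue measure on the cone over `∂E`
to `⟨x, ν⟩ ℋ^{n-1}` (`IsRegularConvex.coneMeasure_eq`). The normal, extended to be constant along
rays, is locally Lipschitz where the gauge is positive, and its divergence is `H` almost everywhere
on `∂E`. Applying the divergence theorem for compactly supported Lipschitz fields in gauge polar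
coordinates gives integration by parts on `∂E`. -/

noncomputable section

namespace GaussianCurvature

variable {n : ℕ}

/-! ### Local defining functions and the exterior normal -/

/-- `Φ` is a local `C^{1,1}` defining function of `E` near `x₀`, with gradient `G`. -/
structure IsDefiningFunction (E : Set (Space n)) (x₀ : Space n) (Φ : Space n → ℝ)
    (G : Space n → Space n) : Prop where
  hasGradientAt : ∀ y, HasGradientAt Φ (G y) y
  one_le_norm : ∀ y, 1 ≤ ‖G y‖
  lipschitz : ∃ K : NNReal, ∃ U ∈ 𝓝 x₀, LipschitzOnWith K G U
  eventually_iff : ∀ᶠ y in 𝓝 x₀, (y ∈ interior E ↔ Φ y < 0) ∧ (y ∈ frontier E ↔ Φ y = 0)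

/-- Take `Φ y = ⟨e, y⟩ - u (P y)`. Since `P e = 0`, its derivative in the direction `e` is `1`,
which bounds the gradient below; the Lipschitz bound passes through `P` because `‖P‖ ≤ 1`. -/
theorem IsSubgraphNear.exists_isDefiningFunction {E : Set (Space n)} {x₀ e : Space n}
    (he : ‖e‖ = 1) {u : (Submodule.span ℝ {e})ᗮ → ℝ} (hE : IsSubgraphNear E x₀ e u)
    (hu : Differentiable ℝ u)
    (hlip : ∃ K : NNReal, ∃ U ∈ 𝓝 ((Submodule.span ℝ {e})ᗮ.orthogonalProjectionOnto x₀),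
      LipschitzOnWith K (fderiv ℝ u) U) :
    ∃ Φ G, IsDefiningFunction E x₀ Φ G := by
  set P := (Submodule.span ℝ {e})ᗮ.orthogonalProjectionOnto with hP
  have hPe : P e = 0 := by
    rw [hP, Submodule.orthogonalProjectionOnto_eq_zero_iff]
    exact Submodule.le_orthogonal_orthogonal _ (Submodule.mem_span_singleton_self e)
  let D : Space n → (Space n →L[ℝ] ℝ) := fun y => innerSL ℝ e - (fderiv ℝ u (P y)).comp P
  refine ⟨fun y => inner ℝ e y - u (P y), fun y => (InnerProductSpace.toDual ℝ _).symm (D y),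
    ?_, ?_, ?_, ?_⟩
  · intro y
    rw [hasGradientAt_iff_hasFDerivAt, LinearIsometryEquiv.apply_symm_apply]
    exact (innerSL ℝ e).hasFDerivAt.sub
      ((hu (P y)).hasFDerivAt.comp y P.hasFDerivAt)
  · intro y
    rw [LinearIsometryEquiv.norm_map]
    have h1 : D y e = 1 := by simp [D, hPe, he]
    calc (1 : ℝ) = ‖D y e‖ := by simp [h1]
      _ ≤ ‖D y‖ * ‖e‖ := (D y).le_opNorm e
      _ = ‖D y‖ := by rw [he, mul_one]
  · obtain ⟨K, U, hU, hK⟩ := hlip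
    refine ⟨K, P ⁻¹' U, P.continuous.continuousAt.preimage_mem_nhds hU, ?_⟩
    refine LipschitzOnWith.of_dist_le_mul fun x hx y hy => ?_
    rw [LinearIsometryEquiv.dist_map, dist_eq_norm]
    have h1 : D x - D y = (fderiv ℝ u (P y) - fderiv ℝ u (P x)).comp P := by
      ext z; simp [D]
    have h2 : ‖P‖ ≤ 1 := Submodule.orthogonalProjectionOnto_norm_le _
    rw [h1]
    calc ‖(fderiv ℝ u (P y) - fderiv ℝ u (P x)).comp P‖
        ≤ ‖fderiv ℝ u (P y) - fderiv ℝ u (P x)‖ * ‖P‖ := ContinuousLinearMap.opNorm_comp_le _ _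
      _ ≤ ‖fderiv ℝ u (P y) - fderiv ℝ u (P x)‖ * 1 := by gcongr
      _ ≤ K * dist (P x) (P y) := by
        rw [mul_one, dist_comm]
        exact (dist_eq_norm (fderiv ℝ u (P y)) (fderiv ℝ u (P x))).symm.trans_le
          (hK.dist_le_mul _ hy _ hx)
      _ ≤ K * dist x y := by
        gcongr
        rw [dist_eq_norm, dist_eq_norm, ← map_sub]
        calc ‖P (x - y)‖ ≤ ‖P‖ * ‖x - y‖ := P.le_opNorm _
          _ ≤ 1 * ‖x - y‖ := by gcongr
          _ = ‖x - y‖ := one_mul _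
  · filter_upwards [hE] with y hy
    simpa [sub_neg, sub_eq_zero] using hy

/-- A set all of whose boundary points have local `C^{1,1}` defining functions. -/
def HasDefiningFunctions (E : Set (Space n)) : Prop :=
  ∀ x₀ ∈ frontier E, ∃ Φ G, IsDefiningFunction E x₀ Φ G

theorem IsClassC2.hasDefiningFunctions {E : Set (Space n)} (hE : IsClassC2 E) :
    HasDefiningFunctions E := by
  intro x hx
  obtain ⟨e, he, u, hu, h⟩ := hE x hx
  refine h.exists_isDefiningFunction he (hu.differentiable (by norm_num)) ?_
  have h1 : ContDiff ℝ 1 (fderiv ℝ u) := hu.fderiv_right (by norm_num)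
  exact h1.contDiffAt.exists_lipschitzOnWith

theorem IsClassC11.hasDefiningFunctions {E : Set (Space n)} (hE : IsClassC11 E) :
    HasDefiningFunctions E := by
  intro x hx
  obtain ⟨e, he, u, ⟨hu, K, hK⟩, h⟩ := hE x hx
  exact h.exists_isDefiningFunction he (hu.differentiable (by norm_num))
    ⟨K, univ, univ_mem, hK.lipschitzOnWith⟩

/-- To first order `Φ` is `⟨G y, z - y⟩`, and `‖G y‖ ≥ 1` lets this term dominate the error outside
the cone of aperture `ε`, so the sign of `Φ` is known there. -/
theorem IsDefiningFunction.isExteriorNormal {E : Set (Space n)} {x₀ : Space n}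
    {Φ : Space n → ℝ} {G : Space n → Space n} (h : IsDefiningFunction E x₀ Φ G) :
    ∀ᶠ y in 𝓝 x₀, y ∈ frontier E → IsExteriorNormal E y (‖G y‖⁻¹ • G y) := by
  filter_upwards [h.eventually_iff.eventually_nhds] with y hy hyE
  have hG := h.one_le_norm y
  have hΦ : Φ y = 0 := (hy.self_of_nhds).2.1 hyE
  refine ⟨by rw [norm_smul, norm_inv, norm_norm, inv_mul_cancel₀ (by positivity)],
    fun ε hε => ?_⟩
  have hd := ((hasGradientAt_iff_hasFDerivAt.1 (h.hasGradientAt y)).isLittleO).def hε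
  filter_upwards [hy, hd] with z hz hz'
  simp only [hΦ, InnerProductSpace.toDual_apply_apply, sub_zero, Real.norm_eq_abs] at hz'
  rw [abs_le] at hz'
  have key : inner ℝ (G y) (z - y) = ‖G y‖ * inner ℝ (z - y) (‖G y‖⁻¹ • G y) := by
    rw [real_inner_smul_right, real_inner_comm, mul_inv_cancel_left₀ (by positivity)]
  have hε' : ε * ‖z - y‖ ≤ ‖G y‖ * (ε * ‖z - y‖) :=
    le_mul_of_one_le_left (by positivity) hG
  constructor
  · intro hlt
    refine interior_subset (hz.1.2 ?_)
    have := mul_lt_mul_of_pos_left hlt (by positivity : 0 < ‖G y‖)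
    nlinarith [hz'.2]
  · intro hlt hzE
    have := mul_lt_mul_of_pos_left hlt (by positivity : 0 < ‖G y‖)
    have hpos : 0 < Φ z := by nlinarith [hz'.1]
    by_cases hi : z ∈ interior E
    · exact absurd (hz.1.1 hi) hpos.not_gt
    · exact hpos.ne' (hz.2.1 ⟨subset_closure hzE, hi⟩)

/-- For two distinct normals, a small step from `x` in the direction `w - v` enters `E` according to
`v` and leaves it according to `w`. -/
theorem IsExteriorNormal.unique {E : Set (Space n)} {x v w : Space n}
    (hv : IsExteriorNormal E x v) (hw : IsExteriorNormal E x w) : v = w := by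
  by_contra hne
  have hlt : inner ℝ v w < (1 : ℝ) := by
    exact (inner_lt_one_iff_real_of_norm_eq_one hv.1 hw.1).2 hne
  set d := w - v with hd
  have hd0 : 0 < ‖d‖ := norm_pos_iff.2 (sub_ne_zero.2 (Ne.symm hne))
  set δ : ℝ := 1 - inner ℝ v w with hδ
  have hδ0 : 0 < δ := by linarith
  have h1 : inner ℝ d v = -δ := by
    rw [hd, inner_sub_left, real_inner_self_eq_norm_sq, hv.1, real_inner_comm]; ring
  have h2 : inner ℝ d w = δ := by
    rw [hd, inner_sub_left, real_inner_self_eq_norm_sq, hw.1]; ring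
  set ε := δ / (2 * ‖d‖) with hε
  have hε0 : 0 < ε := by positivity
  have hεd : ε * ‖d‖ = δ / 2 := by rw [hε]; field_simp
  have hc : Tendsto (fun t : ℝ => x + t • d) (𝓝[>] 0) (𝓝 x) := by
    have : Continuous fun t : ℝ => x + t • d := by fun_prop
    have := this.tendsto 0
    simp only [zero_smul, add_zero] at this
    exact this.mono_left nhdsWithin_le_nhds
  obtain ⟨t, ht1, ht2, ht0⟩ := ((hc.eventually (hv.2 ε hε0)).and
    ((hc.eventually (hw.2 ε hε0)).and self_mem_nhdsWithin)).exists
  replace ht0 : 0 < t := ht0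
  rw [add_sub_cancel_left, real_inner_smul_left, norm_smul, Real.norm_eq_abs, abs_of_pos ht0]
    at ht1 ht2
  refine ht2.2 ?_ (ht1.1 ?_)
  · rw [h2]; nlinarith
  · rw [h1]; nlinarith

theorem IsExteriorNormal.normal_eq {E : Set (Space n)} {x v : Space n}
    (hv : IsExteriorNormal E x v) : normal E x = v := by
  have h : ∃ v, IsExteriorNormal E x v := ⟨v, hv⟩
  rw [normal, dif_pos h]
  exact h.choose_spec.unique hv

theorem HasDefiningFunctions.isExteriorNormal {E : Set (Space n)} (hE : HasDefiningFunctions E)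
    {x : Space n} (hx : x ∈ frontier E) : IsExteriorNormal E x (normal E x) := by
  obtain ⟨Φ, G, h⟩ := hE x hx
  have := h.isExteriorNormal.self_of_nhds hx
  rwa [this.normal_eq]

theorem norm_normalize_sub_le {V : Type*} [NormedAddCommGroup V] [NormedSpace ℝ V] {v w : V}
    (hv : 1 ≤ ‖v‖) (hw : 1 ≤ ‖w‖) : ‖‖v‖⁻¹ • v - ‖w‖⁻¹ • w‖ ≤ 2 * ‖v - w‖ := by
  have hv0 : 0 < ‖v‖ := by linarith
  have hw0 : 0 < ‖w‖ := by linarith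
  have h : ‖v‖⁻¹ • v - ‖w‖⁻¹ • w = ‖v‖⁻¹ • ((v - w) + ((‖w‖ - ‖v‖) * ‖w‖⁻¹) • w) := by
    rw [sub_mul, mul_inv_cancel₀ hw0.ne', sub_smul, one_smul, smul_add, smul_sub, smul_sub,
      smul_smul, ← mul_assoc, inv_mul_cancel₀ hv0.ne', one_mul]
    abel
  rw [h, norm_smul, norm_inv, norm_norm]
  have h2 : ‖(v - w) + ((‖w‖ - ‖v‖) * ‖w‖⁻¹) • w‖ ≤ 2 * ‖v - w‖ := by
    refine (norm_add_le _ _).trans ?_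
    rw [norm_smul, norm_mul, norm_inv, norm_norm, mul_assoc, inv_mul_cancel₀ hw0.ne', mul_one,
      Real.norm_eq_abs]
    have := abs_norm_sub_norm_le w v
    rw [norm_sub_rev] at this
    linarith
  calc ‖v‖⁻¹ * _ ≤ 1 * _ := by
        gcongr
        exact inv_le_one_of_one_le₀ hv
    _ ≤ _ := by rw [one_mul]; exact h2

theorem HasDefiningFunctions.locallyLipschitzOn_normal {E : Set (Space n)}
    (hE : HasDefiningFunctions E) : LocallyLipschitzOn (frontier E) (normal E) := by
  intro x hx
  obtain ⟨Φ, G, h⟩ := hE x hx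
  obtain ⟨K, U, hU, hK⟩ := h.lipschitz
  refine ⟨2 * K, (U ∩ {y | y ∈ frontier E → IsExteriorNormal E y (‖G y‖⁻¹ • G y)}) ∩ frontier E,
    inter_mem (mem_nhdsWithin_of_mem_nhds (inter_mem hU h.isExteriorNormal)) self_mem_nhdsWithin,
    LipschitzOnWith.of_dist_le_mul ?_⟩
  rintro y ⟨⟨hyU, hy⟩, hyE⟩ z ⟨⟨hzU, hz⟩, hzE⟩
  rw [(hy hyE).normal_eq, (hz hzE).normal_eq, dist_eq_norm]
  refine (norm_normalize_sub_le (h.one_le_norm y) (h.one_le_norm z)).trans ?_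
  rw [← dist_eq_norm]
  push_cast
  rw [mul_assoc]
  gcongr
  exact hK.dist_le_mul _ hyU _ hzU

/-- An interior point strictly above the tangent plane would make the open segment from `x` to it
interior to `E`, although the normal excludes its points close to `x`. The closure follows, being
the closure of the interior. -/
theorem IsExteriorNormal.inner_sub_le_zero {E : Set (Space n)} (hc : Convex ℝ E)
    (hi : (interior E).Nonempty) {x v : Space n} (hx : x ∈ frontier E)
    (hv : IsExteriorNormal E x v) {y : Space n} (hy : y ∈ closure E) :
    inner ℝ (y - x) v ≤ 0 := by
  rw [← hc.closure_interior_eq_closure_of_nonempty_interior hi] at hy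
  refine closure_minimal (t := {y | inner ℝ (y - x) v ≤ 0}) (fun z hz => ?_)
    (isClosed_le (by fun_prop) continuous_const) hy
  by_contra! hpos
  simp only [mem_ofPred_eq, not_le] at hpos
  have hzx : 0 < ‖z - x‖ := by
    rw [norm_pos_iff]
    rintro h
    simp [h] at hpos
  set δ : ℝ := inner ℝ (z - x) v
  have hcont : Tendsto (fun t : ℝ => x + t • (z - x)) (𝓝[>] 0) (𝓝 x) := by
    have : Continuous fun t : ℝ => x + t • (z - x) := by fun_prop
    have := this.tendsto 0
    simp only [zero_smul, add_zero] at this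
    exact this.mono_left nhdsWithin_le_nhds
  have hlt : ∀ᶠ t : ℝ in 𝓝[>] 0, t ∈ Ioo (0 : ℝ) 1 := Ioo_mem_nhdsGT one_pos
  obtain ⟨t, ht, ht0, ht1⟩ := ((hcont.eventually (hv.2 (δ / (2 * ‖z - x‖))
    (by positivity))).and hlt).exists
  refine ht.2 ?_ (interior_subset (hc.openSegment_interior_closure_subset_interior hz hx.1
    ⟨t, 1 - t, ht0, by linarith, by ring, ?_⟩))
  · rw [add_sub_cancel_left, real_inner_smul_left, norm_smul, Real.norm_eq_abs, abs_of_pos ht0]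
    have : δ / (2 * ‖z - x‖) * (t * ‖z - x‖) = t * (δ / 2) := by field_simp
    rw [this]
    change t * (δ / 2) < t * δ
    nlinarith
  · module

/-! ### Polar coordinates and cone measures of homogeneous functions -/

/-- The projection `x ↦ x / p(x)` onto `{p = 1}` along rays. -/
def radialProj (p : Space n → ℝ) (x : Space n) : Space n := (p x)⁻¹ • x

/-- The cone measure on `{p = 1}`. -/
def coneMeasure (p : Space n → ℝ) : Measure (Space n) :=
  (n : ENNReal) • (volume.restrict {x | 0 < p x ∧ p x < 1}).map (radialProj p)

/-- The measure `s^{n-1} ds` on `(0, ∞)`. -/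
def powMeasure (n : ℕ) : Measure ℝ :=
  (volume.restrict (Ioi 0)).withDensity fun s => ENNReal.ofReal (s ^ (n - 1))

/-- Positively homogeneous measurable functions. -/
structure IsHomogeneous (p : Space n → ℝ) : Prop where
  measurable : Measurable p
  smul : ∀ t : ℝ, 0 < t → ∀ x, p (t • x) = t * p x

namespace IsHomogeneous

variable {p : Space n → ℝ}

theorem measurable_radialProj (hp : IsHomogeneous p) : Measurable (radialProj p) :=
  hp.measurable.inv.smul measurable_id

theorem radialProj_smul (hp : IsHomogeneous p) {t : ℝ} (ht : 0 < t) (x : Space n) :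
    radialProj p (t • x) = radialProj p x := by
  rw [radialProj, radialProj, hp.smul t ht, mul_inv, smul_smul, mul_right_comm,
    inv_mul_cancel₀ ht.ne', one_mul]

theorem coneMeasure_apply (hp : IsHomogeneous p) {A : Set (Space n)} (hA : MeasurableSet A) :
    coneMeasure p A = n * volume {x | 0 < p x ∧ p x < 1 ∧ radialProj p x ∈ A} := by
  rw [coneMeasure, Measure.smul_apply, Measure.map_apply hp.measurable_radialProj hA,
    Measure.restrict_apply (hp.measurable_radialProj hA), smul_eq_mul]
  congr 2
  ext x
  simp only [mem_inter_iff, mem_preimage, mem_ofPred_eq]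
  tauto

theorem volume_sector (hp : IsHomogeneous p) {b : ℝ} (hb : 0 < b) (A : Set (Space n)) :
    volume {x | 0 < p x ∧ p x < b ∧ radialProj p x ∈ A} =
      ENNReal.ofReal (b ^ n) * volume {x | 0 < p x ∧ p x < 1 ∧ radialProj p x ∈ A} := by
  have h := Measure.addHaar_smul (volume : Measure (Space n)) b
    {x | 0 < p x ∧ p x < 1 ∧ radialProj p x ∈ A}
  rw [finrank_euclideanSpace_fin, abs_of_pos (pow_pos hb n)] at h
  rw [← h]
  congr 1
  ext x
  rw [mem_smul_set_iff_inv_smul_mem₀ hb.ne']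
  simp only [mem_ofPred_eq, hp.radialProj_smul (inv_pos.2 hb), hp.smul _ (inv_pos.2 hb)]
  rw [mul_pos_iff_of_pos_left (inv_pos.2 hb), inv_mul_lt_iff₀ hb, mul_one]

/-- The part of `{0 < p < 1}` that projects into a ball lies in that ball, because `x = p x •
radialProj p x`. -/
theorem sigmaFinite_coneMeasure (hp : IsHomogeneous p) : SigmaFinite (coneMeasure p) := by
  refine ⟨⟨⟨fun k => Metric.closedBall 0 k, fun _ => trivial, fun k => ?_, ?_⟩⟩⟩
  · rw [hp.coneMeasure_apply measurableSet_closedBall]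
    refine ENNReal.mul_lt_top (ENNReal.natCast_lt_top n) ((measure_mono ?_).trans_lt
      (measure_closedBall_lt_top (x := (0 : Space n)) (r := k)))
    rintro x ⟨h0, h1, h2⟩
    rw [mem_closedBall_zero_iff] at h2 ⊢
    have : x = p x • radialProj p x := by
      rw [radialProj, smul_smul, mul_inv_cancel₀ h0.ne', one_smul]
    rw [this, norm_smul, Real.norm_eq_abs, abs_of_pos h0]
    nlinarith [norm_nonneg (radialProj p x)]
  · exact Metric.iUnion_closedBall_nat 0

end IsHomogeneous

theorem powMeasure_Iio (hn : 0 < n) {b : ℝ} (hb : 0 < b) :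
    powMeasure n (Iio b) = ENNReal.ofReal (b ^ n / n) := by
  rw [powMeasure, withDensity_apply _ measurableSet_Iio,
    Measure.restrict_restrict measurableSet_Iio,
    Iio_inter_Ioi, restrict_Ioo_eq_restrict_Ioc,
    ← ofReal_integral_eq_lintegral_ofReal, ← intervalIntegral.integral_of_le hb.le]
  · rw [integral_pow, Nat.sub_add_cancel hn, zero_pow hn.ne', sub_zero,
      Nat.cast_sub (show 1 ≤ n from hn)]
    simp
  · exact (intervalIntegral.intervalIntegrable_pow _).1
  · filter_upwards [ae_restrict_mem measurableSet_Ioc] with y hy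
    exact pow_nonneg hy.1.le _

theorem powMeasure_Iio_of_nonpos {b : ℝ} (hb : b ≤ 0) : powMeasure n (Iio b) = 0 := by
  rw [powMeasure, withDensity_apply _ measurableSet_Iio,
    Measure.restrict_restrict measurableSet_Iio,
    Iio_inter_Ioi, Ioo_eq_empty (by simpa using hb)]
  simp

/-- Polar coordinates with respect to a positively homogeneous function. -/
theorem IsHomogeneous.map_polar {p : Space n → ℝ} (hp : IsHomogeneous p) (hn : 0 < n) :
    (volume.restrict {x | 0 < p x}).map (fun x => (radialProj p x, p x)) =
      (coneMeasure p).prod (powMeasure n) := by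
  have := hp.sigmaFinite_coneMeasure
  symm
  -- Rectangles `s ×ˢ Iio b` suffice. Homogeneity contributes `b ^ n`, the radial factor has mass `b
  -- ^ n / n`, and the `n` in the cone measure cancels this denominator.
  refine Measure.prod_eq_generateFrom MeasurableSpace.generateFrom_measurableSet
    ((borel_eq_generateFrom_Iio ℝ).symm.trans BorelSpace.measurable_eq.symm)
    MeasurableSpace.isPiSystem_measurableSet isPiSystem_Iio
    (coneMeasure p).toFiniteSpanningSetsIn
    ⟨fun k => Iio ((k : ℝ) + 1), fun k => mem_range_self _, fun k => ?_, ?_⟩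
    fun s hs => forall_mem_range.2 fun b => ?_
  · rw [powMeasure_Iio hn (by positivity)]
    exact ENNReal.ofReal_lt_top
  · exact iUnion_eq_univ_iff.2 fun x => (exists_nat_gt x).imp fun k hk =>
      mem_Iio.2 (hk.trans (lt_add_one _))
  · replace hs : MeasurableSet s := hs
    have hm : Measurable fun x => (radialProj p x, p x) :=
      hp.measurable_radialProj.prodMk hp.measurable
    rw [Measure.map_apply hm (hs.prod measurableSet_Iio),
      Measure.restrict_apply (hm (hs.prod measurableSet_Iio))]
    have hset : (fun x => (radialProj p x, p x)) ⁻¹' s ×ˢ Iio b ∩ {x | 0 < p x} =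
        {x | 0 < p x ∧ p x < b ∧ radialProj p x ∈ s} := by
      ext x
      simp only [mem_inter_iff, mem_preimage, mem_prod, mem_Iio, mem_ofPred_eq]
      tauto
    rw [hset]
    rcases le_or_gt b 0 with hb | hb
    · rw [powMeasure_Iio_of_nonpos hb, mul_zero]
      have : {x | 0 < p x ∧ p x < b ∧ radialProj p x ∈ s} = ∅ :=
        eq_empty_of_forall_notMem fun x hx => by
          have h0 := hx.1
          have h1 := hx.2.1
          linarith
      rw [this, measure_empty]
    · rw [hp.volume_sector hb, powMeasure_Iio hn hb, hp.coneMeasure_apply hs,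
        ENNReal.ofReal_div_of_pos (by positivity), ENNReal.ofReal_natCast, mul_comm (n : ENNReal),
        mul_assoc, ENNReal.mul_div_cancel (by positivity) (by simp), mul_comm]

theorem integral_powMeasure (η : ℝ → ℝ) :
    ∫ s, η s ∂powMeasure n = ∫ s in Ioi 0, s ^ (n - 1) * η s := by
  rw [powMeasure, integral_withDensity_eq_integral_toReal_smul (by fun_prop)
    (Eventually.of_forall fun _ => ENNReal.ofReal_lt_top)]
  refine setIntegral_congr_fun measurableSet_Ioi fun s hs => ?_
  simp only [smul_eq_mul]
  rw [ENNReal.toReal_ofReal (pow_nonneg (le_of_lt hs) _)]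

theorem integrable_powMeasure {η : ℝ → ℝ} :
    Integrable η (powMeasure n) ↔ IntegrableOn (fun s => s ^ (n - 1) * η s) (Ioi 0) := by
  rw [powMeasure, integrable_withDensity_iff_integrable_smul' (by fun_prop)
    (Eventually.of_forall fun _ => ENNReal.ofReal_lt_top)]
  refine integrableOn_congr_fun (fun s hs => ?_) measurableSet_Ioi
  simp only [smul_eq_mul]
  rw [ENNReal.toReal_ofReal (pow_nonneg (le_of_lt hs) _)]

namespace IsHomogeneous

variable {p : Space n → ℝ}

theorem integral_polar (hp : IsHomogeneous p) (hn : 0 < n) {f : Space n × ℝ → ℝ}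
    (hf : AEStronglyMeasurable f ((coneMeasure p).prod (powMeasure n))) :
    ∫ x in {x | 0 < p x}, f (radialProj p x, p x) =
      ∫ z, f z ∂(coneMeasure p).prod (powMeasure n) := by
  have hm : Measurable fun x => (radialProj p x, p x) :=
    hp.measurable_radialProj.prodMk hp.measurable
  rw [← hp.map_polar hn] at hf ⊢
  rw [integral_map hm.aemeasurable hf]

theorem integrable_polar (hp : IsHomogeneous p) (hn : 0 < n) {f : Space n × ℝ → ℝ}
    (hf : AEStronglyMeasurable f ((coneMeasure p).prod (powMeasure n))) :
    IntegrableOn (fun x => f (radialProj p x, p x)) {x | 0 < p x} ↔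
      Integrable f ((coneMeasure p).prod (powMeasure n)) := by
  have hm : Measurable fun x => (radialProj p x, p x) :=
    hp.measurable_radialProj.prodMk hp.measurable
  rw [← hp.map_polar hn] at hf ⊢
  rw [integrable_map_measure hf hm.aemeasurable]
  rfl

end IsHomogeneous

/-! ### Local comparison of measures and cones over flat sets -/

/-- Second countability gives a countable subcover; made disjoint, it splits any measurable set into
pieces on which the local inequality applies. -/
theorem measure_le_of_locally_le {X : Type*} [TopologicalSpace X] [SecondCountableTopology X]
    [MeasurableSpace X] [OpensMeasurableSpace X] [Nonempty X] {μ ν : Measure X}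
    (h : ∀ x, ∃ U ∈ 𝓝 x, ∀ A ⊆ U, MeasurableSet A → μ A ≤ ν A) : μ ≤ ν := by
  choose U hU hA using h
  obtain ⟨t, htc, ht⟩ := TopologicalSpace.countable_cover_nhds fun x => interior_mem_nhds.2 (hU x)
  have htn : t.Nonempty := by
    rw [nonempty_iff_ne_empty]
    rintro rfl
    simp only [mem_empty_iff_false, iUnion_of_empty, iUnion_empty] at ht
    exact empty_ne_univ ht
  obtain ⟨f, rfl⟩ := htc.exists_eq_range htn
  rw [biUnion_range] at ht
  have hm : ∀ i, MeasurableSet (disjointed (fun i => interior (U (f i))) i) :=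
    MeasurableSet.disjointed fun i => isOpen_interior.measurableSet
  refine Measure.le_iff.2 fun s hs => ?_
  have hs' : s = ⋃ i, s ∩ disjointed (fun i => interior (U (f i))) i := by
    rw [← inter_iUnion, iUnion_disjointed, ht, inter_univ]
  have hd : Pairwise (Function.onFun Disjoint
      fun i => s ∩ disjointed (fun i => interior (U (f i))) i) := fun i j hij =>
    (disjoint_disjointed _ hij).mono inter_subset_right inter_subset_right
  rw [hs', measure_iUnion hd fun i => hs.inter (hm i), measure_iUnion hd fun i => hs.inter (hm i)]
  refine ENNReal.tsum_le_tsum fun i => hA (f i) _ ?_ (hs.inter (hm i))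
  exact inter_subset_right.trans ((disjointed_le _ i).trans interior_subset)

theorem isHomogeneous_inner_div (v : Space n) (c : ℝ) :
    IsHomogeneous fun x : Space n => inner ℝ x v / c where
  measurable := by fun_prop
  smul t _ x := by rw [real_inner_smul_left, mul_div_assoc]

open scoped Pointwise in
/-- The cone over a subset of a hyperplane. -/
theorem coneMeasure_hyperplane (hn : 0 < n) {v : Space n} (hv : ‖v‖ = 1) {c : ℝ} (hc : 0 < c)
    {B : Set (Space n)} (hB : MeasurableSet B) (hBc : ∀ x ∈ B, inner ℝ x v = c) :
    coneMeasure (fun x => inner ℝ x v / c) B =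
      ENNReal.ofReal c * Measure.euclideanHausdorffMeasure (n - 1) B := by
  have hp := isHomogeneous_inner_div v c
  set p : Space n → ℝ := fun x => inner ℝ x v / c with hpdef
  set T : Set (Space n) := {x | 0 < p x ∧ p x < 1 ∧ radialProj p x ∈ B}
  have hT : MeasurableSet T :=
    (measurableSet_lt measurable_const hp.measurable).inter
      ((measurableSet_lt hp.measurable measurable_const).inter (hp.measurable_radialProj hB))
  -- Fubini in the direction `v`: the slice of the cone at height `s` is `(s / c) • B`, and the
  -- integral of `(s / c) ^ (n - 1)` over `(0, c)` is `c / n`.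
  have hslice : ∀ s : ℝ, T ∩ AffineSubspace.mk' (s • v +ᵥ (0 : Space n))
      (Submodule.span ℝ {v})ᗮ = if s ∈ Ioo 0 c then (s / c) • B else ∅ := by
    intro s
    have hmem : ∀ x : Space n, x ∈ AffineSubspace.mk' (s • v +ᵥ (0 : Space n))
        (Submodule.span ℝ {v})ᗮ ↔ inner ℝ x v = s := by
      intro x
      rw [AffineSubspace.mem_mk', Submodule.mem_orthogonal_singleton_iff_inner_left]
      simp [inner_sub_left, real_inner_smul_left, hv, sub_eq_zero]
    ext x
    simp only [mem_inter_iff, SetLike.mem_coe, hmem]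
    split_ifs with hs
    · have hsc : 0 < s / c := div_pos hs.1 hc
      rw [mem_smul_set_iff_inv_smul_mem₀ hsc.ne']
      constructor
      · rintro ⟨⟨-, -, h⟩, hxs⟩
        simpa [radialProj, hpdef, hxs] using h
      · intro h
        have hx := hBc _ h
        rw [real_inner_smul_left, inv_mul_eq_iff_eq_mul₀ hsc.ne', div_mul_cancel₀ _ hc.ne'] at hx
        refine ⟨⟨?_, ?_, ?_⟩, hx⟩
        · simp only [hpdef, hx]; exact hsc
        · simp only [hpdef, hx]; rw [div_lt_one hc]; exact hs.2
        · simpa only [radialProj, hpdef, hx] using h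
    · simp only [mem_empty_iff_false, iff_false]
      rintro ⟨⟨h0, h1, -⟩, rfl⟩
      simp only [hpdef] at h0 h1
      rw [div_lt_one hc] at h1
      exact hs ⟨(div_pos_iff_of_pos_right hc).1 h0, h1⟩
  have hv0 : v ≠ 0 := by rintro rfl; simp at hv
  have h := EuclideanGeometry.euclideanHausdorffMeasure_eq_lintegral (0 : Space n) hv0 hT
  rw [finrank_euclideanSpace_fin, EuclideanSpace.euclideanHausdorffMeasure_eq_volume] at h
  simp_rw [hslice] at h
  rw [hp.coneMeasure_apply hB]
  change n * volume T = _
  rw [h, ← ofReal_norm, hv, ENNReal.ofReal_one, one_mul]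
  have hint : ∀ s : ℝ, Measure.euclideanHausdorffMeasure (n - 1)
      (if s ∈ Ioo 0 c then (s / c) • B else ∅) =
      (Ioo 0 c).indicator (fun s => ENNReal.ofReal (s ^ (n - 1)) *
        (ENNReal.ofReal ((c ^ (n - 1))⁻¹) * Measure.euclideanHausdorffMeasure (n - 1) B)) s := by
    intro s
    by_cases hs : s ∈ Ioo 0 c
    · have hsc : 0 < s / c := div_pos hs.1 hc
      rw [if_pos hs, indicator_of_mem hs, Measure.euclideanHausdorffMeasure_smul₀ _ hsc.ne',
        ← mul_assoc, ← ENNReal.ofReal_mul (pow_nonneg hs.1.le _), ← div_eq_mul_inv, ← div_pow,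
        ENNReal.smul_def, smul_eq_mul]
      congr 1
      rw [ENNReal.coe_pow, ENNReal.ofReal_pow hsc.le, ← Real.enorm_of_nonneg hsc.le,
          enorm_eq_nnnorm]
    · rw [if_neg hs, indicator_of_notMem hs, measure_empty]
  simp_rw [hint]
  rw [lintegral_indicator measurableSet_Ioo, lintegral_mul_const _ (by fun_prop)]
  have hpow := powMeasure_Iio hn hc
  rw [powMeasure, withDensity_apply _ measurableSet_Iio,
    Measure.restrict_restrict measurableSet_Iio, Iio_inter_Ioi] at hpow
  rw [hpow, ← mul_assoc, ← mul_assoc, ← ENNReal.ofReal_natCast,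
    ← ENNReal.ofReal_mul (by positivity),
    ← ENNReal.ofReal_mul (by positivity)]
  congr 2
  obtain ⟨k, rfl⟩ := Nat.exists_eq_succ_of_ne_zero hn.ne'
  simp only [Nat.succ_eq_add_one, Nat.add_sub_cancel]
  field_simp
  ring

theorem LipschitzOnWith.euclideanHausdorffMeasure_image_le {X Y : Type*} [EMetricSpace X]
    [EMetricSpace Y] [MeasurableSpace X] [BorelSpace X] [MeasurableSpace Y] [BorelSpace Y]
    {K : NNReal} {f : X → Y} {s : Set X} (h : LipschitzOnWith K f s) (d : ℕ) :
    Measure.euclideanHausdorffMeasure d (f '' s) ≤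
      (K : ENNReal) ^ d * Measure.euclideanHausdorffMeasure d s := by
  rw [Measure.euclideanHausdorffMeasure_def, Measure.euclideanHausdorffMeasure_def,
    Measure.smul_apply, Measure.smul_apply, ENNReal.smul_def, ENNReal.smul_def, smul_eq_mul,
    smul_eq_mul, mul_left_comm]
  gcongr
  simpa using h.hausdorffMeasure_image_le (d := d) (by positivity)

/-! ### The cone measure of a regular convex set as a surface measure -/

/-- Convex neighbourhoods of the origin with a locally Lipschitz exterior normal. -/
structure IsRegularConvex (E : Set (Space n)) : Prop where
  convex : Convex ℝ E
  mem_nhds : E ∈ 𝓝 (0 : Space n)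
  norm_normal : ∀ x ∈ frontier E, ‖normal E x‖ = 1
  inner_sub_le_zero : ∀ x ∈ frontier E, ∀ y ∈ closure E, inner ℝ (y - x) (normal E x) ≤ 0
  locallyLipschitzOn : LocallyLipschitzOn (frontier E) (normal E)

theorem isHomogeneous_gauge {E : Set (Space n)} (hc : Convex ℝ E) (h0 : E ∈ 𝓝 (0 : Space n)) :
    IsHomogeneous (gauge E) where
  measurable := (continuous_gauge hc h0).measurable
  smul t ht x := by rw [gauge_smul_of_nonneg ht.le, smul_eq_mul]

namespace IsRegularConvex

variable {E : Set (Space n)} (hE : IsRegularConvex E)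

include hE

theorem isHomogeneous : IsHomogeneous (gauge E) := isHomogeneous_gauge hE.convex hE.mem_nhds

theorem gauge_eq_one_iff {x : Space n} : gauge E x = 1 ↔ x ∈ frontier E :=
  gauge_eq_one_iff_mem_frontier hE.convex hE.mem_nhds

theorem radialProj_mem {x : Space n} (hx : 0 < gauge E x) :
    radialProj (gauge E) x ∈ frontier E := by
  rw [← hE.gauge_eq_one_iff, radialProj, hE.isHomogeneous.smul _ (inv_pos.2 hx),
    inv_mul_cancel₀ hx.ne']

omit hE in
theorem smul_radialProj {p : Space n → ℝ} {x : Space n} (hx : 0 < p x) :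
    p x • radialProj p x = x := by
  rw [radialProj, smul_smul, mul_inv_cancel₀ hx.ne', one_smul]

theorem radialProj_of_mem {x : Space n} (hx : x ∈ frontier E) : radialProj (gauge E) x = x := by
  rw [radialProj, hE.gauge_eq_one_iff.2 hx, inv_one, one_smul]

theorem exists_le_inner : ∃ δ > 0, ∀ x ∈ frontier E, δ ≤ inner ℝ x (normal E x) := by
  obtain ⟨δ, hδ, hb⟩ := Metric.nhds_basis_closedBall.mem_iff.1 hE.mem_nhds
  refine ⟨δ, hδ, fun x hx => ?_⟩
  have hy : δ • normal E x ∈ E := hb (by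
    rw [mem_closedBall_zero_iff, norm_smul, hE.norm_normal x hx, mul_one, Real.norm_eq_abs,
      abs_of_pos hδ])
  have := hE.inner_sub_le_zero x hx _ (subset_closure hy)
  rw [inner_sub_left, real_inner_smul_left, real_inner_self_eq_norm_sq, hE.norm_normal x hx] at this
  linarith

theorem inner_pos {x : Space n} (hx : x ∈ frontier E) : 0 < inner ℝ x (normal E x) := by
  obtain ⟨δ, hδ, h⟩ := hE.exists_le_inner
  exact hδ.trans_le (h x hx)

theorem inner_le_norm {x : Space n} (hx : x ∈ frontier E) : inner ℝ x (normal E x) ≤ ‖x‖ := by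
  have := real_inner_le_norm x (normal E x)
  rwa [hE.norm_normal x hx, mul_one] at this

theorem continuousOn_normal : ContinuousOn (normal E) (frontier E) :=
  hE.locallyLipschitzOn.continuousOn

theorem continuousOn_inner_normal :
    ContinuousOn (fun x => inner ℝ x (normal E x)) (frontier E) :=
  continuousOn_id.inner hE.continuousOn_normal

/-- Near a boundary point, the radial projection to the tangent plane is almost an isometry. -/
theorem eventually_radialProj_tangent {x₀ : Space n} (hx₀ : x₀ ∈ frontier E) {τ : ℝ} (hτ : 0 < τ) :
    ∃ U ∈ 𝓝 x₀, ∀ a ∈ U ∩ frontier E,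
      |(inner ℝ a (normal E x₀) / inner ℝ x₀ (normal E x₀))⁻¹ - 1| ≤ τ ∧
      0 < inner ℝ a (normal E x₀) / inner ℝ x₀ (normal E x₀) ∧
      ∀ b ∈ U ∩ frontier E,
        ‖radialProj (fun x => inner ℝ x (normal E x₀) / inner ℝ x₀ (normal E x₀)) a -
          radialProj (fun x => inner ℝ x (normal E x₀) / inner ℝ x₀ (normal E x₀)) b - (a - b)‖
          ≤ τ * ‖a - b‖ := by
  set v := normal E x₀
  set c : ℝ := inner ℝ x₀ v
  have hc : 0 < c := hE.inner_pos hx₀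
  set p : Space n → ℝ := fun x => inner ℝ x v / c with hp
  have hpc : Continuous p := by fun_prop
  have hp1 : p x₀ = 1 := div_self hc.ne'
  set R := ‖x₀‖ + 1
  have hR : 0 < R := by positivity
  -- Chosen so that the second error term below, `2 * 2 * (δ * ‖a - b‖ / c) * R`, is exactly `τ / 2
  -- * ‖a - b‖`.
  set δ := τ / 2 * c / (4 * R) with hδ
  have hδ0 : 0 < δ := by positivity
  have h1 : ∀ᶠ a in 𝓝 x₀, (p a ∈ Ioi (1 / 2 : ℝ) ∧ |(p a)⁻¹ - 1| < min τ (τ / 2)) ∧ ‖a‖ < R := by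
    refine Filter.Eventually.and (Filter.Eventually.and ?_ ?_) ?_
    · exact hpc.continuousAt.eventually (by rw [hp1]; exact Ioi_mem_nhds (by norm_num))
    · have hcont : ContinuousAt (fun a => |(p a)⁻¹ - 1|) x₀ :=
        ((hpc.continuousAt.inv₀ (by rw [hp1]; exact one_ne_zero)).sub continuousAt_const).abs
      exact hcont.eventually_lt continuousAt_const (by simp [hp1, hτ])
    · exact continuous_norm.continuousAt.eventually_lt continuousAt_const (by simp [R])
  have h2 : ∀ᶠ a in 𝓝[frontier E] x₀, ‖normal E a - v‖ < δ := by
    have := (hE.continuousOn_normal x₀ hx₀)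
    have := Metric.tendsto_nhds.1 this δ hδ0
    simpa only [dist_eq_norm] using this
  rw [eventually_nhdsWithin_iff] at h2
  refine ⟨{a | _}, h1.and h2, ?_⟩
  rintro a ⟨⟨⟨⟨hpa, hpa'⟩, ha⟩, hva⟩, haE⟩
  replace hpa : 1 / 2 < p a := hpa
  have hpa0 : 0 < p a := by linarith
  refine ⟨(hpa'.trans_le (min_le_left _ _)).le, hpa0, ?_⟩
  rintro b ⟨⟨⟨⟨hpb, hpb'⟩, hb⟩, hvb⟩, hbE⟩
  replace hpb : 1 / 2 < p b := hpb
  have hpb0 : 0 < p b := by linarith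
  -- Each boundary point lies below the tangent plane at the other, and both normals are `δ`-close
  -- to `v`; used in both orders this bounds the `v`-component of `a - b` on both sides.
  have key : ∀ y ∈ frontier E, ∀ z ∈ frontier E, ‖normal E y - v‖ < δ →
      inner ℝ (z - y) v ≤ δ * ‖z - y‖ := by
    intro y hy z hz hyv
    have e1 := hE.inner_sub_le_zero y hy z hz.1
    have e2 : inner ℝ (z - y) v =
        inner ℝ (z - y) (normal E y) - inner ℝ (z - y) (normal E y - v) := by
      rw [inner_sub_right]; ring
    have e3 := abs_real_inner_le_norm (z - y) (normal E y - v)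
    have e4 := neg_abs_le (inner ℝ (z - y) (normal E y - v))
    nlinarith [norm_nonneg (z - y)]
  have hk1 := key a haE b hbE (hva haE)
  have hk2 := key b hbE a haE (hvb hbE)
  have hk : |inner ℝ (b - a) v| ≤ δ * ‖a - b‖ := by
    rw [abs_le]
    rw [norm_sub_rev] at hk1
    have : inner ℝ (a - b) v = -inner ℝ (b - a) v := by rw [← inner_neg_left, neg_sub]
    constructor <;> linarith
  have hdiff : radialProj p a - radialProj p b - (a - b) =
      ((p a)⁻¹ - 1) • (a - b) + ((p a)⁻¹ * (p b)⁻¹ * (inner ℝ (b - a) v / c)) • b := by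
    have : inner ℝ (b - a) v / c = p b - p a := by
      rw [inner_sub_left, sub_div]
    rw [this, radialProj, radialProj]
    have h3 : (p a)⁻¹ * (p b)⁻¹ * (p b - p a) = (p a)⁻¹ - (p b)⁻¹ := by field_simp
    rw [h3]
    module
  change ‖radialProj p a - radialProj p b - (a - b)‖ ≤ τ * ‖a - b‖
  rw [hdiff]
  have hia : (p a)⁻¹ ≤ 2 := by rw [inv_le_comm₀ hpa0 two_pos]; linarith
  have hib : (p b)⁻¹ ≤ 2 := by rw [inv_le_comm₀ hpb0 two_pos]; linarith
  calc _ ≤ ‖((p a)⁻¹ - 1) • (a - b)‖ + ‖((p a)⁻¹ * (p b)⁻¹ * (inner ℝ (b - a) v / c)) • b‖ :=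
        norm_add_le _ _
    _ ≤ τ / 2 * ‖a - b‖ + 2 * 2 * (δ * ‖a - b‖ / c) * R := by
      rw [norm_smul, norm_smul, norm_mul, norm_mul, norm_div, norm_inv, norm_inv, Real.norm_eq_abs,
        Real.norm_eq_abs, Real.norm_eq_abs, Real.norm_eq_abs, Real.norm_eq_abs, abs_of_pos hpa0,
        abs_of_pos hpb0, abs_of_pos hc]
      gcongr
      exact (hpa'.trans_le (min_le_right _ _)).le
    _ = τ * ‖a - b‖ := by rw [hδ]; field_simp; ring

/-- Local comparison of the cone measure with the Hausdorff measure. -/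
theorem exists_coneMeasure_comparison (hn : 0 < n) {x₀ : Space n} (hx₀ : x₀ ∈ frontier E)
    {l : NNReal} (hl : 1 < l) :
    ∃ U ∈ 𝓝 x₀, ∀ A ⊆ U ∩ frontier E, MeasurableSet A →
      coneMeasure (gauge E) A ≤ (l : ENNReal) ^ (n - 1) *
        (ENNReal.ofReal (inner ℝ x₀ (normal E x₀)) * Measure.euclideanHausdorffMeasure (n - 1) A) ∧
      ENNReal.ofReal (inner ℝ x₀ (normal E x₀)) * Measure.euclideanHausdorffMeasure (n - 1) A ≤
        (l : ENNReal) ^ (n - 1) * ((l : ENNReal) ^ n * coneMeasure (gauge E) A) := by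
  have hl' : (1 : ℝ) < l := by exact_mod_cast hl
  have hl0 : (0 : ℝ) < l := by linarith
  -- With `τ = 1 - 1/l` the projection is `l`-Lipschitz, because `1 + τ ≤ l` amounts to `l + 1/l ≥
  -- 2`, and so is its inverse, because `1 - τ = 1/l`.
  obtain ⟨U, hU, h⟩ := hE.eventually_radialProj_tangent hx₀
    (τ := 1 - (l : ℝ)⁻¹) (by have := inv_lt_one_of_one_lt₀ hl'; linarith)
  refine ⟨U, hU, fun A hAU hA => ?_⟩
  set v := normal E x₀
  set c : ℝ := inner ℝ x₀ v
  have hc : 0 < c := hE.inner_pos hx₀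
  set p : Space n → ℝ := fun x => inner ℝ x v / c with hp
  have hph : IsHomogeneous p := isHomogeneous_inner_div v c
  have hg := hE.isHomogeneous
  have htwo : 2 ≤ (l : ℝ) + (l : ℝ)⁻¹ := by
    have : (l : ℝ) + (l : ℝ)⁻¹ - 2 = (l - 1) ^ 2 / l := by field_simp; ring
    have h2 : 0 ≤ ((l : ℝ) - 1) ^ 2 / l := by positivity
    linarith
  have hlip : LipschitzOnWith l (radialProj p) A := by
    refine LipschitzOnWith.of_dist_le_mul fun a ha b hb => ?_
    rw [dist_eq_norm, dist_eq_norm]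
    have h1 := (h a (hAU ha)).2.2 b (hAU hb)
    have h2 := norm_sub_norm_le (radialProj p a - radialProj p b) (a - b)
    change ‖radialProj p a - radialProj p b - (a - b)‖ ≤ _ at h1
    nlinarith [norm_nonneg (a - b)]
  have hanti : ∀ a ∈ A, ∀ b ∈ A, ‖a - b‖ ≤ l * ‖radialProj p a - radialProj p b‖ := by
    intro a ha b hb
    have h1 := (h a (hAU ha)).2.2 b (hAU hb)
    have h2 := norm_sub_norm_le (a - b) (radialProj p a - radialProj p b)
    change ‖radialProj p a - radialProj p b - (a - b)‖ ≤ _ at h1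
    rw [norm_sub_rev] at h1
    have h3 : (l : ℝ)⁻¹ * ‖a - b‖ ≤ ‖radialProj p a - radialProj p b‖ := by linarith
    rwa [inv_mul_le_iff₀ hl0] at h3
  have hinj : InjOn (radialProj p) A := fun a ha b hb hab => by
    have := hanti a ha b hb
    rw [hab, sub_self, norm_zero, mul_zero] at this
    exact sub_eq_zero.1 (norm_le_zero_iff.1 this)
  set S := radialProj p '' A
  have hS : MeasurableSet S := hA.image_of_continuousOn_injOn hlip.continuousOn hinj
  have hinv : LipschitzOnWith l (Function.invFunOn (radialProj p) A) S := by
    refine LipschitzOnWith.of_dist_le_mul ?_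
    rintro _ ⟨a, ha, rfl⟩ _ ⟨b, hb, rfl⟩
    rw [hinj.leftInvOn_invFunOn ha, hinj.leftInvOn_invFunOn hb, dist_eq_norm, dist_eq_norm]
    exact hanti a ha b hb
  have hinvS : Function.invFunOn (radialProj p) A '' S = A :=
    hinj.leftInvOn_invFunOn.image_image
  have hH1 := LipschitzOnWith.euclideanHausdorffMeasure_image_le hlip (n - 1)
  have hH2 := LipschitzOnWith.euclideanHausdorffMeasure_image_le hinv (n - 1)
  rw [hinvS] at hH2
  have hflat : coneMeasure p S =
      ENNReal.ofReal c * Measure.euclideanHausdorffMeasure (n - 1) S := by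
    refine coneMeasure_hyperplane hn (hE.norm_normal x₀ hx₀) hc hS ?_
    rintro _ ⟨a, ha, rfl⟩
    have hpa : 0 < p a := (h a (hAU ha)).2.1
    rw [radialProj, real_inner_smul_left]
    have : inner ℝ a v = p a * c := by rw [hp]; field_simp
    rw [this, inv_mul_cancel_left₀ hpa.ne']
  have hpA : ∀ a ∈ A, p a ≤ 1 ∧ (p a)⁻¹ < l := by
    intro a ha
    constructor
    · have := hE.inner_sub_le_zero x₀ hx₀ a (hAU ha).2.1
      rw [inner_sub_left] at this
      rw [hp]
      simp only
      rw [div_le_one hc]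
      linarith
    · have h1 := (h a (hAU ha)).1
      change |(p a)⁻¹ - 1| ≤ _ at h1
      have := (abs_le.1 h1).2
      have h4 : 0 < (l : ℝ) - 1 := by linarith
      have h5 : (l : ℝ) + (l : ℝ)⁻¹ - 2 = (l - 1) ^ 2 / l := by field_simp; ring
      have h6 : 0 < ((l : ℝ) - 1) ^ 2 / l := by positivity
      linarith
  -- `E` lies below its tangent plane, so `p ≤ 1` on `A` and the cone up to `A` is contained in the
  -- cone up to its projection `S`.
  have hκ1 : coneMeasure (gauge E) A ≤ coneMeasure p S := by
    rw [hg.coneMeasure_apply hA, hph.coneMeasure_apply hS]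
    gcongr n * volume ?_
    rintro x ⟨h0, h1, hxA⟩
    have hpa : 0 < p (radialProj (gauge E) x) := (h _ (hAU hxA)).2.1
    have hpx : p x = gauge E x * p (radialProj (gauge E) x) := by
      rw [← hph.smul _ h0, smul_radialProj h0]
    refine ⟨by rw [hpx]; positivity, ?_, ?_⟩
    · rw [hpx]
      nlinarith [(hpA _ hxA).1]
    · have : radialProj p x = radialProj p (radialProj (gauge E) x) := by
        conv_lhs => rw [← smul_radialProj h0, hph.radialProj_smul h0]
      rw [this]
      exact mem_image_of_mem _ hxA
  -- Conversely `1 / p < l` on `A`, so the cone up to `S`, shrunk by `1 / l`, fits in the cone up to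
  -- `A`; the scaling costs the factor `l ^ n`.
  have hκ2 : coneMeasure p S ≤ (l : ENNReal) ^ n * coneMeasure (gauge E) A := by
    rw [hg.coneMeasure_apply hA, hph.coneMeasure_apply hS, mul_left_comm]
    gcongr n * ?_
    have hv := hph.volume_sector (inv_pos.2 hl0) S
    have hle : volume {x | 0 < p x ∧ p x < (l : ℝ)⁻¹ ∧ radialProj p x ∈ S} ≤
        volume {x | 0 < gauge E x ∧ gauge E x < 1 ∧ radialProj (gauge E) x ∈ A} := by
      refine measure_mono ?_
      rintro x ⟨h0, h1, a, ha, hax⟩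
      have hpa : 0 < p a := (h a (hAU ha)).2.1
      have hx : x = (p x * (p a)⁻¹) • a := by
        rw [mul_smul]
        change x = p x • radialProj p a
        rw [hax, smul_radialProj h0]
      have hga : gauge E a = 1 := hE.gauge_eq_one_iff.2 (hAU ha).2
      have ht : 0 < p x * (p a)⁻¹ := by positivity
      have hgx : gauge E x = p x * (p a)⁻¹ := by
        conv_lhs => rw [hx]
        rw [hg.smul _ ht, hga, mul_one]
      refine ⟨by rw [hgx]; exact ht, ?_, ?_⟩
      · rw [hgx]
        calc p x * (p a)⁻¹ ≤ p x * l := by gcongr; exact (hpA a ha).2.le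
          _ < (l : ℝ)⁻¹ * l := by gcongr
          _ = 1 := inv_mul_cancel₀ hl0.ne'
      · rw [hx, hg.radialProj_smul ht, hE.radialProj_of_mem (hAU ha).2]
        exact ha
    rw [hv, inv_pow, ENNReal.ofReal_inv_of_pos (by positivity), ENNReal.ofReal_pow hl0.le,
      ENNReal.ofReal_coe_nnreal] at hle
    rwa [← ENNReal.inv_mul_le_iff]
    · exact pow_ne_zero _ (by exact_mod_cast (by positivity : (0 : NNReal) < l).ne')
    · exact ENNReal.pow_ne_top ENNReal.coe_ne_top
  constructor
  · calc coneMeasure (gauge E) A ≤ coneMeasure p S := hκ1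
      _ = ENNReal.ofReal c * Measure.euclideanHausdorffMeasure (n - 1) S := hflat
      _ ≤ ENNReal.ofReal c * (l ^ (n - 1) * Measure.euclideanHausdorffMeasure (n - 1) A) := by
        gcongr
      _ = _ := mul_left_comm _ _ _
  · calc ENNReal.ofReal c * Measure.euclideanHausdorffMeasure (n - 1) A
        ≤ ENNReal.ofReal c * (l ^ (n - 1) * Measure.euclideanHausdorffMeasure (n - 1) S) :=
          mul_le_mul_right hH2 _
      _ = l ^ (n - 1) * coneMeasure p S := by rw [hflat, mul_left_comm]
      _ ≤ _ := by gcongr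

end IsRegularConvex

theorem le_of_forall_one_lt_pow_mul {μ ν : Measure (Space n)} {k : ℕ}
    (h : ∀ l : NNReal, 1 < l → μ ≤ ((l : ENNReal) ^ k) • ν) : μ ≤ ν := by
  refine Measure.le_iff.2 fun s _ => ?_
  have ht : Tendsto (fun l : NNReal => (l : ENNReal) ^ k * ν s) (𝓝[>] 1) (𝓝 (ν s)) := by
    have h1 : Tendsto (fun l : NNReal => (l : ENNReal) ^ k) (𝓝[>] 1) (𝓝 (1 : ENNReal)) := by
      have : Continuous fun l : NNReal => (l : ENNReal) ^ k :=
        (ENNReal.continuous_pow k).comp ENNReal.continuous_coe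
      have := this.tendsto 1
      simp only [ENNReal.coe_one, one_pow] at this
      exact this.mono_left nhdsWithin_le_nhds
    have h2 := ENNReal.Tendsto.mul_const (b := ν s) h1 (Or.inl one_ne_zero)
    rwa [one_mul] at h2
  refine ge_of_tendsto ht ?_
  filter_upwards [self_mem_nhdsWithin] with l hl
  have := h l hl s
  rwa [Measure.smul_apply, smul_eq_mul] at this

namespace IsRegularConvex

variable {E : Set (Space n)} (hE : IsRegularConvex E)

include hE

theorem coneMeasure_compl_frontier {A : Set (Space n)} (hA : MeasurableSet A)
    (h : Disjoint A (frontier E)) : coneMeasure (gauge E) A = 0 := by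
  rw [hE.isHomogeneous.coneMeasure_apply hA]
  have : {x | 0 < gauge E x ∧ gauge E x < 1 ∧ radialProj (gauge E) x ∈ A} = ∅ :=
    eq_empty_of_forall_notMem fun x hx =>
      disjoint_left.1 h hx.2.2 (hE.radialProj_mem hx.1)
  rw [this, measure_empty, mul_zero]

omit hE in
theorem withDensity_boundaryMeasure_apply {A : Set (Space n)} (hA : MeasurableSet A)
    (f : Space n → ENNReal) :
    (boundaryMeasure E).withDensity f A =
      ∫⁻ x in A ∩ frontier E, f x ∂Measure.euclideanHausdorffMeasure (n - 1) := by
  rw [withDensity_apply _ hA, boundaryMeasure, Measure.restrict_restrict hA]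

/-- The cone measure of `E` is the boundary measure with density `⟨x, ν⟩`. -/
theorem coneMeasure_eq (hn : 0 < n) :
    coneMeasure (gauge E) =
      (boundaryMeasure E).withDensity fun x => ENNReal.ofReal (inner ℝ x (normal E x)) := by
  set κ := coneMeasure (gauge E)
  set ρ := (boundaryMeasure E).withDensity fun x => ENNReal.ofReal (inner ℝ x (normal E x))
  have hF : MeasurableSet (frontier E) := isClosed_frontier.measurableSet
  -- The exponent `2 * n` collects `l ^ (n - 1)` from the Lipschitz bounds, `l ^ n` from the
  -- shrinking and one `l` from the oscillation of `⟨x, ν⟩`. Globalizing and letting `l` tend to `1`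
  -- gives equality.
  have hlocal : ∀ l : NNReal, 1 < l → ∀ x, ∃ U ∈ 𝓝 x, ∀ A ⊆ U, MeasurableSet A →
      κ A ≤ (l : ENNReal) ^ (2 * n) * ρ A ∧ ρ A ≤ (l : ENNReal) ^ (2 * n) * κ A := by
    intro l hl x
    have hl0 : (l : ENNReal) ≠ 0 := by simpa using (zero_lt_one.trans hl).ne'
    have hl1 : (1 : ENNReal) ≤ l := by exact_mod_cast hl.le
    by_cases hx : x ∈ frontier E
    · obtain ⟨U, hU, h⟩ := hE.exists_coneMeasure_comparison hn hx hl
      set c : ℝ := inner ℝ x (normal E x)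
      have hc : 0 < c := hE.inner_pos hx
      have hl' : (1 : ℝ) < l := by exact_mod_cast hl
      have h2 : ∀ᶠ a in 𝓝[frontier E] x, inner ℝ a (normal E a) < l * c ∧
          c < l * inner ℝ a (normal E a) := by
        have hc1 := hE.continuousOn_inner_normal x hx
        refine (hc1.eventually_lt tendsto_const_nhds ?_).and
          (tendsto_const_nhds.eventually_lt (hc1.const_mul (l : ℝ)) ?_)
        · change c < l * c
          nlinarith
        · change c < l * c
          nlinarith
      rw [eventually_nhdsWithin_iff] at h2
      refine ⟨_, inter_mem hU h2, fun A hAU hA => ?_⟩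
      have hAF : MeasurableSet (A ∩ frontier E) := hA.inter hF
      obtain ⟨h3, h4⟩ := h (A ∩ frontier E)
        (inter_subset_inter_left _ (hAU.trans inter_subset_left)) hAF
      have hκ : κ A = κ (A ∩ frontier E) := by
        rw [← measure_inter_add_sdiff A hF, hE.coneMeasure_compl_frontier (hA.diff hF)
          disjoint_sdiff_left, add_zero]
      have hρ : ρ A = ∫⁻ x in A ∩ frontier E, ENNReal.ofReal (inner ℝ x (normal E x))
          ∂Measure.euclideanHausdorffMeasure (n - 1) := withDensity_boundaryMeasure_apply hA _
      set H := (Measure.euclideanHausdorffMeasure (n - 1) : Measure (Space n)) (A ∩ frontier E)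
      have hρ1 : ρ A ≤ l * (ENNReal.ofReal c * H) := by
        rw [hρ, ← mul_assoc, ← setLIntegral_const]
        refine setLIntegral_mono' hAF fun a ha => ?_
        rw [← ENNReal.ofReal_coe_nnreal, ← ENNReal.ofReal_mul l.coe_nonneg]
        exact ENNReal.ofReal_le_ofReal ((hAU ha.1).2 ha.2).1.le
      have hρ2 : ENNReal.ofReal c * H ≤ l * ρ A := by
        rw [hρ, ← lintegral_const_mul' _ _ ENNReal.coe_ne_top, ← setLIntegral_const]
        refine setLIntegral_mono' hAF fun a ha => ?_
        rw [← ENNReal.ofReal_coe_nnreal, ← ENNReal.ofReal_mul l.coe_nonneg]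
        exact ENNReal.ofReal_le_ofReal ((hAU ha.1).2 ha.2).2.le
      obtain ⟨k, rfl⟩ := Nat.exists_eq_succ_of_ne_zero hn.ne'
      simp only [Nat.succ_eq_add_one, Nat.add_sub_cancel] at *
      constructor
      · calc κ A ≤ l ^ k * (l * ρ A) := by
              rw [hκ]
              exact h3.trans (mul_le_mul_right hρ2 _)
          _ = l ^ (k + 1) * ρ A := by rw [← mul_assoc, ← pow_succ]
          _ ≤ l ^ (2 * (k + 1)) * ρ A :=
            mul_le_mul_left (pow_le_pow_right₀ hl1 (by omega)) _
      · calc ρ A ≤ l * (l ^ k * (l ^ (k + 1) * κ A)) := by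
              rw [hκ]
              exact hρ1.trans (mul_le_mul_right h4 _)
          _ = l ^ (2 * (k + 1)) * κ A := by ring
    · refine ⟨(frontier E)ᶜ, isClosed_frontier.isOpen_compl.mem_nhds hx, fun A hAU hA => ?_⟩
      have hd : Disjoint A (frontier E) := disjoint_left.2 fun a ha => hAU ha
      have h1 : κ A = 0 := hE.coneMeasure_compl_frontier hA hd
      have h2 : ρ A = 0 := by
        rw [withDensity_boundaryMeasure_apply hA, hd.inter_eq]
        simp
      rw [h1, h2]
      simp
  refine le_antisymm (le_of_forall_one_lt_pow_mul (k := 2 * n) fun l hl => ?_)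
    (le_of_forall_one_lt_pow_mul (k := 2 * n) fun l hl => ?_)
  · refine measure_le_of_locally_le fun x => ?_
    obtain ⟨U, hU, h⟩ := hlocal l hl x
    exact ⟨U, hU, fun A hAU hA => (h A hAU hA).1⟩
  · refine measure_le_of_locally_le fun x => ?_
    obtain ⟨U, hU, h⟩ := hlocal l hl x
    exact ⟨U, hU, fun A hAU hA => (h A hAU hA).2⟩

omit hE in
theorem aestronglyMeasurable_of_continuousOn {F : Type*} [TopologicalSpace F]
    [TopologicalSpace.PseudoMetrizableSpace F] [SecondCountableTopology F]
    {f : Space n → F} (hf : ContinuousOn f (frontier E)) :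
    AEStronglyMeasurable f (boundaryMeasure E) :=
  hf.aestronglyMeasurable isClosed_frontier.measurableSet

theorem aemeasurable_density : AEMeasurable
    (fun x => ENNReal.ofReal (inner ℝ x (normal E x))) (boundaryMeasure E) :=
  (aestronglyMeasurable_of_continuousOn hE.continuousOn_inner_normal).aemeasurable.ennreal_ofReal

omit hE in
theorem ae_boundaryMeasure_mem : ∀ᵐ x ∂boundaryMeasure E, x ∈ frontier E :=
  ae_restrict_mem isClosed_frontier.measurableSet

theorem integral_coneMeasure (hn : 0 < n) (f : Space n → ℝ) :
    ∫ x, f x ∂coneMeasure (gauge E) =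
      ∫ x, inner ℝ x (normal E x) * f x ∂boundaryMeasure E := by
  rw [hE.coneMeasure_eq hn, integral_withDensity_eq_integral_toReal_smul₀ hE.aemeasurable_density
    (Eventually.of_forall fun _ => ENNReal.ofReal_lt_top)]
  refine integral_congr_ae ?_
  filter_upwards [ae_boundaryMeasure_mem] with x hx
  rw [ENNReal.toReal_ofReal (hE.inner_pos hx).le, smul_eq_mul]

theorem integrable_coneMeasure (hn : 0 < n) {f : Space n → ℝ} :
    Integrable f (coneMeasure (gauge E)) ↔
      Integrable (fun x => inner ℝ x (normal E x) * f x) (boundaryMeasure E) := by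
  rw [hE.coneMeasure_eq hn, integrable_withDensity_iff_integrable_smul₀' hE.aemeasurable_density
    (Eventually.of_forall fun _ => ENNReal.ofReal_lt_top)]
  refine integrable_congr ?_
  filter_upwards [ae_boundaryMeasure_mem] with x hx
  rw [ENNReal.toReal_ofReal (hE.inner_pos hx).le, smul_eq_mul]

theorem ae_coneMeasure_iff (hn : 0 < n) {P : Space n → Prop} :
    (∀ᵐ x ∂coneMeasure (gauge E), P x) ↔ ∀ᵐ x ∂boundaryMeasure E, P x := by
  rw [hE.coneMeasure_eq hn, ae_withDensity_iff' hE.aemeasurable_density]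
  refine eventually_congr ?_
  filter_upwards [ae_boundaryMeasure_mem] with x hx
  have := hE.inner_pos hx
  simp [this]

end IsRegularConvex

/-! ### Mean curvature as the divergence of the homogeneously extended normal -/

/-- The function `f` is Lipschitz in a neighbourhood of `x`. -/
def IsLipschitzNear {V W : Type*} [PseudoEMetricSpace V] [PseudoEMetricSpace W] (f : V → W)
    (x : V) : Prop :=
  ∃ K, ∃ U ∈ 𝓝 x, LipschitzOnWith K f U

namespace IsLipschitzNear

variable {V W₁ W₂ : Type*} [NormedAddCommGroup V] [NormedAddCommGroup W₁] [NormedAddCommGroup W₂]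

theorem continuousAt {f : V → W₁} {x : V} (hf : IsLipschitzNear f x) : ContinuousAt f x := by
  obtain ⟨K, U, hU, hK⟩ := hf
  exact hK.continuousOn.continuousAt hU

theorem prodMk {f : V → W₁} {g : V → W₂} {x : V} (hf : IsLipschitzNear f x)
    (hg : IsLipschitzNear g x) : IsLipschitzNear (fun y => (f y, g y)) x := by
  obtain ⟨K, U, hU, hK⟩ := hf
  obtain ⟨L, T, hT, hL⟩ := hg
  exact ⟨max K L, U ∩ T, inter_mem hU hT,
    (hK.mono inter_subset_left).prodMk (hL.mono inter_subset_right)⟩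

theorem id (x : V) : IsLipschitzNear (fun y : V => y) x :=
  ⟨1, univ, univ_mem, LipschitzWith.id.lipschitzOnWith⟩

variable [NormedSpace ℝ W₁] [NormedSpace ℝ W₂]

theorem contDiffAt_comp {f : V → W₁} {Ψ : W₁ → W₂} {x : V} (hf : IsLipschitzNear f x)
    (hΨ : ContDiffAt ℝ 1 Ψ (f x)) : IsLipschitzNear (fun y => Ψ (f y)) x := by
  have hc := hf.continuousAt
  obtain ⟨K, U, hU, hK⟩ := hf
  obtain ⟨L, T, hT, hL⟩ := hΨ.exists_lipschitzOnWith
  exact ⟨L * K, U ∩ f ⁻¹' T, inter_mem hU (hc hT),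
    hL.comp (hK.mono inter_subset_left) fun y hy => hy.2⟩

theorem smul {f : V → ℝ} {g : V → W₁} {x : V} (hf : IsLipschitzNear f x)
    (hg : IsLipschitzNear g x) : IsLipschitzNear (fun y => f y • g y) x :=
  (hf.prodMk hg).contDiffAt_comp (Ψ := fun q : ℝ × W₁ => q.1 • q.2)
    (contDiffAt_fst.smul contDiffAt_snd)

theorem inv_smul [NormedSpace ℝ V] {g : V → ℝ} {x : V} (hg : IsLipschitzNear g x) (hx : g x ≠ 0) :
    IsLipschitzNear (fun y => (g y)⁻¹ • y) x :=
  (hg.contDiffAt_comp (Ψ := fun s : ℝ => s⁻¹) (contDiffAt_inv ℝ hx)).smul (id x)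

end IsLipschitzNear

/-- The divergence of a vector field. -/
def divergence (X : Space n → Space n) (x : Space n) : ℝ :=
  LinearMap.trace ℝ (Space n) (fderiv ℝ X x : Space n →ₗ[ℝ] Space n)

theorem divergence_eq_sum (X : Space n → Space n) (x : Space n) :
    divergence X x = ∑ i, inner ℝ (EuclideanSpace.basisFun (Fin n) ℝ i)
      (fderiv ℝ X x (EuclideanSpace.basisFun (Fin n) ℝ i)) := by
  rw [divergence, LinearMap.trace_eq_sum_inner _ (EuclideanSpace.basisFun (Fin n) ℝ)]
  rfl

theorem measurable_divergence (X : Space n → Space n) : Measurable (divergence X) := by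
  have : divergence X = fun x => ∑ i, inner ℝ (EuclideanSpace.basisFun (Fin n) ℝ i)
      (fderiv ℝ X x (EuclideanSpace.basisFun (Fin n) ℝ i)) := funext (divergence_eq_sum X)
  rw [this]
  refine Finset.measurable_sum _ fun i _ => ?_
  exact measurable_const.inner (measurable_fderiv_apply_const ℝ X _)

/-- The trace over the orthogonal complement of a unit vector. -/
theorem sum_inner_orthogonal (A : Space n →L[ℝ] Space n) {v : Space n} (hv : ‖v‖ = 1) :
    ∑ i, inner ℝ (A (stdOrthonormalBasis ℝ (Submodule.span ℝ {v})ᗮ i : Space n))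
      (stdOrthonormalBasis ℝ (Submodule.span ℝ {v})ᗮ i : Space n) =
    LinearMap.trace ℝ (Space n) (A : Space n →ₗ[ℝ] Space n) - inner ℝ (A v) v := by
  set W := (Submodule.span ℝ {v})ᗮ with hW
  set P : Space n →ₗ[ℝ] W := (W.orthogonalProjectionOnto : Space n →ₗ[ℝ] W)
  have h1 : ∑ i, inner ℝ (A (stdOrthonormalBasis ℝ W i : Space n))
      (stdOrthonormalBasis ℝ W i : Space n) =
      LinearMap.trace ℝ W (P ∘ₗ ((A : Space n →ₗ[ℝ] Space n) ∘ₗ W.subtype)) := by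
    rw [LinearMap.trace_eq_sum_inner _ (stdOrthonormalBasis ℝ W)]
    refine Finset.sum_congr rfl fun i _ => ?_
    rw [real_inner_comm]
    exact (Submodule.inner_orthogonalProjectionOnto_eq_of_mem_left _ _).symm
  rw [h1, LinearMap.trace_comp_comm', LinearMap.comp_assoc]
  have h2 : W.subtype ∘ₗ P = LinearMap.id -
      (InnerProductSpace.rankOne ℝ v v : Space n →ₗ[ℝ] Space n) := by
    ext1 x
    have h3 := Submodule.starProjection_orthogonal_val (K := Submodule.span ℝ {v}) x
    have h4 := Submodule.starProjection_unit_singleton ℝ hv x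
    rw [h4] at h3
    simpa [P, hW] using h3
  rw [h2, LinearMap.comp_sub, map_sub, LinearMap.comp_id]
  congr 1
  have h5 : (A : Space n →ₗ[ℝ] Space n) ∘ₗ
      (InnerProductSpace.rankOne ℝ v v : Space n →ₗ[ℝ] Space n) =
      (InnerProductSpace.rankOne ℝ (A v) v : Space n →ₗ[ℝ] Space n) := by
    ext1 x
    simp
  rw [h5, InnerProductSpace.trace_rankOne, real_inner_comm]

namespace IsRegularConvex

variable {E : Set (Space n)} (hE : IsRegularConvex E)

include hE

/-- For `t > gauge E y` the point `y / t` lies in the closure of `E`, hence in the supporting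
half-space at `z`. Thus the gauge dominates the linear function `⟨·, ν⟩ / ⟨z, ν⟩`, with equality
along the ray through `z`. -/
theorem inner_le_gauge_mul {z : Space n} (hz : z ∈ frontier E) (y : Space n) :
    inner ℝ y (normal E z) ≤ gauge E y * inner ℝ z (normal E z) := by
  have hc := hE.inner_pos hz
  rw [← div_le_iff₀ hc]
  refine le_of_forall_gt_imp_ge_of_dense fun t ht => ?_
  have ht0 : 0 < t := (gauge_nonneg y).trans_lt ht
  have h1 : gauge E (t⁻¹ • y) ≤ 1 := by
    rw [hE.isHomogeneous.smul _ (inv_pos.2 ht0), inv_mul_le_iff₀ ht0, mul_one]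
    exact ht.le
  have h2 := hE.inner_sub_le_zero z hz _
    ((gauge_le_one_iff_mem_closure hE.convex hE.mem_nhds).1 h1)
  rw [inner_sub_left, real_inner_smul_left, sub_nonpos, inv_mul_le_iff₀ ht0] at h2
  rwa [div_le_iff₀ hc]

/-- The gradient of the gauge. -/
theorem fderiv_gauge_apply {x : Space n} (hx : 0 < gauge E x)
    (hd : DifferentiableAt ℝ (gauge E) x) (v : Space n) :
    fderiv ℝ (gauge E) x v = inner ℝ v (normal E (radialProj (gauge E) x)) /
      inner ℝ (radialProj (gauge E) x) (normal E (radialProj (gauge E) x)) := by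
  set z := radialProj (gauge E) x
  have hz : z ∈ frontier E := hE.radialProj_mem hx
  have hc := hE.inner_pos hz
  set ν := normal E z
  -- The gauge minus its supporting linear function is nonnegative and vanishes at `x`, so the two
  -- have the same derivative there.
  have hmin : IsLocalMin (fun y => gauge E y - (inner ℝ z ν)⁻¹ * inner ℝ ν y) x := by
    refine Eventually.of_forall fun y => ?_
    have h1 := hE.inner_le_gauge_mul hz y
    have h2 : inner ℝ ν x = gauge E x * inner ℝ z ν := by
      rw [← real_inner_smul_left, smul_radialProj hx, real_inner_comm]
    simp only [h2]
    rw [mul_comm (gauge E x), inv_mul_cancel_left₀ hc.ne', sub_self, sub_nonneg,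
      inv_mul_le_iff₀ hc, real_inner_comm, mul_comm]
    exact h1
  have hder : HasFDerivAt (fun y => gauge E y - (inner ℝ z ν)⁻¹ * inner ℝ ν y)
      (fderiv ℝ (gauge E) x - (inner ℝ z ν)⁻¹ • innerSL ℝ ν) x :=
    hd.hasFDerivAt.sub ((innerSL ℝ ν).hasFDerivAt.const_mul _)
  have h0 := hmin.hasFDerivAt_eq_zero hder
  have := DFunLike.congr_fun h0 v
  simp only [_root_.sub_apply, _root_.smul_apply, innerSL_apply_apply,
    smul_eq_mul, _root_.zero_apply, sub_eq_zero] at this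
  rw [this, div_eq_inv_mul, real_inner_comm v ν]

omit hE in
theorem hasFDerivAt_radialProj {p : Space n → ℝ} {x : Space n} (hx : 0 < p x)
    (hd : DifferentiableAt ℝ p x) :
    HasFDerivAt (radialProj p) ((p x)⁻¹ • ContinuousLinearMap.id ℝ (Space n) +
      ((-(p x ^ 2)⁻¹) • fderiv ℝ p x).smulRight x) x := by
  exact ((hasDerivAt_inv hx.ne').comp_hasFDerivAt x hd.hasFDerivAt).smul (hasFDerivAt_id x)

/-- `radialProj` maps a neighbourhood of `x` into `∂E`, and its derivative at `x` fixes `v` because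
the gauge has zero derivative along `v`. This is what makes `fderivWithin` along `∂E`, used in
`meanCurvature`, well determined on tangent vectors. -/
theorem mem_tangentConeAt {x : Space n} (hx : x ∈ frontier E)
    (hd : DifferentiableAt ℝ (gauge E) x) {v : Space n} (hv : inner ℝ v (normal E x) = 0) :
    v ∈ tangentConeAt ℝ (frontier E) x := by
  have hg : gauge E x = 1 := hE.gauge_eq_one_iff.2 hx
  have hpos : 0 < gauge E x := by rw [hg]; exact one_pos
  have hπ := hE.radialProj_of_mem hx
  have hU : {y | 0 < gauge E y} ∈ 𝓝 x :=
    (isOpen_lt continuous_const (continuous_gauge hE.convex hE.mem_nhds)).mem_nhds hpos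
  have h1 := (hasFDerivAt_radialProj hpos hd).hasFDerivWithinAt (s := {y | 0 < gauge E y})
  have hv' : v ∈ tangentConeAt ℝ {y | 0 < gauge E y} x := by
    rw [tangentConeAt_of_mem_nhds hU]; exact mem_univ _
  have h2 := h1.mapsTo_tangent_cone hv'
  rw [hπ] at h2
  have h3 := hE.fderiv_gauge_apply hpos hd v
  rw [hπ, hv, zero_div] at h3
  have h4 : ((gauge E x)⁻¹ • ContinuousLinearMap.id ℝ (Space n) +
      ((-(gauge E x ^ 2)⁻¹) • fderiv ℝ (gauge E) x).smulRight x) v = v := by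
    simp [hg, h3]
  rw [h4] at h2
  refine tangentConeAt_mono ?_ h2
  rintro _ ⟨y, hy, rfl⟩
  exact hE.radialProj_mem hy

/-- The mean curvature in terms of an extension of the normal. -/
theorem meanCurvature_eq {x : Space n} (hx : x ∈ frontier E)
    (hd : DifferentiableAt ℝ (gauge E) x) {f : Space n → Space n} {A : Space n →L[ℝ] Space n}
    (hf : HasFDerivAt f A x) (hfE : ∀ y ∈ frontier E, f y = normal E y) :
    meanCurvature E x = LinearMap.trace ℝ (Space n) (A : Space n →ₗ[ℝ] Space n) -
      inner ℝ (A (normal E x)) (normal E x) := by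
  rw [← sum_inner_orthogonal A (hE.norm_normal x hx), meanCurvature, tangentialDiv]
  refine Finset.sum_congr rfl fun i _ => ?_
  have h1 : HasFDerivWithinAt (normal E) A (frontier E) x :=
    hf.hasFDerivWithinAt.congr (fun y hy => (hfE y hy).symm) (hfE x hx).symm
  have h2 := h1.differentiableWithinAt.hasFDerivWithinAt
  rw [h2.unique_on h1 (hE.mem_tangentConeAt hx hd ?_)]
  have h3 := (stdOrthonormalBasis ℝ (Submodule.span ℝ {normal E x})ᗮ i).2
  exact (Submodule.mem_orthogonal_singleton_iff_inner_left.1 h3)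

/-- The homogeneous extension of the normal. -/
theorem norm_normal_radialProj {x : Space n} (hx : 0 < gauge E x) :
    ‖normal E (radialProj (gauge E) x)‖ = 1 :=
  hE.norm_normal _ (hE.radialProj_mem hx)

theorem eventually_gauge_pos {x : Space n} (hx : 0 < gauge E x) : ∀ᶠ y in 𝓝 x, 0 < gauge E y :=
  (isOpen_lt continuous_const (continuous_gauge hE.convex hE.mem_nhds)).mem_nhds hx

/-- Differentiate `‖N‖² = 1`. Consequently the normal direction contributes nothing to the trace,
and tangential and full divergence of `N` agree. -/
theorem inner_fderiv_normal_radialProj {x : Space n} (hx : 0 < gauge E x)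
    (hd : DifferentiableAt ℝ (fun y => normal E (radialProj (gauge E) y)) x) (v : Space n) :
    inner ℝ (fderiv ℝ (fun y => normal E (radialProj (gauge E) y)) x v)
      (normal E (radialProj (gauge E) x)) = 0 := by
  set N := fun y => normal E (radialProj (gauge E) y)
  have h1 : HasFDerivAt (fun y => inner ℝ (N y) (N y)) _ x := hd.hasFDerivAt.inner ℝ hd.hasFDerivAt
  have h2 : HasFDerivAt (fun y => inner ℝ (N y) (N y)) (0 : Space n →L[ℝ] ℝ) x := by
    refine (hasFDerivAt_const (1 : ℝ) x).congr_of_eventuallyEq ?_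
    filter_upwards [hE.eventually_gauge_pos hx] with y hy
    rw [real_inner_self_eq_norm_sq, hE.norm_normal_radialProj hy, one_pow]
  have h3 := DFunLike.congr_fun (h1.unique h2) v
  simp only [ContinuousLinearMap.comp_apply, ContinuousLinearMap.prod_apply, fderivInnerCLM_apply,
    _root_.zero_apply] at h3
  rw [real_inner_comm] at h3
  change inner ℝ (fderiv ℝ N x v) (N x) = 0
  linarith

/-- The extended normal is homogeneous of degree `0`, so its derivative is homogeneous of degree
`-1`; comparing `x` with its projection produces the factor `gauge E x`. -/
theorem meanCurvature_radialProj {x : Space n} (hx : 0 < gauge E x)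
    (hg : DifferentiableAt ℝ (gauge E) x)
    (hd : DifferentiableAt ℝ (fun y => normal E (radialProj (gauge E) y)) x) :
    meanCurvature E (radialProj (gauge E) x) =
      gauge E x * divergence (fun y => normal E (radialProj (gauge E) y)) x := by
  set N := fun y => normal E (radialProj (gauge E) y) with hN
  set z := radialProj (gauge E) x with hz
  have hxz : gauge E x • z = x := smul_radialProj hx
  have hscale : HasFDerivAt (fun y : Space n => gauge E x • y)
      (gauge E x • ContinuousLinearMap.id ℝ (Space n)) z :=
    (hasFDerivAt_id z).const_smul (gauge E x)
  have hg' : DifferentiableAt ℝ (gauge E) z := by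
    have h1 : gauge E = fun y => (gauge E x)⁻¹ * gauge E (gauge E x • y) := by
      ext y
      rw [hE.isHomogeneous.smul _ hx, inv_mul_cancel_left₀ hx.ne']
    rw [h1]
    rw [← hxz] at hg
    exact (hg.comp z hscale.differentiableAt).const_mul _
  have hd' : HasFDerivAt N (gauge E x • fderiv ℝ N x) z := by
    have h1 : N = N ∘ fun y => gauge E x • y := by
      ext1 y
      simp only [hN, Function.comp_apply, hE.isHomogeneous.radialProj_smul hx]
    have h2 : HasFDerivAt N (fderiv ℝ N x) (gauge E x • z) := by rw [hxz]; exact hd.hasFDerivAt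
    have h3 := h2.comp z hscale
    rw [← h1] at h3
    have h4 : gauge E x • fderiv ℝ N x =
        (fderiv ℝ N x).comp (gauge E x • ContinuousLinearMap.id ℝ (Space n)) := by
      ext1 v
      simp
    rw [h4]
    exact h3
  have hzE : z ∈ frontier E := hE.radialProj_mem hx
  rw [hE.meanCurvature_eq hzE hg' hd' fun y hy => by
    simp only [hN, hE.radialProj_of_mem hy]]
  have h0 := hE.inner_fderiv_normal_radialProj hx hd (normal E z)
  rw [_root_.smul_apply, real_inner_smul_left, h0, mul_zero, sub_zero, divergence,
    ContinuousLinearMap.toLinearMap_smul, map_smul, smul_eq_mul]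

theorem isLipschitzNear_gauge (x : Space n) : IsLipschitzNear (gauge E) x := by
  obtain ⟨L, hL⟩ := hE.convex.lipschitz_gauge hE.mem_nhds
  exact ⟨L, univ, univ_mem, hL.lipschitzOnWith⟩

theorem isLipschitzNear_radialProj {x : Space n} (hx : 0 < gauge E x) :
    IsLipschitzNear (radialProj (gauge E)) x :=
  (hE.isLipschitzNear_gauge x).inv_smul hx.ne'

theorem isLipschitzNear_normal_radialProj {x : Space n} (hx : 0 < gauge E x) :
    IsLipschitzNear (fun y => normal E (radialProj (gauge E) y)) x := by
  have hπ := hE.isLipschitzNear_radialProj hx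
  have hcont : Tendsto (radialProj (gauge E)) (𝓝 x) (𝓝[frontier E] (radialProj (gauge E) x)) := by
    refine tendsto_nhdsWithin_iff.2 ⟨hπ.continuousAt, ?_⟩
    filter_upwards [hE.eventually_gauge_pos hx] with y hy
    exact hE.radialProj_mem hy
  obtain ⟨K₁, U, hU, hK₁⟩ := hπ
  obtain ⟨K₂, t₂, ht₂, hK₂⟩ := hE.locallyLipschitzOn (hE.radialProj_mem hx)
  exact ⟨K₂ * K₁, U ∩ radialProj (gauge E) ⁻¹' t₂, inter_mem hU (hcont ht₂),
    hK₂.comp (hK₁.mono inter_subset_left) fun y hy => hy.2⟩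

/-- The homogeneous extension of the normal is differentiable almost everywhere. -/
theorem ae_differentiableAt : ∀ᵐ x : Space n, 0 < gauge E x →
    DifferentiableAt ℝ (gauge E) x ∧
      DifferentiableAt ℝ (fun y => normal E (radialProj (gauge E) y)) x := by
  obtain ⟨L, hL⟩ := hE.convex.lipschitz_gauge hE.mem_nhds
  have h1 : ∀ᵐ x : Space n, 0 < gauge E x →
      DifferentiableAt ℝ (fun y => normal E (radialProj (gauge E) y)) x := by
    rw [ae_iff]
    refine measure_null_of_locally_null _ fun x hx => ?_
    simp only [mem_ofPred_eq, Classical.not_imp] at hx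
    obtain ⟨K, U, hU, hK⟩ := hE.isLipschitzNear_normal_radialProj hx.1
    have hK' := hK.mono (interior_subset : interior U ⊆ U)
    have h2 := hK'.ae_differentiableWithinAt (μ := volume) isOpen_interior.measurableSet
    rw [ae_restrict_iff' isOpen_interior.measurableSet] at h2
    refine ⟨_, inter_mem_nhdsWithin _ (interior_mem_nhds.2 hU), ?_⟩
    refine measure_mono_null ?_ (ae_iff.1 h2)
    rintro y ⟨hy, hyU⟩ h3
    simp only [mem_ofPred_eq, Classical.not_imp] at hy
    exact hy.2 ((h3 hyU).differentiableAt (isOpen_interior.mem_nhds hyU))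
  filter_upwards [h1, hL.ae_differentiableAt] with x hx hx' h0
  exact ⟨hx', hx h0⟩

/-- Differentiability of the gauge and of the extended normal is invariant under positive dilations,
so the almost everywhere statement in space descends to the cone measure, which has the same null
sets as the boundary measure. -/
theorem ae_meanCurvature_eq (hn : 0 < n) : ∀ᵐ z ∂boundaryMeasure E,
    meanCurvature E z = divergence (fun y => normal E (radialProj (gauge E) y)) z := by
  rw [← hE.ae_coneMeasure_iff hn]
  set N := fun y => normal E (radialProj (gauge E) y) with hN
  have hm : MeasurableSet {z | DifferentiableAt ℝ (gauge E) z ∧ DifferentiableAt ℝ N z} :=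
    (measurableSet_of_differentiableAt ℝ _).inter (measurableSet_of_differentiableAt ℝ _)
  have h1 : ∀ᵐ z ∂coneMeasure (gauge E),
      DifferentiableAt ℝ (gauge E) z ∧ DifferentiableAt ℝ N z := by
    refine Measure.ae_smul_measure ?_ _
    rw [ae_map_iff hE.isHomogeneous.measurable_radialProj.aemeasurable hm]
    filter_upwards [ae_restrict_of_ae hE.ae_differentiableAt, ae_restrict_mem
      ((measurableSet_lt measurable_const hE.isHomogeneous.measurable).inter
        (measurableSet_lt hE.isHomogeneous.measurable measurable_const))] with x hx hx'
    have h0 : 0 < gauge E x := hx'.1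
    obtain ⟨hg, hd⟩ := hx h0
    set z := radialProj (gauge E) x
    have hxz : gauge E x • z = x := smul_radialProj h0
    have hs : DifferentiableAt ℝ (fun y : Space n => gauge E x • y) z := by fun_prop
    rw [← hxz] at hg hd
    constructor
    · have h1 : gauge E = fun y => (gauge E x)⁻¹ * gauge E (gauge E x • y) := by
        ext y
        rw [hE.isHomogeneous.smul _ h0, inv_mul_cancel_left₀ h0.ne']
      have h2 := (hg.comp z hs).const_mul (gauge E x)⁻¹
      rw [h1]
      exact h2
    · have h1 : N = N ∘ fun y => gauge E x • y := by
        ext1 y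
        simp only [hN, Function.comp_apply, hE.isHomogeneous.radialProj_smul h0]
      rw [h1]
      exact hd.comp z hs
  have h2 : ∀ᵐ z ∂coneMeasure (gauge E), z ∈ frontier E := by
    rw [hE.ae_coneMeasure_iff hn]
    exact ae_boundaryMeasure_mem
  filter_upwards [h1, h2] with z hz hzE
  have hgz := hE.gauge_eq_one_iff.2 hzE
  have := hE.meanCurvature_radialProj (by rw [hgz]; exact one_pos) hz.1 hz.2
  rwa [hE.radialProj_of_mem hzE, hgz, one_mul] at this

theorem aestronglyMeasurable_meanCurvature (hn : 0 < n) :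
    AEStronglyMeasurable (meanCurvature E) (boundaryMeasure E) :=
  ((measurable_divergence _).aestronglyMeasurable).congr
    ((hE.ae_meanCurvature_eq hn).mono fun _ hz => hz.symm)

end IsRegularConvex

/-! ### The divergence theorem for Lipschitz fields and integration by parts on the boundary -/

theorem exists_lipschitzWith_of_isLipschitzNear {V W : Type*} [NormedAddCommGroup V]
    [ProperSpace V] [NormedAddCommGroup W] {f : V → W}
    (hf : ∀ x, IsLipschitzNear f x) {R : ℝ} (hR : 0 ≤ R) (hfR : ∀ x, R ≤ ‖x‖ → f x = 0)
    (h0 : f 0 = 0) :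
    ∃ K, LipschitzWith K f := by
  have hloc : LocallyLipschitzOn (Metric.closedBall (0 : V) (R + 1)) f := by
    intro x _
    obtain ⟨K, U, hU, hK⟩ := hf x
    exact ⟨K, U, mem_nhdsWithin_of_mem_nhds hU, hK⟩
  obtain ⟨K, hK⟩ := hloc.exists_lipschitzOnWith_of_compact (isCompact_closedBall _ _)
  -- If one point lies outside the ball of radius `R + 1`, either both values vanish or the distance
  -- is at least `1`, while `f 0 = 0` bounds the other value by `K * R`.
  have key : ∀ x y : V, ‖x‖ ≤ R + 1 → R + 1 < ‖y‖ → ‖f x - f y‖ ≤ (K * R) * ‖x - y‖ := by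
    intro x y hx hy
    rw [hfR y (by linarith), sub_zero]
    rcases le_or_gt R ‖x‖ with hx' | hx'
    · rw [hfR x hx', norm_zero]
      positivity
    · have h1 := hK.norm_sub_le (x := x) (y := 0) (by simpa using hx) (by simp; linarith)
      rw [h0, sub_zero, sub_zero] at h1
      have h2 := norm_sub_norm_le y x
      rw [norm_sub_rev] at h2
      have h3 : 1 ≤ ‖x - y‖ := by linarith
      calc ‖f x‖ ≤ K * ‖x‖ := h1
        _ ≤ K * R := by gcongr
        _ ≤ K * R * ‖x - y‖ := le_mul_of_one_le_right (by positivity) h3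
  refine ⟨max K (K * ⟨R, hR⟩), LipschitzWith.of_dist_le_mul fun x y => ?_⟩
  rw [dist_eq_norm, dist_eq_norm]
  have hm1 : (K : ℝ) ≤ (max K (K * ⟨R, hR⟩) : NNReal) := by exact_mod_cast le_max_left _ _
  have hm2 : (K : ℝ) * R ≤ (max K (K * ⟨R, hR⟩) : NNReal) := by
    have := le_max_right K (K * ⟨R, hR⟩)
    exact_mod_cast this
  rcases le_or_gt ‖x‖ (R + 1) with hx | hx <;> rcases le_or_gt ‖y‖ (R + 1) with hy | hy
  · exact (hK.norm_sub_le (by simpa using hx) (by simpa using hy)).trans (by gcongr)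
  · exact (key x y hx hy).trans (by gcongr)
  · rw [norm_sub_rev, norm_sub_rev x]
    exact (key y x hy hx).trans (by gcongr)
  · rw [hfR x (by linarith), hfR y (by linarith), sub_self, norm_zero]
    positivity

theorem integral_lineDeriv_eq_zero {f : Space n → ℝ} {K : NNReal} (hf : LipschitzWith K f)
    (hc : HasCompactSupport f) (v : Space n) : ∫ x, lineDeriv ℝ f x v = 0 := by
  have h := LipschitzWith.integral_lineDeriv_mul_eq (μ := (volume : Measure (Space n)))
    (LipschitzWith.const (1 : ℝ)) hf hc (-v)
  have h1 : ∀ x : Space n, lineDeriv ℝ (fun _ : Space n => (1 : ℝ)) x (-v) = 0 := fun x => by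
    simp [lineDeriv]
  simp only [h1, zero_mul, integral_zero, neg_neg, mul_one] at h
  exact h.symm

theorem integrable_lineDeriv {f : Space n → ℝ} {K : NNReal} (hf : LipschitzWith K f)
    (hc : HasCompactSupport f) (v : Space n) : Integrable fun x => lineDeriv ℝ f x v := by
  have h1 : MemLp (fun x => lineDeriv ℝ f x v) ⊤ (volume.restrict (tsupport f)) :=
    (hf.memLp_lineDeriv v).restrict _
  have : IsFiniteMeasure ((volume : Measure (Space n)).restrict (tsupport f)) :=
    isFiniteMeasure_restrict.2 hc.measure_lt_top.ne
  have h2 : IntegrableOn (fun x => lineDeriv ℝ f x v) (tsupport f) :=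
    h1.integrable le_top
  rwa [integrableOn_iff_integrable_of_support_subset] at h2
  intro x hx
  by_contra hx'
  refine hx ?_
  have : f =ᶠ[𝓝 x] fun _ => 0 := notMem_tsupport_iff_eventuallyEq.1 hx'
  simp only [this.lineDeriv_eq]
  simp [lineDeriv]

/-- The divergence theorem for compactly supported Lipschitz fields. -/
theorem integral_divergence_eq_zero {X : Space n → Space n} {K : NNReal} (hX : LipschitzWith K X)
    (hc : HasCompactSupport X) : ∫ x, divergence X x = 0 := by
  set e := EuclideanSpace.basisFun (Fin n) ℝ
  have hXi : ∀ i, LipschitzWith (1 * K) fun x => inner ℝ (e i) (X x) := by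
    intro i
    refine LipschitzWith.comp (f := fun y => inner ℝ (e i) y) ?_ hX
    refine LipschitzWith.of_dist_le_mul fun y z => ?_
    rw [dist_eq_norm, dist_eq_norm, ← inner_sub_right, NNReal.coe_one, one_mul]
    refine (norm_inner_le_norm _ _).trans ?_
    rw [e.orthonormal.1, one_mul]
  have hci : ∀ i, HasCompactSupport fun x => inner ℝ (e i) (X x) := fun i =>
    hc.comp_left (g := fun y => inner ℝ (e i) y) (inner_zero_right _)
  have hae : ∀ᵐ x, divergence X x = ∑ i, lineDeriv ℝ (fun x => inner ℝ (e i) (X x)) x (e i) := by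
    filter_upwards [hX.ae_differentiableAt] with x hx
    rw [divergence_eq_sum]
    refine Finset.sum_congr rfl fun i _ => ?_
    have h1 : HasFDerivAt (fun x => inner ℝ (e i) (X x))
        ((innerSL ℝ (e i)).comp (fderiv ℝ X x)) x :=
      (innerSL ℝ (e i)).hasFDerivAt.comp x hx.hasFDerivAt
    rw [(h1.hasLineDerivAt (e i)).lineDeriv]
    rfl
  rw [integral_congr_ae hae, integral_finsetSum _ fun i _ => integrable_lineDeriv (hXi i) (hci i) _]
  exact Finset.sum_eq_zero fun i _ => integral_lineDeriv_eq_zero (hXi i) (hci i) _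

theorem divergence_smul {φ : Space n → ℝ} {X : Space n → Space n} {x : Space n}
    {φ' : Space n →L[ℝ] ℝ} (hφ : HasFDerivAt φ φ' x) (hX : DifferentiableAt ℝ X x) :
    divergence (fun y => φ y • X y) x = φ x * divergence X x + φ' (X x) := by
  have h := (hφ.smul hX.hasFDerivAt).fderiv
  change fderiv ℝ (fun y => φ y • X y) x = _ at h
  rw [divergence, h, ContinuousLinearMap.toLinearMap_add, map_add,
    ContinuousLinearMap.toLinearMap_smul, map_smul, divergence, smul_eq_mul]
  congr 1
  exact LinearMap.trace_smulRight _ _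

/-- A smooth bump function on `(1, 3)`. -/
def radialBump : ContDiffBump (2 : ℝ) := ⟨1 / 2, 1, by norm_num, by norm_num⟩

theorem radialBump_eq_zero {s : ℝ} (hs : s ∉ Ioo (1 : ℝ) 3) : radialBump s = 0 := by
  refine radialBump.zero_of_le_dist ?_
  change (1 : ℝ) ≤ dist s 2
  rw [Real.dist_eq, le_abs]
  simp only [mem_Ioo, not_and_or, not_lt] at hs
  rcases hs with hs | hs
  · right; linarith
  · left; linarith

theorem differentiable_radialBump : Differentiable ℝ radialBump :=
  (radialBump.contDiff (n := 1)).differentiable (by norm_num)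

/-- The integral of `(s ^ (n - 1) θ)'` over `(0, ∞)` vanishes, which gives the factor `-(n - 1)`.
Positivity of the other integral allows it to be cancelled after separating variables. -/
theorem integral_radialBump (hn : 2 ≤ n) :
    Integrable (fun s => radialBump s / s) (powMeasure n) ∧
    Integrable (deriv radialBump) (powMeasure n) ∧
    0 < ∫ s, radialBump s / s ∂powMeasure n ∧
    ∫ s, deriv radialBump s ∂powMeasure n =
      -((n : ℝ) - 1) * ∫ s, radialBump s / s ∂powMeasure n := by
  obtain ⟨k, rfl⟩ := Nat.exists_eq_add_of_le' hn
  have hc1 : Continuous fun s : ℝ => s ^ k * radialBump s :=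
    (continuous_pow k).mul radialBump.continuous
  have hc2 : Continuous fun s : ℝ => s ^ (k + 1) * deriv radialBump s :=
    (continuous_pow _).mul ((radialBump.contDiff (n := 1)).continuous_deriv le_rfl)
  have hi1 : Integrable fun s : ℝ => s ^ k * radialBump s :=
    hc1.integrable_of_hasCompactSupport radialBump.hasCompactSupport.mul_left
  have hi2 : Integrable fun s : ℝ => s ^ (k + 1) * deriv radialBump s :=
    hc2.integrable_of_hasCompactSupport radialBump.hasCompactSupport.deriv.mul_left
  have hcongr : EqOn (fun s : ℝ => s ^ (k + 2 - 1) * (radialBump s / s))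
      (fun s => s ^ k * radialBump s) (Ioi 0) := by
    intro s hs
    have hs0 : s ≠ 0 := (mem_Ioi.1 hs).ne'
    simp only [show k + 2 - 1 = k + 1 from rfl, pow_succ]
    field_simp
  have hpos : 0 < ∫ s in Ioi (0 : ℝ), s ^ k * radialBump s := by
    rw [setIntegral_pos_iff_support_of_nonneg_ae]
    · refine lt_of_lt_of_le ?_ (measure_mono (?_ : Ioo (1 : ℝ) 3 ⊆ _))
      · simp
      · intro s hs
        have hs0 : 0 < s := one_pos.trans hs.1
        refine ⟨?_, hs0⟩
        have h1 : 0 < radialBump s := by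
          refine radialBump.pos_of_mem_ball ?_
          change dist s 2 < 1
          rw [Real.dist_eq, abs_lt]
          constructor <;> linarith [hs.1, hs.2]
        exact (mul_pos (pow_pos hs0 k) h1).ne'
    · filter_upwards [ae_restrict_mem measurableSet_Ioi] with s hs
      exact mul_nonneg (pow_nonneg (le_of_lt hs) _) radialBump.nonneg
    · exact hi1.integrableOn
  have hI : ∫ s, radialBump s / s ∂powMeasure (k + 2) =
      ∫ s in Ioi (0 : ℝ), s ^ k * radialBump s := by
    rw [integral_powMeasure]
    exact setIntegral_congr_fun measurableSet_Ioi hcongr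
  refine ⟨?_, ?_, ?_, ?_⟩
  · rw [integrable_powMeasure]
    exact (integrableOn_congr_fun hcongr measurableSet_Ioi).2 hi1.integrableOn
  · rw [integrable_powMeasure]
    exact hi2.integrableOn
  · rw [hI]
    exact hpos
  · rw [hI, integral_powMeasure]
    have hder : ∀ s ∈ Ici (0 : ℝ), HasDerivAt (fun s : ℝ => s ^ (k + 1) * radialBump s)
        (((k : ℝ) + 1) * (s ^ k * radialBump s) + s ^ (k + 1) * deriv radialBump s) s := by
      intro s _
      have h1 := (hasDerivAt_pow (k + 1) s).mul (differentiable_radialBump s).hasDerivAt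
      simp only [Nat.add_sub_cancel, Nat.cast_add, Nat.cast_one] at h1
      exact h1.congr_deriv (by ring)
    have htend : Tendsto (fun s : ℝ => s ^ (k + 1) * radialBump s) atTop (𝓝 0) := by
      refine tendsto_const_nhds.congr' ?_
      filter_upwards [eventually_ge_atTop (3 : ℝ)] with s hs
      rw [radialBump_eq_zero (fun h => absurd h.2 hs.not_gt), mul_zero]
    have h2 := integral_Ioi_of_hasDerivAt_of_tendsto' hder
      ((hi1.const_mul _).add hi2).integrableOn htend
    rw [integral_add (hi1.const_mul _).integrableOn hi2.integrableOn,
      integral_const_mul] at h2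
    simp only [ne_eq, Nat.add_eq_zero_iff, one_ne_zero, and_false, not_false_eq_true, zero_pow,
      zero_mul, sub_self] at h2
    push_cast
    change ∫ s in Ioi (0 : ℝ), s ^ (k + 1) * deriv radialBump s = _
    linarith

namespace IsRegularConvex

variable {E : Set (Space n)} (hE : IsRegularConvex E)

include hE

theorem radialProj_ne_zero {x : Space n} (hx : 0 < gauge E x) : radialProj (gauge E) x ≠ 0 := by
  intro h0
  have := hE.gauge_eq_one_iff.2 (hE.radialProj_mem hx)
  rw [h0, gauge_zero] at this
  exact zero_ne_one this

/-- Product rule with `Dg(ν) = 1 / ⟨z, ν⟩`, `Dπ(ν) = (ν - z / ⟨z, ν⟩) / g` and `div N = H / g`,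
where `g` is the gauge and `z = π x`. Each term is a function of `z` times a function of `g`, ready
for polar coordinates. -/
theorem divergence_flux_of_pos {h : Space n → ℝ} (hh : ∀ x ≠ 0, ContDiffAt ℝ 1 h x) {θ : ℝ → ℝ}
    (hθ : Differentiable ℝ θ) {x : Space n} (hx : 0 < gauge E x)
    (hg : DifferentiableAt ℝ (gauge E) x)
    (hd : DifferentiableAt ℝ (fun y => normal E (radialProj (gauge E) y)) x) :
    divergence (fun y => (h (radialProj (gauge E) y) * θ (gauge E y)) •
        normal E (radialProj (gauge E) y)) x =
      (h (radialProj (gauge E) x) * meanCurvature E (radialProj (gauge E) x) +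
        fderiv ℝ h (radialProj (gauge E) x) (normal E (radialProj (gauge E) x)) -
        fderiv ℝ h (radialProj (gauge E) x) (radialProj (gauge E) x) /
          inner ℝ (radialProj (gauge E) x) (normal E (radialProj (gauge E) x))) *
        (θ (gauge E x) / gauge E x) +
      h (radialProj (gauge E) x) /
        inner ℝ (radialProj (gauge E) x) (normal E (radialProj (gauge E) x)) *
          deriv θ (gauge E x) := by
  have hπ := hasFDerivAt_radialProj hx hg
  have hz : radialProj (gauge E) x ∈ frontier E := hE.radialProj_mem hx
  have hDg := hE.fderiv_gauge_apply hx hg (normal E (radialProj (gauge E) x))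
  have hhz : HasFDerivAt h (fderiv ℝ h (radialProj (gauge E) x)) (radialProj (gauge E) x) :=
    ((hh _ (hE.radialProj_ne_zero hx)).differentiableAt one_ne_zero).hasFDerivAt
  have hφ := (hhz.comp x hπ).mul ((hθ (gauge E x)).hasDerivAt.comp_hasFDerivAt x hg.hasFDerivAt)
  have hdiv := divergence_smul hφ hd
  have hxz : x = gauge E x • radialProj (gauge E) x := (smul_radialProj hx).symm
  rw [real_inner_self_eq_norm_sq, hE.norm_normal_radialProj hx, one_pow] at hDg
  have hc := hE.inner_pos hz
  have hH := hE.meanCurvature_radialProj hx hg hd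
  refine Eq.trans hdiv ?_
  rw [hH]
  generalize hz' : radialProj (gauge E) x = z at *
  generalize normal E z = ν at *
  generalize divergence (fun y => normal E (radialProj (gauge E) y)) x = D at *
  have hDπ : ((gauge E x)⁻¹ • ContinuousLinearMap.id ℝ (Space n) +
      ((-(gauge E x ^ 2)⁻¹) • fderiv ℝ (gauge E) x).smulRight x) ν =
      (gauge E x)⁻¹ • ν - ((gauge E x)⁻¹ / inner ℝ z ν) • z := by
    simp only [_root_.add_apply, _root_.smul_apply, ContinuousLinearMap.id_apply,
      ContinuousLinearMap.smulRight_apply, hDg, smul_eq_mul]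
    have hx2 : ∀ c : ℝ, c • x = (c * gauge E x) • z := fun c => by rw [mul_smul, ← hxz]
    rw [hx2, sub_eq_add_neg, ← neg_smul]
    congr 2
    field_simp
  simp only [_root_.add_apply, _root_.smul_apply, ContinuousLinearMap.comp_apply, hDπ, hDg,
    smul_eq_mul, Function.comp_apply, map_sub, map_smul, hz', Pi.mul_apply]
  field_simp
  ring

end IsRegularConvex

namespace IsRegularConvex

variable {E : Set (Space n)} (hE : IsRegularConvex E)

include hE

/-- The bump removes the region `gauge E < 1`, including the directions of zero gauge where
`radialProj` degenerates; on its support the gauge is below `3`, so the cutoff radius `R` of `h`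
confines the field to the ball of radius `3 * R`. -/
theorem exists_lipschitzWith_flux {h : Space n → ℝ} (hh : ∀ x ≠ 0, ContDiffAt ℝ 1 h x) {R : ℝ}
    (hR0 : 0 ≤ R) (hR : ∀ x, R ≤ ‖x‖ → h x = 0) :
    (∃ K, LipschitzWith K fun y => (h (radialProj (gauge E) y) * radialBump (gauge E y)) •
        normal E (radialProj (gauge E) y)) ∧
      HasCompactSupport fun y => (h (radialProj (gauge E) y) * radialBump (gauge E y)) •
        normal E (radialProj (gauge E) y) := by
  set V : Space n → Space n := fun y => (h (radialProj (gauge E) y) * radialBump (gauge E y)) •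
        normal E (radialProj (gauge E) y) with hV
  have hsupp : ∀ x, 3 * R ≤ ‖x‖ → V x = 0 := by
    intro x hx
    by_cases hg : gauge E x ∈ Ioo (1 : ℝ) 3
    · have hg0 : 0 < gauge E x := one_pos.trans hg.1
      have hz : R ≤ ‖radialProj (gauge E) x‖ := by
        have h1 : ‖x‖ = gauge E x * ‖radialProj (gauge E) x‖ := by
          conv_lhs => rw [← smul_radialProj hg0, norm_smul, Real.norm_eq_abs, abs_of_pos hg0]
        nlinarith [hg.2, norm_nonneg (radialProj (gauge E) x)]
      simp only [hV, hR _ hz, zero_mul, zero_smul]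
    · simp only [hV, radialBump_eq_zero hg, mul_zero, zero_smul]
  have hnear : ∀ x, IsLipschitzNear V x := by
    intro x
    rcases (gauge_nonneg (s := E) x).eq_or_lt with hx | hx
    · have hU : {y | gauge E y < 1} ∈ 𝓝 x :=
        (isOpen_lt (continuous_gauge hE.convex hE.mem_nhds) continuous_const).mem_nhds (by
          simp [← hx])
      refine ⟨0, _, hU, LipschitzOnWith.of_dist_le_mul fun y hy z hz => ?_⟩
      have h0 : ∀ y : Space n, gauge E y < 1 → V y = 0 := fun y hy => by
        simp only [hV, radialBump_eq_zero fun h1 => absurd h1.1 hy.not_gt, mul_zero, zero_smul]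
      rw [h0 y hy, h0 z hz, dist_self]
      simp
    · have h1 := (hE.isLipschitzNear_radialProj hx).contDiffAt_comp
        (hh _ (hE.radialProj_ne_zero hx))
      have h2 := (hE.isLipschitzNear_gauge x).contDiffAt_comp
        (radialBump.contDiff (n := 1)).contDiffAt
      exact (h1.smul h2).smul (hE.isLipschitzNear_normal_radialProj hx)
  refine ⟨exists_lipschitzWith_of_isLipschitzNear hnear (by positivity) hsupp ?_, ?_⟩
  · simp only [hV, gauge_zero]
    rw [radialBump_eq_zero (by simp), mul_zero, zero_smul]
  · refine HasCompactSupport.intro (isCompact_closedBall (0 : Space n) (3 * R)) fun x hx => ?_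
    refine hsupp x ?_
    rw [mem_closedBall_zero_iff, not_le] at hx
    exact hx.le

/-- Integration by parts on the boundary, with respect to the cone measure. -/
theorem integral_flux_coneMeasure (hn : 2 ≤ n) {h : Space n → ℝ}
    (hh : ∀ x ≠ 0, ContDiffAt ℝ 1 h x) {R : ℝ} (hR0 : 0 ≤ R) (hR : ∀ x, R ≤ ‖x‖ → h x = 0)
    (h1 : Integrable (fun z => h z * meanCurvature E z + fderiv ℝ h z (normal E z) -
      fderiv ℝ h z z / inner ℝ z (normal E z)) (coneMeasure (gauge E)))
    (h2 : Integrable (fun z => h z / inner ℝ z (normal E z)) (coneMeasure (gauge E))) :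
    ∫ z, (h z * meanCurvature E z + fderiv ℝ h z (normal E z) -
      fderiv ℝ h z z / inner ℝ z (normal E z)) ∂coneMeasure (gauge E) =
    ((n : ℝ) - 1) * ∫ z, h z / inner ℝ z (normal E z) ∂coneMeasure (gauge E) := by
  have hn0 : 0 < n := by omega
  obtain ⟨⟨K, hK⟩, hc⟩ := hE.exists_lipschitzWith_flux hh hR0 hR
  set V : Space n → Space n := fun y => (h (radialProj (gauge E) y) * radialBump (gauge E y)) •
        normal E (radialProj (gauge E) y) with hV
  set f₁ : Space n → ℝ := fun z => h z * meanCurvature E z + fderiv ℝ h z (normal E z) -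
      fderiv ℝ h z z / inner ℝ z (normal E z)
  set f₂ : Space n → ℝ := fun z => h z / inner ℝ z (normal E z)
  obtain ⟨hθ1, hθ2, hθpos, hθ⟩ := integral_radialBump hn
  have := hE.isHomogeneous.sigmaFinite_coneMeasure
  have : SFinite (powMeasure n) := by unfold powMeasure; infer_instance
  have hi1 := h1.mul_prod hθ1
  have hi2 := h2.mul_prod hθ2
  have hdiv := integral_divergence_eq_zero hK hc
  have hae : ∀ᵐ x, divergence V x = {x | 0 < gauge E x}.indicator (fun x =>
      f₁ (radialProj (gauge E) x) * (radialBump (gauge E x) / gauge E x) +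
      f₂ (radialProj (gauge E) x) * deriv radialBump (gauge E x)) x := by
    filter_upwards [hE.ae_differentiableAt] with x hx
    by_cases h0 : 0 < gauge E x
    · rw [indicator_of_mem (show x ∈ {x | 0 < gauge E x} from h0)]
      exact hE.divergence_flux_of_pos hh differentiable_radialBump h0 (hx h0).1 (hx h0).2
    · rw [indicator_of_notMem (show x ∉ {x | 0 < gauge E x} from h0)]
      have hU : {y | gauge E y < 1} ∈ 𝓝 x :=
        (isOpen_lt (continuous_gauge hE.convex hE.mem_nhds) continuous_const).mem_nhds (by
          rw [mem_ofPred_eq]; linarith)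
      have hV0 : V =ᶠ[𝓝 x] fun _ => 0 := by
        filter_upwards [hU] with y hy
        simp only [hV, radialBump_eq_zero fun h1 => absurd h1.1 (not_lt_of_gt hy), mul_zero,
          zero_smul]
      rw [divergence, hV0.fderiv_eq]
      simp
  have hm : MeasurableSet {x | 0 < gauge E x} :=
    measurableSet_lt measurable_const hE.isHomogeneous.measurable
  rw [integral_congr_ae hae, integral_indicator hm] at hdiv
  have hpolar := hE.isHomogeneous.integral_polar hn0
    (f := fun z => f₁ z.1 * (radialBump z.2 / z.2) + f₂ z.1 * deriv radialBump z.2)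
    (hi1.add hi2).aestronglyMeasurable
  simp only at hpolar
  rw [hdiv, integral_add hi1 hi2, integral_prod_mul (fun z => f₁ z) (fun s => radialBump s / s),
    integral_prod_mul (fun z => f₂ z) (fun s => deriv radialBump s), hθ] at hpolar
  -- The total divergence is zero and both of its terms factor; the common radial integral is
  -- nonzero.
  have hfin : (∫ s, radialBump s / s ∂powMeasure n) *
      (∫ z, f₁ z ∂coneMeasure (gauge E) -
        ((n : ℝ) - 1) * ∫ z, f₂ z ∂coneMeasure (gauge E)) = 0 := by
    linarith
  rcases mul_eq_zero.1 hfin with h3 | h3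
  · exact absurd h3 hθpos.ne'
  · exact sub_eq_zero.1 h3

end IsRegularConvex

/-! ### The radial energy without curvature, by cutoff on possibly unbounded boundaries -/

/-- The weight `e^{-|x|²/2} / |x|`. -/
def weight (x : Space n) : ℝ := Real.exp (-‖x‖ ^ 2 / 2) / ‖x‖

/-- The boundary integrand arising from the tangential derivative of the weight. -/
def tangentialTerm (E : Set (Space n)) (x : Space n) : ℝ :=
  (1 / ‖x‖ + 1 / ‖x‖ ^ 3) * (‖x‖ ^ 2 - inner ℝ x (normal E x) ^ 2) * Real.exp (-‖x‖ ^ 2 / 2)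

/-- A smooth cutoff, equal to `1` on the ball of radius `k + 1`. -/
def cutoffBump (n : ℕ) : ContDiffBump (0 : Space n) := ⟨1, 2, one_pos, by norm_num⟩

/-- The rescaled cutoff. -/
def cutoff (k : ℕ) (x : Space n) : ℝ := cutoffBump n (((k : ℝ) + 1)⁻¹ • x)

theorem cutoff_eq_one {k : ℕ} {x : Space n} (hx : ‖x‖ ≤ k + 1) : cutoff k x = 1 := by
  refine (cutoffBump n).one_of_mem_closedBall ?_
  rw [mem_closedBall_zero_iff, norm_smul, norm_inv, Real.norm_of_nonneg (by positivity),
    inv_mul_le_iff₀ (by positivity)]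
  change ‖x‖ ≤ (k + 1) * 1
  rwa [mul_one]

theorem cutoff_eq_zero {k : ℕ} {x : Space n} (hx : 2 * ((k : ℝ) + 1) ≤ ‖x‖) : cutoff k x = 0 := by
  refine (cutoffBump n).zero_of_le_dist ?_
  rw [dist_zero_right, norm_smul, norm_inv, Real.norm_of_nonneg (by positivity),
    le_inv_mul_iff₀ (by positivity), mul_comm]
  exact hx

theorem cutoff_nonneg (k : ℕ) (x : Space n) : 0 ≤ cutoff k x := (cutoffBump n).nonneg

theorem cutoff_le_one (k : ℕ) (x : Space n) : cutoff k x ≤ 1 := (cutoffBump n).le_one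

theorem contDiff_cutoff (k : ℕ) : ContDiff ℝ 1 (cutoff (n := n) k) :=
  (cutoffBump n).contDiff.comp (contDiff_const_smul _)

theorem exists_norm_fderiv_cutoff_le :
    ∃ C, ∀ (k : ℕ) (x : Space n), ‖fderiv ℝ (cutoff k) x‖ ≤ C * ((k : ℝ) + 1)⁻¹ := by
  obtain ⟨C, hC⟩ := ((cutoffBump n).contDiff (n := 1)).continuous_fderiv one_ne_zero
    |>.bounded_above_of_compact_support ((cutoffBump n).hasCompactSupport.fderiv ℝ)
  refine ⟨C, fun k x => ?_⟩
  have hs : HasFDerivAt (fun y : Space n => ((k : ℝ) + 1)⁻¹ • y)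
      (((k : ℝ) + 1)⁻¹ • ContinuousLinearMap.id ℝ (Space n)) x :=
    (hasFDerivAt_id x).const_smul ((k : ℝ) + 1)⁻¹
  have h1 : HasFDerivAt (cutoff (n := n) k)
      ((fderiv ℝ (cutoffBump n) (((k : ℝ) + 1)⁻¹ • x)).comp
        (((k : ℝ) + 1)⁻¹ • ContinuousLinearMap.id ℝ (Space n))) x :=
    (((cutoffBump n).contDiff (n := 1)).differentiable one_ne_zero _).hasFDerivAt.comp x hs
  rw [h1.fderiv, ContinuousLinearMap.comp_smul, ContinuousLinearMap.comp_id, norm_smul, norm_inv,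
    Real.norm_of_nonneg (by positivity : (0 : ℝ) ≤ (k : ℝ) + 1), mul_comm]
  gcongr
  exact hC _

theorem contDiffAt_weight {x : Space n} (hx : x ≠ 0) : ContDiffAt ℝ 1 (weight (n := n)) x := by
  refine ContDiffAt.div ?_ (contDiffAt_norm ℝ hx) (norm_ne_zero_iff.2 hx)
  exact (((contDiff_norm_sq ℝ).neg.div_const 2).exp).contDiffAt

theorem fderiv_weight {x : Space n} (hx : x ≠ 0) (v : Space n) :
    fderiv ℝ (weight (n := n)) x v =
      -(1 / ‖x‖ + 1 / ‖x‖ ^ 3) * Real.exp (-‖x‖ ^ 2 / 2) * inner ℝ x v := by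
  have ht : 0 < ‖x‖ := norm_pos_iff.2 hx
  have h1 : HasFDerivAt (fun y : Space n => ‖y‖ ^ 2) (2 • innerSL ℝ x) x :=
    (hasStrictFDerivAt_norm_sq x).hasFDerivAt
  have hu : HasDerivAt (fun s : ℝ => Real.exp (-s / 2) / Real.sqrt s)
      ((Real.exp (-‖x‖ ^ 2 / 2) * (-1 / 2) * Real.sqrt (‖x‖ ^ 2) -
        Real.exp (-‖x‖ ^ 2 / 2) * (1 / (2 * Real.sqrt (‖x‖ ^ 2)))) / Real.sqrt (‖x‖ ^ 2) ^ 2)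
      (‖x‖ ^ 2) := by
    have h2 : HasDerivAt (fun s : ℝ => Real.exp (-s / 2))
        (Real.exp (-‖x‖ ^ 2 / 2) * (-1 / 2)) (‖x‖ ^ 2) :=
      ((hasDerivAt_neg _).div_const 2).exp
    exact h2.div (Real.hasDerivAt_sqrt (by positivity)) (by rw [Real.sqrt_sq ht.le]; exact ht.ne')
  have h3 := hu.comp_hasFDerivAt x h1
  have h4 : ((fun s : ℝ => Real.exp (-s / 2) / Real.sqrt s) ∘ fun y : Space n => ‖y‖ ^ 2) =
      weight := by
    ext y
    simp only [Function.comp_apply, weight, Real.sqrt_sq (norm_nonneg y)]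
  rw [h4] at h3
  rw [h3.fderiv, Real.sqrt_sq ht.le]
  simp only [_root_.smul_apply, innerSL_apply_apply, smul_eq_mul, nsmul_eq_mul, Nat.cast_ofNat]
  field_simp
  ring

theorem exp_neg_half_le (x : Space n) : Real.exp (-‖x‖ ^ 2 / 2) ≤ Real.exp (-‖x‖ ^ 2 / 4) :=
  Real.exp_le_exp.2 (by nlinarith [sq_nonneg ‖x‖])

theorem norm_mul_exp_neg_half_le (x : Space n) :
    ‖x‖ * Real.exp (-‖x‖ ^ 2 / 2) ≤ 4 * Real.exp (-‖x‖ ^ 2 / 4) := by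
  have h1 : Real.exp (-‖x‖ ^ 2 / 2) = Real.exp (-‖x‖ ^ 2 / 4) * Real.exp (-‖x‖ ^ 2 / 4) := by
    rw [← Real.exp_add]; ring_nf
  have h2 : ‖x‖ * Real.exp (-‖x‖ ^ 2 / 4) ≤ 4 := by
    have h3 : Real.exp (-‖x‖ ^ 2 / 4) * Real.exp (‖x‖ ^ 2 / 4) = 1 := by
      rw [← Real.exp_add, ← Real.exp_zero]; congr 1; ring
    have h4 := Real.add_one_le_exp (‖x‖ ^ 2 / 4)
    have h5 : ‖x‖ ≤ 4 * Real.exp (‖x‖ ^ 2 / 4) := by nlinarith [sq_nonneg (‖x‖ - 2)]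
    calc ‖x‖ * Real.exp (-‖x‖ ^ 2 / 4)
        ≤ 4 * Real.exp (‖x‖ ^ 2 / 4) * Real.exp (-‖x‖ ^ 2 / 4) := by gcongr
      _ = 4 := by rw [mul_assoc, mul_comm (Real.exp (‖x‖ ^ 2 / 4)), h3, mul_one]
  rw [h1, ← mul_assoc]
  gcongr

namespace IsRegularConvex

variable {E : Set (Space n)} (hE : IsRegularConvex E)

include hE

/-- On `{0 < gauge E < 1}` projecting to `∂E` increases the norm, so the Gaussian at the projected
point is dominated by the integrable Gaussian at `x`, even when `E` is unbounded. -/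
theorem integrable_exp_coneMeasure :
    Integrable (fun z => Real.exp (-‖z‖ ^ 2 / 4)) (coneMeasure (gauge E)) := by
  have hcont : Continuous fun z : Space n => Real.exp (-‖z‖ ^ 2 / 4) := by fun_prop
  refine Integrable.smul_measure ?_ (ENNReal.natCast_ne_top n)
  rw [integrable_map_measure hcont.aestronglyMeasurable
    hE.isHomogeneous.measurable_radialProj.aemeasurable]
  have hG : Integrable fun x : Space n => Real.exp (-(1 / 4) * ‖x‖ ^ 2) := by
    have := GaussianFourier.integrable_cexp_neg_mul_sq_norm_add (V := Space n) (b := 1 / 4)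
      (by norm_num) 0 0
    have h2 := this.norm
    refine h2.congr (Eventually.of_forall fun x => ?_)
    simp only [zero_mul, add_zero, Complex.norm_exp]
    congr 1
    norm_cast
    simp
    norm_cast
  refine Integrable.mono' (hG.restrict (s := {x | 0 < gauge E x ∧ gauge E x < 1}))
    (hcont.measurable.comp hE.isHomogeneous.measurable_radialProj).aestronglyMeasurable ?_
  filter_upwards [ae_restrict_mem ((measurableSet_lt measurable_const
    hE.isHomogeneous.measurable).inter (measurableSet_lt hE.isHomogeneous.measurable
      measurable_const))] with x hx
  have h0 : 0 < gauge E x := hx.1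
  have h1 : gauge E x < 1 := hx.2
  have h2 : ‖x‖ ≤ ‖radialProj (gauge E) x‖ := by
    conv_lhs => rw [← smul_radialProj h0, norm_smul, Real.norm_eq_abs, abs_of_pos h0]
    exact mul_le_of_le_one_left (norm_nonneg _) h1.le
  rw [Function.comp_apply, Real.norm_of_nonneg (Real.exp_nonneg _)]
  refine Real.exp_le_exp.2 ?_
  have h3 : ‖x‖ ^ 2 ≤ ‖radialProj (gauge E) x‖ ^ 2 := by gcongr
  linarith

/-- The density `⟨x, ν⟩` of the cone measure is bounded below by a positive constant, so
integrability passes to the surface measure. -/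
theorem integrable_exp (hn : 0 < n) :
    Integrable (fun z => Real.exp (-‖z‖ ^ 2 / 4)) (boundaryMeasure E) := by
  have h1 := (hE.integrable_coneMeasure hn).1 hE.integrable_exp_coneMeasure
  obtain ⟨δ, hδ, h⟩ := hE.exists_le_inner
  refine (h1.const_mul δ⁻¹).mono' (Continuous.aestronglyMeasurable (by fun_prop)) ?_
  filter_upwards [ae_boundaryMeasure_mem] with z hz
  rw [Real.norm_of_nonneg (Real.exp_nonneg _), ← mul_assoc]
  refine le_mul_of_one_le_left (Real.exp_nonneg _) ?_
  rw [le_inv_mul_iff₀ hδ, mul_one]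
  exact h z hz

theorem integrable_of_continuousOn_of_le (hn : 0 < n) {f : Space n → ℝ}
    (hf : ContinuousOn f (frontier E)) {C : ℝ}
    (hC : ∀ z ∈ frontier E, |f z| ≤ C * Real.exp (-‖z‖ ^ 2 / 4)) :
    Integrable f (boundaryMeasure E) := by
  refine ((hE.integrable_exp hn).const_mul C).mono' (aestronglyMeasurable_of_continuousOn hf) ?_
  filter_upwards [ae_boundaryMeasure_mem] with z hz
  exact hC z hz

theorem norm_pos_of_mem {z : Space n} (hz : z ∈ frontier E) : 0 < ‖z‖ :=
  (hE.inner_pos hz).trans_le (hE.inner_le_norm hz)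

theorem continuousOn_weight : ContinuousOn (weight (n := n)) (frontier E) := by
  refine ContinuousOn.div (Continuous.continuousOn (by fun_prop)) continuous_norm.continuousOn
    fun z hz => (hE.norm_pos_of_mem hz).ne'

theorem continuousOn_tangentialTerm : ContinuousOn (tangentialTerm E) (frontier E) := by
  have h0 : ∀ z ∈ frontier E, ‖z‖ ≠ 0 := fun z hz => (hE.norm_pos_of_mem hz).ne'
  have h1 : ContinuousOn (fun z : Space n => ‖z‖) (frontier E) := continuous_norm.continuousOn
  refine ((ContinuousOn.add (continuousOn_const.div h1 h0)
    (continuousOn_const.div (h1.pow 3) fun z hz => pow_ne_zero 3 (h0 z hz))).mul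
    ((h1.pow 2).sub (hE.continuousOn_inner_normal.pow 2))).mul
    (Continuous.continuousOn (by fun_prop))

theorem integrable_weight (hn : 0 < n) : Integrable (weight (n := n)) (boundaryMeasure E) := by
  obtain ⟨δ, hδ, h⟩ := hE.exists_le_inner
  refine hE.integrable_of_continuousOn_of_le hn hE.continuousOn_weight (C := δ⁻¹) fun z hz => ?_
  have ht : δ ≤ ‖z‖ := (h z hz).trans (hE.inner_le_norm hz)
  rw [weight, abs_of_nonneg (by positivity), div_eq_inv_mul]
  exact mul_le_mul (inv_anti₀ hδ ht) (exp_neg_half_le z) (Real.exp_nonneg _) (by positivity)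

theorem integrable_tangentialTerm (hn : 0 < n) :
    Integrable (tangentialTerm E) (boundaryMeasure E) := by
  obtain ⟨δ, hδ, h⟩ := hE.exists_le_inner
  refine hE.integrable_of_continuousOn_of_le hn hE.continuousOn_tangentialTerm
    (C := 4 + δ⁻¹) fun z hz => ?_
  have ht : δ ≤ ‖z‖ := (h z hz).trans (hE.inner_le_norm hz)
  have ht0 : 0 < ‖z‖ := hδ.trans_le ht
  have hp := hE.inner_le_norm hz
  have hp0 := hE.inner_pos hz
  rw [tangentialTerm]
  set p : ℝ := inner ℝ z (normal E z)
  have h1 : 0 ≤ ‖z‖ ^ 2 - p ^ 2 := by nlinarith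
  rw [abs_of_nonneg (by positivity)]
  calc (1 / ‖z‖ + 1 / ‖z‖ ^ 3) * (‖z‖ ^ 2 - p ^ 2) * Real.exp (-‖z‖ ^ 2 / 2)
      ≤ (1 / ‖z‖ + 1 / ‖z‖ ^ 3) * ‖z‖ ^ 2 * Real.exp (-‖z‖ ^ 2 / 2) := by
        gcongr
        linarith [sq_nonneg p]
    _ = ‖z‖ * Real.exp (-‖z‖ ^ 2 / 2) + ‖z‖⁻¹ * Real.exp (-‖z‖ ^ 2 / 2) := by
        field_simp
    _ ≤ 4 * Real.exp (-‖z‖ ^ 2 / 4) + δ⁻¹ * Real.exp (-‖z‖ ^ 2 / 4) :=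
        add_le_add (norm_mul_exp_neg_half_le z)
          (mul_le_mul (inv_anti₀ hδ ht) (exp_neg_half_le z) (Real.exp_nonneg _) (by positivity))
    _ = (4 + δ⁻¹) * Real.exp (-‖z‖ ^ 2 / 4) := by ring

theorem integrable_radialDensity (hi : Integrable (curvatureDensity E) (boundaryMeasure E)) :
    Integrable (radialDensity E) (boundaryMeasure E) := by
  have hc : ContinuousOn (fun z => inner ℝ z (normal E z) / ‖z‖) (frontier E) :=
    hE.continuousOn_inner_normal.div continuous_norm.continuousOn
      fun z hz => (hE.norm_pos_of_mem hz).ne'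
  refine hi.norm.mono' ((aestronglyMeasurable_of_continuousOn hc).mul hi.aestronglyMeasurable) ?_
  filter_upwards [ae_boundaryMeasure_mem] with z hz
  have hp := hE.inner_le_norm hz
  have hp0 := hE.inner_pos hz
  have ht := hE.norm_pos_of_mem hz
  rw [radialDensity, norm_mul, Real.norm_of_nonneg (by positivity)]
  refine mul_le_of_le_one_left (norm_nonneg _) ?_
  rwa [div_le_one ht]

omit hE in
theorem tendsto_integral_cutoff_mul {f : Space n → ℝ} {μ : Measure (Space n)}
    (hf : Integrable f μ) :
    Tendsto (fun k : ℕ => ∫ x, cutoff k x * f x ∂μ) atTop (𝓝 (∫ x, f x ∂μ)) := by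
  refine tendsto_integral_of_dominated_convergence (fun x => ‖f x‖)
    (fun k => (contDiff_cutoff k).continuous.aestronglyMeasurable.mul hf.aestronglyMeasurable)
    hf.norm (fun k => Eventually.of_forall fun x => ?_) (Eventually.of_forall fun x => ?_)
  · rw [norm_mul, Real.norm_of_nonneg (cutoff_nonneg k x)]
    exact mul_le_of_le_one_left (norm_nonneg _) (cutoff_le_one k x)
  · refine tendsto_const_nhds.congr' ?_
    obtain ⟨N, hN⟩ := exists_nat_ge ‖x‖
    filter_upwards [eventually_ge_atTop N] with k hk
    have : (N : ℝ) ≤ k := by exact_mod_cast hk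
    rw [cutoff_eq_one (by linarith), one_mul]

/-- Integration by parts on the boundary for the field `e^{-|x|²/2} x / |x|`. -/
theorem radialEnergy_eq (hn : 2 ≤ n)
    (hi : Integrable (curvatureDensity E) (boundaryMeasure E)) :
    radialEnergy E = ∫ x, ((n : ℝ) - 1) * weight x - tangentialTerm E x ∂boundaryMeasure E := by
  have hn0 : 0 < n := by omega
  have hr := hE.integrable_radialDensity hi
  have hw := hE.integrable_weight hn0
  have hA := hE.integrable_tangentialTerm hn0
  have hrA : Integrable (fun x => radialDensity E x + tangentialTerm E x) (boundaryMeasure E) :=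
    hr.add hA
  have hwA : Integrable (fun x => ((n : ℝ) - 1) * weight x - tangentialTerm E x)
      (boundaryMeasure E) := (hw.const_mul _).sub hA
  obtain ⟨C, hC⟩ := exists_norm_fderiv_cutoff_le (n := n)
  have hC0 : 0 ≤ C := by
    have := (norm_nonneg _).trans (hC 0 0)
    simpa using this
  set f : Space n → ℝ := fun x =>
    radialDensity E x + tangentialTerm E x - ((n : ℝ) - 1) * weight x
  have hf : Integrable f (boundaryMeasure E) := (hr.add hA).sub (hw.const_mul _)
  -- The error from differentiating the cutoff. The factor `1 / ‖x‖` in the weight compensates the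
  -- growth of `x`, and the cutoff gradient is `O(1 / (k + 1))`, so its integral tends to `0`.
  set T : ℕ → Space n → ℝ := fun k x => weight x *
    (fderiv ℝ (cutoff k) x (normal E x) * inner ℝ x (normal E x) - fderiv ℝ (cutoff k) x x)
  have hTbound : ∀ k, ∀ z ∈ frontier E,
      |T k z| ≤ (2 * C * ((k : ℝ) + 1)⁻¹) * Real.exp (-‖z‖ ^ 2 / 4) := by
    intro k z hz
    have ht := hE.norm_pos_of_mem hz
    have hp := hE.inner_le_norm hz
    have hp0 := hE.inner_pos hz
    have e1 : |fderiv ℝ (cutoff k) z (normal E z)| ≤ C * ((k : ℝ) + 1)⁻¹ := by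
      have := (fderiv ℝ (cutoff k) z).le_of_opNorm_le (hC k z) (normal E z)
      rwa [hE.norm_normal z hz, mul_one] at this
    have e2 : |fderiv ℝ (cutoff k) z z| ≤ C * ((k : ℝ) + 1)⁻¹ * ‖z‖ :=
      (fderiv ℝ (cutoff k) z).le_of_opNorm_le (hC k z) z
    have e3 : |fderiv ℝ (cutoff k) z (normal E z) * inner ℝ z (normal E z) -
        fderiv ℝ (cutoff k) z z| ≤ 2 * C * ((k : ℝ) + 1)⁻¹ * ‖z‖ := by
      refine (abs_sub _ _).trans ?_
      rw [abs_mul, abs_of_pos hp0]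
      have := mul_le_mul e1 hp hp0.le ((abs_nonneg _).trans e1)
      linarith
    simp only [T]
    rw [abs_mul, weight, abs_of_nonneg (by positivity)]
    calc Real.exp (-‖z‖ ^ 2 / 2) / ‖z‖ * _
        ≤ Real.exp (-‖z‖ ^ 2 / 2) / ‖z‖ * (2 * C * ((k : ℝ) + 1)⁻¹ * ‖z‖) := by gcongr
      _ = 2 * C * ((k : ℝ) + 1)⁻¹ * Real.exp (-‖z‖ ^ 2 / 2) := by field_simp
      _ ≤ _ := mul_le_mul_of_nonneg_left (exp_neg_half_le z) (by positivity)
  have hTint : ∀ k, Integrable (T k) (boundaryMeasure E) := by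
    intro k
    refine hE.integrable_of_continuousOn_of_le hn0 ?_ (hTbound k)
    have hD : ContinuousOn (fderiv ℝ (cutoff (n := n) k)) (frontier E) :=
      ((contDiff_cutoff k).continuous_fderiv one_ne_zero).continuousOn
    exact hE.continuousOn_weight.mul (((hD.clm_apply hE.continuousOn_normal).mul
      hE.continuousOn_inner_normal).sub (hD.clm_apply continuousOn_id))
  have hstep : ∀ k : ℕ, ∫ x, cutoff k x * f x ∂boundaryMeasure E =
      -∫ x, T k x ∂boundaryMeasure E := by
    intro k
    set h : Space n → ℝ := fun x => cutoff k x * weight x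
    have hcut : ∀ {g : Space n → ℝ}, Integrable g (boundaryMeasure E) →
        Integrable (fun x => cutoff k x * g x) (boundaryMeasure E) := by
      intro g hg
      refine hg.norm.mono' ((contDiff_cutoff k).continuous.aestronglyMeasurable.mul
        hg.aestronglyMeasurable) (Eventually.of_forall fun x => ?_)
      rw [norm_mul, Real.norm_of_nonneg (cutoff_nonneg k x)]
      exact mul_le_of_le_one_left (norm_nonneg _) (cutoff_le_one k x)
    have hder : ∀ z ∈ frontier E, ∀ v, fderiv ℝ h z v =
        cutoff k z * (-(1 / ‖z‖ + 1 / ‖z‖ ^ 3) * Real.exp (-‖z‖ ^ 2 / 2) * inner ℝ z v) +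
          weight z * fderiv ℝ (cutoff k) z v := by
      intro z hz v
      have hz0 : z ≠ 0 := norm_pos_iff.1 (hE.norm_pos_of_mem hz)
      have h1 := ((contDiff_cutoff k).differentiable one_ne_zero z).hasFDerivAt.mul
        ((contDiffAt_weight hz0).differentiableAt one_ne_zero).hasFDerivAt
      have h2 : fderiv ℝ h z = _ := h1.fderiv
      rw [h2]
      simp only [_root_.add_apply, _root_.smul_apply, smul_eq_mul, fderiv_weight hz0]
    -- Multiplying by `⟨z, ν⟩` passes from the cone measure to the surface measure; the derivative
    -- of the weight produces `tangentialTerm`.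
    have e1 : ∀ z ∈ frontier E, inner ℝ z (normal E z) *
        (h z * meanCurvature E z + fderiv ℝ h z (normal E z) -
          fderiv ℝ h z z / inner ℝ z (normal E z)) =
        cutoff k z * (radialDensity E z + tangentialTerm E z) + T k z := by
      intro z hz
      have hp0 := hE.inner_pos hz
      have ht := hE.norm_pos_of_mem hz
      rw [hder z hz, hder z hz, real_inner_self_eq_norm_sq]
      simp only [h, T, radialDensity, curvatureDensity, tangentialTerm, weight]
      field_simp
      ring
    have e2 : ∀ z ∈ frontier E, inner ℝ z (normal E z) * (h z / inner ℝ z (normal E z)) =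
        cutoff k z * weight z := by
      intro z hz
      have hp0 := hE.inner_pos hz
      simp only [h]
      field_simp
    have i1 : Integrable (fun z => cutoff k z * (radialDensity E z + tangentialTerm E z) + T k z)
        (boundaryMeasure E) := (hcut hrA).add (hTint k)
    have i2 := hcut hw
    have ae1 := ae_boundaryMeasure_mem.mono e1
    have ae2 := ae_boundaryMeasure_mem.mono e2
    have key := hE.integral_flux_coneMeasure hn (h := h)
      (fun x hx => (contDiff_cutoff k).contDiffAt.mul (contDiffAt_weight hx))
      (R := 2 * ((k : ℝ) + 1)) (by positivity)
      (fun x hx => by simp only [h, cutoff_eq_zero hx, zero_mul])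
      ((hE.integrable_coneMeasure hn0).2 (i1.congr (ae1.mono fun _ h => h.symm)))
      ((hE.integrable_coneMeasure hn0).2 (i2.congr (ae2.mono fun _ h => h.symm)))
    rw [hE.integral_coneMeasure hn0, hE.integral_coneMeasure hn0, integral_congr_ae ae1,
      integral_congr_ae ae2, integral_add (hcut hrA) (hTint k)] at key
    have e3 : ∫ x, cutoff k x * f x ∂boundaryMeasure E =
        ∫ x, cutoff k x * (radialDensity E x + tangentialTerm E x) ∂boundaryMeasure E -
          ((n : ℝ) - 1) * ∫ x, cutoff k x * weight x ∂boundaryMeasure E := by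
      rw [← integral_const_mul, ← integral_sub (hcut hrA) (i2.const_mul _)]
      refine integral_congr_ae (Eventually.of_forall fun x => ?_)
      simp only [f]
      ring
    rw [e3]
    linarith
  have hlim := tendsto_integral_cutoff_mul hf
  have hT0 : Tendsto (fun k : ℕ => ∫ x, T k x ∂boundaryMeasure E) atTop (𝓝 0) := by
    have hb : ∀ k : ℕ, ‖∫ x, T k x ∂boundaryMeasure E‖ ≤
        (2 * C * ∫ x, Real.exp (-‖x‖ ^ 2 / 4) ∂boundaryMeasure E) * ((k : ℝ) + 1)⁻¹ := by
      intro k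
      refine (norm_integral_le_of_norm_le ((hE.integrable_exp hn0).const_mul _)
        (ae_boundaryMeasure_mem.mono (hTbound k))).trans_eq ?_
      rw [integral_const_mul]
      ring
    refine squeeze_zero_norm hb ?_
    have h1 : Tendsto (fun k : ℕ => ((k : ℝ) + 1)⁻¹) atTop (𝓝 0) := by
      simpa using tendsto_one_div_add_atTop_nhds_zero_nat (𝕜 := ℝ)
    simpa using h1.const_mul (2 * C * ∫ x, Real.exp (-‖x‖ ^ 2 / 4) ∂boundaryMeasure E)
  simp only [hstep] at hlim
  have hzero : ∫ x, f x ∂boundaryMeasure E = 0 :=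
    tendsto_nhds_unique hlim (by simpa using hT0.neg)
  have e4 : ∫ x, f x ∂boundaryMeasure E = radialEnergy E -
      ∫ x, ((n : ℝ) - 1) * weight x - tangentialTerm E x ∂boundaryMeasure E := by
    rw [radialEnergy, ← integral_sub hr hwA]
    refine integral_congr_ae (Eventually.of_forall fun x => ?_)
    simp only [f]
    ring
  linarith

end IsRegularConvex

/-! ### The Gauss-Green formula for the singular radial field -/

/-- The divergence of `x ↦ e^{-|x|²/2} x / |x|²`. -/
def radialDivergence (x : Space n) : ℝ :=
  (((n : ℝ) - 2) / ‖x‖ ^ 2 - 1) * Real.exp (-‖x‖ ^ 2 / 2)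

theorem measurable_radialDivergence : Measurable (radialDivergence (n := n)) := by
  unfold radialDivergence
  fun_prop

/-- The primitive, along a ray, of the radial divergence times the polar Jacobian. It vanishes at
the origin because `n - 2 ≥ 1`, so the singularity of the field carries no flux, and for `t ≠ 0` it
tends to `0` at infinity. -/
theorem hasDerivAt_radial (hn : 3 ≤ n) (t s : ℝ) :
    HasDerivAt (fun s : ℝ => s ^ (n - 2) * Real.exp (-(s * t) ^ 2 / 2) / t ^ 2)
      ((((n : ℝ) - 2) * s ^ (n - 3) - s ^ (n - 1) * t ^ 2) * Real.exp (-(s * t) ^ 2 / 2) / t ^ 2)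
      s := by
  obtain ⟨k, rfl⟩ := Nat.exists_eq_add_of_le' hn
  have h1 : HasDerivAt (fun s : ℝ => -(s * t) ^ 2 / 2) (-(s * t ^ 2)) s := by
    have := ((((hasDerivAt_id s).mul_const t).pow 2).neg.div_const 2)
    refine this.congr_deriv ?_
    simp only [id]
    push_cast
    ring
  have h2 := ((hasDerivAt_pow (k + 1) s).mul h1.exp).div_const (t ^ 2)
  refine h2.congr_deriv ?_
  simp only [show k + 3 - 3 = k from rfl, show k + 3 - 1 = k + 2 from rfl, Nat.add_sub_cancel]
  push_cast
  ring

theorem pow_mul_radialDivergence_smul (hn : 3 ≤ n) {s : ℝ} (hs : 0 < s) {z : Space n}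
    (hz : z ≠ 0) : s ^ (n - 1) * radialDivergence (s • z) =
      (((n : ℝ) - 2) * s ^ (n - 3) - s ^ (n - 1) * ‖z‖ ^ 2) *
        Real.exp (-(s * ‖z‖) ^ 2 / 2) / ‖z‖ ^ 2 := by
  have ht : 0 < ‖z‖ := norm_pos_iff.2 hz
  obtain ⟨k, rfl⟩ := Nat.exists_eq_add_of_le' hn
  rw [radialDivergence, norm_smul, Real.norm_of_nonneg hs.le]
  simp only [show k + 3 - 3 = k from rfl, show k + 3 - 1 = k + 2 from rfl]
  field_simp
  ring

theorem integral_Ioo_radialDivergence (hn : 3 ≤ n) {z : Space n} (hz : z ≠ 0) :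
    ∫ s in Ioo (0 : ℝ) 1, s ^ (n - 1) * radialDivergence (s • z) =
      Real.exp (-‖z‖ ^ 2 / 2) / ‖z‖ ^ 2 := by
  have ht : 0 < ‖z‖ := norm_pos_iff.2 hz
  rw [setIntegral_congr_fun measurableSet_Ioo
    fun s hs => pow_mul_radialDivergence_smul hn hs.1 hz, ← integral_Ioc_eq_integral_Ioo,
    ← intervalIntegral.integral_of_le zero_le_one,
    intervalIntegral.integral_eq_sub_of_hasDerivAt (fun s _ => hasDerivAt_radial hn ‖z‖ s)
      (Continuous.intervalIntegrable (by fun_prop) _ _)]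
  rw [zero_pow (by omega)]
  simp

theorem integrableOn_pow_mul_exp (k : ℕ) {b : ℝ} (hb : 0 < b) :
    IntegrableOn (fun s : ℝ => s ^ k * Real.exp (-b * s ^ 2)) (Ioi 0) := by
  have h := integrable_rpow_mul_exp_neg_mul_sq hb
    (s := (k : ℝ)) (by have : (0 : ℝ) ≤ k := k.cast_nonneg; linarith)
  refine h.integrableOn.congr_fun (fun s _ => ?_) measurableSet_Ioi
  simp only [Real.rpow_natCast]

theorem integrableOn_radialDivergence (hn : 3 ≤ n) {z : Space n} (hz : z ≠ 0) :
    IntegrableOn (fun s : ℝ => s ^ (n - 1) * radialDivergence (s • z)) (Ioi 0) := by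
  have ht : 0 < ‖z‖ := norm_pos_iff.2 hz
  have h1 := ((integrableOn_pow_mul_exp (n - 3) (b := ‖z‖ ^ 2 / 2) (by positivity)).const_mul
    (((n : ℝ) - 2) / ‖z‖ ^ 2)).sub (integrableOn_pow_mul_exp (n - 1) (b := ‖z‖ ^ 2 / 2)
      (by positivity))
  refine IntegrableOn.congr_fun h1 (fun s hs => ?_) measurableSet_Ioi
  rw [pow_mul_radialDivergence_smul hn hs hz]
  have h2 : -(s * ‖z‖) ^ 2 / 2 = -(‖z‖ ^ 2 / 2) * s ^ 2 := by ring
  simp only [Pi.sub_apply, h2]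
  field_simp

theorem integral_Ioi_radialDivergence (hn : 3 ≤ n) {z : Space n} (hz : z ≠ 0) :
    ∫ s in Ioi (0 : ℝ), s ^ (n - 1) * radialDivergence (s • z) = 0 := by
  have ht : 0 < ‖z‖ := norm_pos_iff.2 hz
  have hcongr : EqOn (fun s : ℝ => s ^ (n - 1) * radialDivergence (s • z)) (fun s : ℝ =>
      (((n : ℝ) - 2) * s ^ (n - 3) - s ^ (n - 1) * ‖z‖ ^ 2) *
        Real.exp (-(s * ‖z‖) ^ 2 / 2) / ‖z‖ ^ 2) (Ioi 0) :=
    fun s hs => pow_mul_radialDivergence_smul hn hs hz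
  have htend : Tendsto (fun s : ℝ => s ^ (n - 2) * Real.exp (-(s * ‖z‖) ^ 2 / 2) / ‖z‖ ^ 2)
      atTop (𝓝 0) := by
    have h1 : Tendsto (fun s : ℝ => s ^ (n - 2) * Real.exp (-(‖z‖ ^ 2 / 2) * s ^ 2)) atTop
        (𝓝 0) := by
      have h2 := rpow_mul_exp_neg_mul_sq_isLittleO_exp_neg (b := ‖z‖ ^ 2 / 2) (by positivity)
        ((n - 2 : ℕ) : ℝ)
      have h3 : Tendsto (fun s : ℝ => Real.exp (-(1 / 2) * s)) atTop (𝓝 0) := by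
        refine Real.tendsto_exp_atBot.comp ?_
        exact tendsto_id.const_mul_atTop_of_neg (by norm_num)
      have h4 := h2.trans_tendsto h3
      simpa only [Real.rpow_natCast] using h4
    have h5 := h1.div_const (‖z‖ ^ 2)
    rw [zero_div] at h5
    refine h5.congr fun s => ?_
    have h2 : -(s * ‖z‖) ^ 2 / 2 = -(‖z‖ ^ 2 / 2) * s ^ 2 := by ring
    rw [h2]
  rw [setIntegral_congr_fun measurableSet_Ioi hcongr,
    integral_Ioi_of_hasDerivAt_of_tendsto' (fun s _ => hasDerivAt_radial hn ‖z‖ s)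
      ((integrableOn_congr_fun hcongr measurableSet_Ioi).1 (integrableOn_radialDivergence hn hz))
      htend, zero_pow (by omega)]
  simp

theorem exists_norm_eq_one (hn : 0 < n) : ∃ z : Space n, ‖z‖ = 1 :=
  ⟨EuclideanSpace.basisFun (Fin n) ℝ ⟨0, hn⟩, (EuclideanSpace.basisFun (Fin n) ℝ).orthonormal.1 _⟩

theorem integrable_radialDivergence (hn : 3 ≤ n) : Integrable (radialDivergence (n := n)) := by
  obtain ⟨z, hz⟩ := exists_norm_eq_one (n := n) (by omega)
  have hz0 : z ≠ 0 := by rintro rfl; simp at hz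
  have : Nontrivial (Space n) := ⟨z, 0, hz0⟩
  have h := integrable_fun_norm_addHaar (volume : Measure (Space n))
    (f := fun t : ℝ => (((n : ℝ) - 2) / t ^ 2 - 1) * Real.exp (-t ^ 2 / 2))
  refine h.2 ((integrableOn_congr_fun (fun s hs => ?_) measurableSet_Ioi).1
    (integrableOn_radialDivergence hn hz0))
  rw [finrank_euclideanSpace_fin, smul_eq_mul, radialDivergence, norm_smul, hz, mul_one,
    Real.norm_of_nonneg (le_of_lt hs)]

theorem integral_radialDivergence (hn : 3 ≤ n) : ∫ x, radialDivergence (n := n) x = 0 := by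
  obtain ⟨z, hz⟩ := exists_norm_eq_one (n := n) (by omega)
  have hz0 : z ≠ 0 := by rintro rfl; simp at hz
  have : Nontrivial (Space n) := ⟨z, 0, hz0⟩
  have h := integral_fun_norm_addHaar (volume : Measure (Space n))
    (fun t : ℝ => (((n : ℝ) - 2) / t ^ 2 - 1) * Real.exp (-t ^ 2 / 2))
  refine h.trans ?_
  rw [finrank_euclideanSpace_fin]
  have h0 := integral_Ioi_radialDivergence hn hz0
  rw [setIntegral_congr_fun measurableSet_Ioi (g := fun s : ℝ =>
    s ^ (n - 1) • ((((n : ℝ) - 2) / s ^ 2 - 1) * Real.exp (-s ^ 2 / 2))) fun s hs => ?_] at h0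
  · rw [h0]
    simp
  · simp only [smul_eq_mul]
    rw [radialDivergence, norm_smul, hz, mul_one, Real.norm_of_nonneg (le_of_lt hs)]

namespace IsRegularConvex

variable {E : Set (Space n)} (hE : IsRegularConvex E)

include hE

/-- Gauge polar coordinates restricted to gauge values in `B`; needed for the whole ray and for its
part inside `E`. -/
theorem setIntegral_radialDivergence_pos (hn : 3 ≤ n) {B : Set ℝ} (hB : MeasurableSet B) :
    ∫ x in {x | 0 < gauge E x}, B.indicator (fun _ => radialDivergence x) (gauge E x) =
      ∫ z, (∫ s in Ioi (0 : ℝ) ∩ B, s ^ (n - 1) * radialDivergence (s • z))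
        ∂coneMeasure (gauge E) := by
  have hn0 : 0 < n := by omega
  have := hE.isHomogeneous.sigmaFinite_coneMeasure
  have : SFinite (powMeasure n) := by unfold powMeasure; infer_instance
  set f : Space n × ℝ → ℝ := fun q => B.indicator (fun s => radialDivergence (s • q.1)) q.2
  have hfm : Measurable f := by
    have h1 : f = (Prod.snd ⁻¹' B).indicator
        fun q : Space n × ℝ => radialDivergence (q.2 • q.1) := by
      ext q
      rfl
    rw [h1]
    exact (measurable_radialDivergence.comp (measurable_snd.smul measurable_fst)).indicator
      (measurable_snd hB)
  have heq : EqOn (fun x => f (radialProj (gauge E) x, gauge E x))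
      (fun x => B.indicator (fun _ => radialDivergence x) (gauge E x)) {x | 0 < gauge E x} := by
    intro x hx
    by_cases hxB : gauge E x ∈ B
    · simp only [f, indicator_of_mem hxB, smul_radialProj hx]
    · simp only [f, indicator_of_notMem hxB]
  have hm : MeasurableSet {x | 0 < gauge E x} :=
    measurableSet_lt measurable_const hE.isHomogeneous.measurable
  have hint : IntegrableOn (fun x => B.indicator (fun _ => radialDivergence x) (gauge E x))
      {x | 0 < gauge E x} := by
    have h1 : (fun x => B.indicator (fun _ => radialDivergence x) (gauge E x)) =
        (gauge E ⁻¹' B).indicator radialDivergence := by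
      ext x
      rfl
    rw [h1]
    exact ((integrable_radialDivergence hn).indicator
      (hE.isHomogeneous.measurable hB)).integrableOn
  have hprod := (hE.isHomogeneous.integrable_polar hn0 hfm.aestronglyMeasurable).1
    (hint.congr_fun heq.symm hm)
  rw [← setIntegral_congr_fun hm heq, hE.isHomogeneous.integral_polar hn0 hfm.aestronglyMeasurable,
    integral_prod _ hprod]
  refine integral_congr_ae (Eventually.of_forall fun z => ?_)
  simp only
  rw [integral_powMeasure, ← setIntegral_indicator hB]
  refine setIntegral_congr_fun measurableSet_Ioi fun s _ => ?_
  by_cases hs : s ∈ B <;> simp [f, hs]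

omit hE in
theorem ne_zero_of_mem (h0 : E ∈ 𝓝 (0 : Space n)) {z : Space n} (hz : z ∈ frontier E) : z ≠ 0 := by
  rintro rfl
  exact hz.2 (mem_interior_iff_mem_nhds.2 h0)

theorem ae_coneMeasure_ne_zero (hn : 0 < n) : ∀ᵐ z ∂coneMeasure (gauge E), z ≠ 0 := by
  rw [hE.ae_coneMeasure_iff hn]
  exact ae_boundaryMeasure_mem.mono fun z hz => ne_zero_of_mem hE.mem_nhds hz

/-- The Gauss-Green formula for the field `e^{-|x|²/2} x / |x|²`. -/
theorem integral_inner_div_sq (hn : 3 ≤ n) :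
    ∫ x, inner ℝ x (normal E x) / ‖x‖ ^ 2 * Real.exp (-‖x‖ ^ 2 / 2) ∂boundaryMeasure E =
      ∫ x in E, radialDivergence x := by
  have hn0 : 0 < n := by omega
  have hF := integrable_radialDivergence hn
  have hm : MeasurableSet {x | 0 < gauge E x} :=
    measurableSet_lt measurable_const hE.isHomogeneous.measurable
  have hm1 : MeasurableSet {x | gauge E x < 1} :=
    measurableSet_lt hE.isHomogeneous.measurable measurable_const
  have h1 : ∫ x in {x | 0 < gauge E x}, radialDivergence x = 0 := by
    have h2 := hE.setIntegral_radialDivergence_pos hn MeasurableSet.univ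
    simp only [indicator_univ, inter_univ] at h2
    rw [h2]
    refine integral_eq_zero_of_ae ?_
    filter_upwards [hE.ae_coneMeasure_ne_zero hn0] with z hz
    exact integral_Ioi_radialDivergence hn hz
  -- For unbounded `E` the gauge vanishes on a cone that polar coordinates miss. Its contribution is
  -- zero because the integrals over all of space and over the complement both vanish.
  have h2 : ∫ x in {x | 0 < gauge E x}ᶜ, radialDivergence x = 0 := by
    have := integral_add_compl hm hF
    rw [h1, integral_radialDivergence hn, zero_add] at this
    exact this
  have h3 : ∫ x in {x | 0 < gauge E x} ∩ {x | gauge E x < 1}, radialDivergence x =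
      ∫ z, Real.exp (-‖z‖ ^ 2 / 2) / ‖z‖ ^ 2 ∂coneMeasure (gauge E) := by
    have h4 := hE.setIntegral_radialDivergence_pos hn (measurableSet_Iio (a := (1 : ℝ)))
    rw [← setIntegral_indicator hm1]
    refine Eq.trans ?_ (h4.trans (integral_congr_ae ?_))
    · refine setIntegral_congr_fun hm fun x _ => ?_
      simp [indicator]
    · filter_upwards [hE.ae_coneMeasure_ne_zero hn0] with z hz
      rw [Ioi_inter_Iio]
      exact integral_Ioo_radialDivergence hn hz
  have h5 : ∫ x in E, radialDivergence x = ∫ x in {x | gauge E x < 1}, radialDivergence x := by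
    rw [setOfPred_gauge_lt_one_eq_interior hE.convex hE.mem_nhds]
    exact setIntegral_congr_set
      (interior_ae_eq_of_null_frontier (hE.convex.addHaar_frontier _)).symm
  have h6 : {x | gauge E x < 1} \ {x | 0 < gauge E x} = {x | 0 < gauge E x}ᶜ := by
    ext x
    simp only [Set.mem_sdiff, mem_ofPred_eq, mem_compl_iff, and_iff_right_iff_imp]
    intro h
    linarith
  rw [h5, ← integral_inter_add_sdiff hm hF.integrableOn, h6, h2, add_zero, inter_comm, h3,
    hE.integral_coneMeasure hn0]
  refine integral_congr_ae (Eventually.of_forall fun x => ?_)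
  simp only
  ring

end IsRegularConvex

/-! ### Gaussian volume of half-spaces and the distance of tangent planes -/

theorem integrable_exp_neg_norm_sq_div_two {V : Type*} [NormedAddCommGroup V]
    [InnerProductSpace ℝ V] [FiniteDimensional ℝ V] [MeasurableSpace V] [BorelSpace V] :
    Integrable fun x : V => Real.exp (-‖x‖ ^ 2 / 2) := by
  by_contra h
  have h1 := GaussianFourier.integral_rexp_neg_mul_sq_norm (V := V) (b := 1 / 2) (by norm_num)
  have h2 : (fun x : V => Real.exp (-(1 / 2) * ‖x‖ ^ 2)) = fun x => Real.exp (-‖x‖ ^ 2 / 2) := by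
    ext x; congr 1; ring
  rw [h2, integral_undef h] at h1
  have h3 : 0 < (Real.pi / (1 / 2)) ^ ((Module.finrank ℝ V : ℝ) / 2) := by positivity
  exact h3.ne h1

theorem integral_exp_neg_norm_sq_div_two {V : Type*} [NormedAddCommGroup V]
    [InnerProductSpace ℝ V] [FiniteDimensional ℝ V] [MeasurableSpace V] [BorelSpace V] :
    ∫ x : V, Real.exp (-‖x‖ ^ 2 / 2) = (2 * Real.pi) ^ ((Module.finrank ℝ V : ℝ) / 2) := by
  have h1 := GaussianFourier.integral_rexp_neg_mul_sq_norm (V := V) (b := 1 / 2) (by norm_num)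
  have h2 : (fun x : V => Real.exp (-(1 / 2) * ‖x‖ ^ 2)) = fun x => Real.exp (-‖x‖ ^ 2 / 2) := by
    ext x; congr 1; ring
  rw [h2] at h1
  rw [h1]
  congr 1
  ring

theorem integrable_exp_neg_sq_div_two : Integrable fun t : ℝ => Real.exp (-t ^ 2 / 2) := by
  simpa using integrable_exp_neg_norm_sq_div_two (V := ℝ)

/-- The Gaussian volume of a half-space. -/
theorem gaussianVolume_halfspace {v : Space n} (hv : ‖v‖ = 1) (s : ℝ) :
    gaussianVolume {x : Space n | inner ℝ x v ≤ s} = psi s := by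
  set S := Submodule.span ℝ {v}
  have hv0 : v ≠ 0 := by rintro rfl; simp at hv
  have hmp := S.measurePreserving_measurableEquivProd (0 : Space n)
  rw [finrank_euclideanSpace_fin, EuclideanSpace.euclideanHausdorffMeasure_eq_volume] at hmp
  set f : S → ℝ := {a : S | inner ℝ (a : Space n) v ≤ s}.indicator fun a => Real.exp (-‖a‖ ^ 2 / 2)
  set g : Sᗮ → ℝ := fun b => Real.exp (-‖b‖ ^ 2 / 2)
  have hvS : v ∈ S := Submodule.mem_span_singleton_self v
  have h1 : ∫ x in {x : Space n | inner ℝ x v ≤ s}, Real.exp (-‖x‖ ^ 2 / 2) =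
      (∫ a, f a) * ∫ b, g b := by
    rw [← integral_prod_mul, ← Measure.volume_eq_prod,
      ← hmp.integral_comp (MeasurableEquiv.measurableEmbedding _),
      ← integral_indicator (measurableSet_le (by fun_prop) measurable_const)]
    refine integral_congr_ae (Eventually.of_forall fun x => ?_)
    simp only [Submodule.measurableEquivProd_apply, vsub_eq_sub, sub_zero]
    have hin : inner ℝ ((S.orthogonalProjectionOnto x : S) : Space n) v = inner ℝ x v := by
      have := Submodule.inner_orthogonalProjectionOnto_eq_of_mem_right (K := S) ⟨v, hvS⟩ x
      exact this
    have hnorm : ‖x‖ ^ 2 = ‖S.orthogonalProjectionOnto x‖ ^ 2 +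
        ‖Sᗮ.orthogonalProjectionOnto x‖ ^ 2 :=
      Submodule.norm_sq_eq_add_norm_sq_projection x S
    by_cases hx : inner ℝ x v ≤ s
    · have hx' : S.orthogonalProjectionOnto x ∈ {a : S | inner ℝ (a : Space n) v ≤ s} := by
        rw [mem_ofPred_eq, hin]; exact hx
      rw [indicator_of_mem (show x ∈ {x : Space n | inner ℝ x v ≤ s} from hx)]
      simp only [f, g, indicator_of_mem hx']
      rw [← Real.exp_add, hnorm]
      congr 1
      ring
    · have hx' : S.orthogonalProjectionOnto x ∉ {a : S | inner ℝ (a : Space n) v ≤ s} := by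
        rw [mem_ofPred_eq, hin]; exact hx
      rw [indicator_of_notMem (show x ∉ {x : Space n | inner ℝ x v ≤ s} from hx)]
      simp only [f, indicator_of_notMem hx', zero_mul]
  have h2 : ∫ a, f a = ∫ t in Iic s, Real.exp (-t ^ 2 / 2) := by
    set L := LinearIsometryEquiv.toSpanUnitSingleton (𝕜 := ℝ) v hv
    rw [← (L.measurePreserving).integral_comp L.toHomeomorph.measurableEmbedding,
      ← integral_indicator measurableSet_Iic]
    refine integral_congr_ae (Eventually.of_forall fun t => ?_)
    have hL : inner ℝ ((L t : S) : Space n) v = t := by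
      simp [L, real_inner_smul_left, hv]
    by_cases ht : t ≤ s
    · have ht' : L t ∈ {a : S | inner ℝ (a : Space n) v ≤ s} := by
        rw [mem_ofPred_eq, hL]; exact ht
      simp only [f, indicator_of_mem ht', indicator_of_mem (mem_Iic.2 ht), L.norm_map,
        Real.norm_eq_abs, sq_abs]
    · have ht' : L t ∉ {a : S | inner ℝ (a : Space n) v ≤ s} := by
        rw [mem_ofPred_eq, hL]; exact ht
      simp only [f, indicator_of_notMem ht', indicator_of_notMem (mt mem_Iic.1 ht)]
  have h3 : (Module.finrank ℝ Sᗮ : ℝ) = n - 1 := by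
    have h4 := S.finrank_add_finrank_orthogonal
    rw [finrank_span_singleton hv0, finrank_euclideanSpace_fin] at h4
    have h5 : (1 : ℝ) + Module.finrank ℝ Sᗮ = n := by exact_mod_cast h4
    linarith
  have h4 : (2 * Real.pi) ^ ((n : ℝ) / 2) =
      (2 * Real.pi) ^ (((n : ℝ) - 1) / 2) * Real.sqrt (2 * Real.pi) := by
    rw [Real.sqrt_eq_rpow, ← Real.rpow_add (by positivity)]
    congr 1
    ring
  have h5 : (0 : ℝ) < (2 * Real.pi) ^ (((n : ℝ) - 1) / 2) := by positivity
  rw [gaussianVolume, psi, h1, h2, integral_exp_neg_norm_sq_div_two, h3, h4]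
  field_simp

theorem psi_pos (s : ℝ) : 0 < psi s := by
  refine mul_pos (by positivity) ?_
  rw [setIntegral_pos_iff_support_of_nonneg_ae
    (Eventually.of_forall fun t => (Real.exp_pos _).le) integrable_exp_neg_sq_div_two.integrableOn]
  have : (Function.support fun t : ℝ => Real.exp (-t ^ 2 / 2)) = univ :=
    eq_univ_of_forall fun t => (Real.exp_pos _).ne'
  rw [this, univ_inter]
  simp

theorem strictMono_psi : StrictMono psi := by
  intro a b hab
  rw [psi, psi]
  refine mul_lt_mul_of_pos_left ?_ (by positivity)
  have hi := integrable_exp_neg_sq_div_two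
  have h := intervalIntegral.integral_Iic_sub_Iic (hi.integrableOn (s := Iic a))
    (hi.integrableOn (s := Iic b))
  have hpos := intervalIntegral.intervalIntegral_pos_of_pos
    (hi.intervalIntegrable (a := a) (b := b)) (fun t => Real.exp_pos _) hab
  linarith

theorem gaussianVolume_mono {E F : Set (Space n)} (h : E ⊆ F) :
    gaussianVolume E ≤ gaussianVolume F := by
  refine mul_le_mul_of_nonneg_left ?_ (by positivity)
  exact setIntegral_mono_set integrable_exp_neg_norm_sq_div_two.integrableOn
    (Eventually.of_forall fun x => (Real.exp_pos _).le) (Eventually.of_forall h)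

/-- A set with empty interior lies in its frontier, which is Lebesgue-null for a convex set. -/
theorem interior_nonempty_of_gaussianVolume_pos {E : Set (Space n)} (hc : Convex ℝ E)
    (h : 0 < gaussianVolume E) : (interior E).Nonempty := by
  by_contra hne
  rw [not_nonempty_iff_eq_empty] at hne
  have h1 : volume E = 0 := by
    refine measure_mono_null (fun x hx => ?_) (hc.addHaar_frontier volume)
    exact ⟨subset_closure hx, by rw [hne]; simp⟩
  rw [gaussianVolume, Measure.restrict_eq_zero.2 h1, integral_zero_measure, mul_zero] at h
  exact h.false

/-- The tangent planes of a convex set of large Gaussian volume are far from the origin. -/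
theorem HasDefiningFunctions.le_inner_normal {E : Set (Space n)}
    (hE : HasDefiningFunctions E) (hc : Convex ℝ E) {a : ℝ} (ha : psi a ≤ gaussianVolume E)
    {x : Space n} (hx : x ∈ frontier E) : a ≤ inner ℝ x (normal E x) := by
  have hi := interior_nonempty_of_gaussianVolume_pos hc ((psi_pos a).trans_le ha)
  have hν := hE.isExteriorNormal hx
  have hsub : E ⊆ {y : Space n | inner ℝ y (normal E x) ≤ inner ℝ x (normal E x)} := by
    intro y hy
    have := hν.inner_sub_le_zero hc hi hx (subset_closure hy)
    rw [inner_sub_left] at this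
    rw [mem_ofPred_eq]
    linarith
  have h1 := gaussianVolume_mono hsub
  rw [gaussianVolume_halfspace hν.1] at h1
  exact strictMono_psi.le_iff_le.1 (ha.trans h1)

/-- The origin is interior: on the boundary it would satisfy `0 = ⟨0, ν⟩ ≥ a > 0`. -/
theorem HasDefiningFunctions.isRegularConvex {E : Set (Space n)} (hE : HasDefiningFunctions E)
    (hc : Convex ℝ E) (h0 : (0 : Space n) ∈ E) {a : ℝ} (ha0 : 0 < a)
    (ha : psi a ≤ gaussianVolume E) : IsRegularConvex E where
  convex := hc
  mem_nhds := by
    rw [← mem_interior_iff_mem_nhds]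
    by_contra hi
    have := hE.le_inner_normal hc ha (x := 0) ⟨subset_closure h0, hi⟩
    rw [inner_zero_left] at this
    linarith
  norm_normal x hx := (hE.isExteriorNormal hx).1
  inner_sub_le_zero x hx y hy := (hE.isExteriorNormal hx).inner_sub_le_zero hc
    (interior_nonempty_of_gaussianVolume_pos hc ((psi_pos a).trans_le ha)) hx hy
  locallyLipschitzOn := hE.locallyLipschitzOn_normal

/-! ### Centered balls -/

section Ball

variable {r : ℝ}

theorem normal_ball (hr : 0 < r) {x : Space n} (hx : ‖x‖ = r) :
    normal (Metric.ball (0 : Space n) r) x = r⁻¹ • x := by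
  refine IsExteriorNormal.normal_eq ⟨?_, fun ε hε => ?_⟩
  · rw [norm_smul, norm_inv, Real.norm_of_nonneg hr.le, hx, inv_mul_cancel₀ hr.ne']
  · filter_upwards [Metric.ball_mem_nhds x (by positivity : 0 < 2 * r * ε)] with y hy
    rw [mem_ball_iff_norm] at hy
    have h1 : ‖y‖ ^ 2 = r ^ 2 + 2 * inner ℝ (y - x) x + ‖y - x‖ ^ 2 := by
      conv_lhs => rw [show y = (y - x) + x by abel]
      rw [norm_add_sq_real, hx]
      ring
    have h2 : inner ℝ (y - x) (r⁻¹ • x) = r⁻¹ * inner ℝ (y - x) x := real_inner_smul_right _ _ _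
    have h3 : inner ℝ (y - x) x = r * inner ℝ (y - x) (r⁻¹ • x) := by
      rw [h2, mul_inv_cancel_left₀ hr.ne']
    rw [h3] at h1
    have hd := norm_nonneg (y - x)
    constructor
    · intro hlt
      rw [mem_ball_zero_iff]
      refine lt_of_pow_lt_pow_left₀ 2 hr.le ?_
      have := mul_lt_mul_of_pos_left hlt hr
      nlinarith
    · intro hlt
      rw [mem_ball_zero_iff, not_lt]
      refine le_of_sq_le_sq ?_ (norm_nonneg y)
      have := mul_lt_mul_of_pos_left hlt hr
      have : 0 ≤ r * (ε * ‖y - x‖) := by positivity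
      nlinarith [sq_nonneg ‖y - x‖]

theorem mem_frontier_ball (hr : 0 < r) {x : Space n} :
    x ∈ frontier (Metric.ball (0 : Space n) r) ↔ ‖x‖ = r := by
  rw [frontier_ball _ hr.ne', mem_sphere_zero_iff_norm]

theorem isRegularConvex_ball (hr : 0 < r) : IsRegularConvex (Metric.ball (0 : Space n) r) where
  convex := convex_ball 0 r
  mem_nhds := Metric.ball_mem_nhds 0 hr
  norm_normal x hx := by
    rw [mem_frontier_ball hr] at hx
    rw [normal_ball hr hx, norm_smul, norm_inv, Real.norm_of_nonneg hr.le, hx,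
      inv_mul_cancel₀ hr.ne']
  inner_sub_le_zero x hx y hy := by
    rw [mem_frontier_ball hr] at hx
    rw [closure_ball _ hr.ne', mem_closedBall_zero_iff] at hy
    rw [normal_ball hr hx, real_inner_smul_right, inner_sub_left, real_inner_self_eq_norm_sq, hx]
    have := real_inner_le_norm y x
    rw [hx] at this
    refine mul_nonpos_of_nonneg_of_nonpos (by positivity) ?_
    nlinarith
  locallyLipschitzOn := by
    have h1 : LipschitzWith ‖r⁻¹‖₊ fun x : Space n => r⁻¹ • x := lipschitzWith_smul _
    intro x _
    refine ⟨‖r⁻¹‖₊, frontier (Metric.ball (0 : Space n) r), self_mem_nhdsWithin, ?_⟩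
    intro y hy z hz
    rw [normal_ball hr ((mem_frontier_ball hr).1 hy), normal_ball hr ((mem_frontier_ball hr).1 hz)]
    exact h1 y z

theorem meanCurvature_ball (hr : 0 < r) {x : Space n} (hx : ‖x‖ = r) :
    meanCurvature (Metric.ball (0 : Space n) r) x = ((n : ℝ) - 1) / r := by
  have hE := isRegularConvex_ball (n := n) hr
  have hx0 : x ≠ 0 := by rintro rfl; rw [norm_zero] at hx; exact hr.ne hx
  have hg : DifferentiableAt ℝ (gauge (Metric.ball (0 : Space n) r)) x := by
    have : gauge (Metric.ball (0 : Space n) r) = fun y => ‖y‖ / r := by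
      ext y; exact gauge_ball hr.le y
    rw [this]
    have h : DifferentiableAt ℝ (fun y : Space n => ‖y‖) x :=
      (contDiffAt_norm ℝ hx0).differentiableAt (n := 1) one_ne_zero
    simpa only [div_eq_mul_inv] using h.mul_const r⁻¹
  have hf : HasFDerivAt (fun y : Space n => r⁻¹ • y) (r⁻¹ • ContinuousLinearMap.id ℝ (Space n)) x :=
    (hasFDerivAt_id x).const_smul r⁻¹
  have htr : LinearMap.trace ℝ (Space n)
      (ContinuousLinearMap.id ℝ (Space n) : Space n →ₗ[ℝ] Space n) = n := by
    change LinearMap.trace ℝ (Space n) LinearMap.id = _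
    rw [LinearMap.trace_id, finrank_euclideanSpace_fin]
  rw [hE.meanCurvature_eq ((mem_frontier_ball hr).2 hx) hg hf fun y hy =>
    (normal_ball hr ((mem_frontier_ball hr).1 hy)).symm, ContinuousLinearMap.toLinearMap_smul,
    map_smul, _root_.smul_apply, real_inner_smul_left, ContinuousLinearMap.id_apply,
    real_inner_self_eq_norm_sq, hE.norm_normal x ((mem_frontier_ball hr).2 hx),
    htr, smul_eq_mul]
  field_simp

/-- On the sphere `H = (n - 1) / r = (n - 1) ⟨x, ν⟩ / ‖x‖²`, so the Gauss-Green formula applies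
directly. -/
theorem curvatureEnergy_ball (hn : 3 ≤ n) (hr : 0 < r) :
    curvatureEnergy (Metric.ball (0 : Space n) r) =
      ((n : ℝ) - 1) * ∫ x in Metric.ball (0 : Space n) r, radialDivergence x := by
  have hE := isRegularConvex_ball (n := n) hr
  rw [← hE.integral_inner_div_sq hn, ← integral_const_mul]
  refine integral_congr_ae ?_
  filter_upwards [IsRegularConvex.ae_boundaryMeasure_mem] with x hx
  rw [mem_frontier_ball hr] at hx
  rw [curvatureDensity, meanCurvature_ball hr hx, normal_ball hr hx, real_inner_smul_right,
    real_inner_self_eq_norm_sq, hx]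
  field_simp

theorem radialEnergy_ball (hr : 0 < r) :
    radialEnergy (Metric.ball (0 : Space n) r) = curvatureEnergy (Metric.ball (0 : Space n) r) := by
  refine integral_congr_ae ?_
  filter_upwards [IsRegularConvex.ae_boundaryMeasure_mem] with x hx
  rw [mem_frontier_ball hr] at hx
  rw [radialDensity, normal_ball hr hx, real_inner_smul_right, real_inner_self_eq_norm_sq, hx]
  field_simp

end Ball

/-! ### Maximality of balls and the pointwise inequalities -/

/-- Among sets of given Gaussian volume, centered balls maximize the integral of the radial
divergence. -/
theorem setIntegral_radialDivergence_le (hn : 3 ≤ n) {E : Set (Space n)} (hc : Convex ℝ E) {r : ℝ}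
    (hr : 0 < r) (h : gaussianVolume E = gaussianVolume (Metric.ball (0 : Space n) r)) :
    ∫ x in E, radialDivergence x ≤ ∫ x in Metric.ball (0 : Space n) r, radialDivergence x := by
  have hae : (interior E : Set (Space n)) =ᵐ[volume] E :=
    interior_ae_eq_of_null_frontier (hc.addHaar_frontier _)
  have hF := integrable_radialDivergence hn
  have hG : Integrable fun x : Space n => Real.exp (-‖x‖ ^ 2 / 2) :=
    integrable_exp_neg_norm_sq_div_two
  -- The ratio of the radial divergence to the Gaussian on the sphere of radius `r`. Subtracting `c`
  -- times the Gaussian leaves a density that is nonnegative in the ball and nonpositive outside,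
  -- while equal volumes make the subtracted terms cancel.
  set c : ℝ := ((n : ℝ) - 2) / r ^ 2 - 1 with hcdef
  have hvol : ∫ x in interior E, Real.exp (-‖x‖ ^ 2 / 2) =
      ∫ x in Metric.ball (0 : Space n) r, Real.exp (-‖x‖ ^ 2 / 2) := by
    rw [setIntegral_congr_set hae]
    rw [gaussianVolume, gaussianVolume] at h
    exact mul_left_cancel₀ (by positivity) h
  have hn2 : (0 : ℝ) ≤ (n : ℝ) - 2 := by
    have : (3 : ℝ) ≤ n := by exact_mod_cast hn
    linarith
  have hI : Integrable fun x : Space n => radialDivergence x - c * Real.exp (-‖x‖ ^ 2 / 2) :=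
    hF.sub (hG.const_mul c)
  have key : ∫ x in interior E, (radialDivergence x - c * Real.exp (-‖x‖ ^ 2 / 2)) ≤
      ∫ x in Metric.ball (0 : Space n) r, (radialDivergence x - c * Real.exp (-‖x‖ ^ 2 / 2)) := by
    rw [← integral_indicator isOpen_interior.measurableSet,
      ← integral_indicator measurableSet_ball]
    have : Nontrivial (Space n) := by
      obtain ⟨z, hz⟩ := exists_norm_eq_one (n := n) (by omega)
      exact ⟨z, 0, by rintro rfl; simp at hz⟩
    refine integral_mono_ae (hI.indicator isOpen_interior.measurableSet)
      (hI.indicator measurableSet_ball) ?_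
    filter_upwards [compl_mem_ae_iff.2 (measure_singleton (0 : Space n))] with x hx0
    have hx : 0 < ‖x‖ := norm_pos_iff.2 hx0
    have hid : radialDivergence x - c * Real.exp (-‖x‖ ^ 2 / 2) =
        (((n : ℝ) - 2) / ‖x‖ ^ 2 - ((n : ℝ) - 2) / r ^ 2) * Real.exp (-‖x‖ ^ 2 / 2) := by
      rw [radialDivergence, hcdef]
      ring
    by_cases hxB : x ∈ Metric.ball (0 : Space n) r
    · rw [indicator_of_mem hxB]
      refine indicator_apply_le' (fun _ => le_rfl) fun _ => ?_
      rw [hid]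
      refine mul_nonneg (sub_nonneg.2 ?_) (Real.exp_nonneg _)
      rw [mem_ball_zero_iff] at hxB
      gcongr
    · rw [indicator_of_notMem hxB]
      refine indicator_apply_le' (fun _ => ?_) fun _ => le_rfl
      rw [hid]
      refine mul_nonpos_of_nonpos_of_nonneg (sub_nonpos.2 ?_) (Real.exp_nonneg _)
      rw [mem_ball_zero_iff, not_lt] at hxB
      gcongr
  rw [integral_sub hF.integrableOn (hG.const_mul c).integrableOn,
    integral_sub hF.integrableOn (hG.const_mul c).integrableOn, integral_const_mul,
    integral_const_mul, hvol, setIntegral_congr_set hae] at key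
  linarith

namespace IsRegularConvex

variable {E : Set (Space n)} (hE : IsRegularConvex E)

include hE

theorem integrable_inner_div_sq (hn : 0 < n) : Integrable
    (fun x => inner ℝ x (normal E x) / ‖x‖ ^ 2 * Real.exp (-‖x‖ ^ 2 / 2)) (boundaryMeasure E) := by
  have hc : ContinuousOn (fun x => inner ℝ x (normal E x) / ‖x‖ ^ 2 * Real.exp (-‖x‖ ^ 2 / 2))
      (frontier E) :=
    (hE.continuousOn_inner_normal.div (continuous_norm.continuousOn.pow 2)
      fun z hz => pow_ne_zero 2 (hE.norm_pos_of_mem hz).ne').mul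
      (Continuous.continuousOn (by fun_prop))
  refine (hE.integrable_weight hn).mono' (aestronglyMeasurable_of_continuousOn hc) ?_
  filter_upwards [ae_boundaryMeasure_mem] with x hx
  have hp := hE.inner_le_norm hx
  have hp0 := hE.inner_pos hx
  have ht := hE.norm_pos_of_mem hx
  rw [Real.norm_of_nonneg (by positivity), weight]
  calc inner ℝ x (normal E x) / ‖x‖ ^ 2 * Real.exp (-‖x‖ ^ 2 / 2)
      ≤ ‖x‖ / ‖x‖ ^ 2 * Real.exp (-‖x‖ ^ 2 / 2) := by gcongr
    _ = Real.exp (-‖x‖ ^ 2 / 2) / ‖x‖ := by field_simp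

theorem le_curvatureEnergy_ball (hn : 3 ≤ n) {r : ℝ} (hr : 0 < r)
    (h : gaussianVolume E = gaussianVolume (Metric.ball (0 : Space n) r)) :
    ((n : ℝ) - 1) * ∫ x, inner ℝ x (normal E x) / ‖x‖ ^ 2 * Real.exp (-‖x‖ ^ 2 / 2)
      ∂boundaryMeasure E ≤ curvatureEnergy (Metric.ball (0 : Space n) r) := by
  rw [curvatureEnergy_ball hn hr, hE.integral_inner_div_sq hn]
  have : (3 : ℝ) ≤ n := by exact_mod_cast hn
  exact mul_le_mul_of_nonneg_left (setIntegral_radialDivergence_le hn hE.convex hr h) (by linarith)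

/-- After integration by parts the inequality is pointwise: the difference of integrands has the
factor `t - p ≥ 0`, and the other factor is nonnegative since `t² ≥ p² ≥ n - 2`. -/
theorem radialEnergy_le (hn : 3 ≤ n)
    (hp : ∀ x ∈ frontier E, Real.sqrt ((n : ℝ) - 2) ≤ inner ℝ x (normal E x))
    (hi : Integrable (curvatureDensity E) (boundaryMeasure E)) :
    radialEnergy E ≤ ((n : ℝ) - 1) *
      ∫ x, inner ℝ x (normal E x) / ‖x‖ ^ 2 * Real.exp (-‖x‖ ^ 2 / 2) ∂boundaryMeasure E := by
  have hn0 : 0 < n := by omega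
  have hn3 : (3 : ℝ) ≤ n := by exact_mod_cast hn
  rw [hE.radialEnergy_eq (by omega) hi, ← integral_const_mul]
  refine integral_mono_ae (((hE.integrable_weight hn0).const_mul _).sub
    (hE.integrable_tangentialTerm hn0)) ((hE.integrable_inner_div_sq hn0).const_mul _) ?_
  filter_upwards [ae_boundaryMeasure_mem] with x hx
  have ht := hE.norm_pos_of_mem hx
  have hpt := hE.inner_le_norm hx
  have hp0 := hE.inner_pos hx
  have hps := hp x hx
  simp only [weight, tangentialTerm]
  generalize inner ℝ x (normal E x) = p at *
  generalize ‖x‖ = t at *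
  have hp2 : (n : ℝ) - 2 ≤ p ^ 2 := by
    rw [← Real.sq_sqrt (by linarith : (0 : ℝ) ≤ (n : ℝ) - 2)]
    gcongr
  have hmain : 0 ≤ (t - p) * ((t ^ 2 + 1) * (t + p) - ((n : ℝ) - 1) * t) := by
    refine mul_nonneg (sub_nonneg.2 hpt) ?_
    have : (n : ℝ) - 1 ≤ t ^ 2 + 1 := by nlinarith
    nlinarith
  have hid : ((n : ℝ) - 1) * (p / t ^ 2 * Real.exp (-t ^ 2 / 2)) -
      (((n : ℝ) - 1) * (Real.exp (-t ^ 2 / 2) / t) -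
        (1 / t + 1 / t ^ 3) * (t ^ 2 - p ^ 2) * Real.exp (-t ^ 2 / 2)) =
      (t - p) * ((t ^ 2 + 1) * (t + p) - ((n : ℝ) - 1) * t) * (Real.exp (-t ^ 2 / 2) / t ^ 3) := by
    field_simp
    ring
  have := mul_nonneg hmain (by positivity : 0 ≤ Real.exp (-t ^ 2 / 2) / t ^ 3)
  linarith

/-- The excess `(1 - p/t) H` over the radial density carries the factor `t - p` too, so it can be
charged to the slack in the radial estimate. -/
theorem curvatureEnergy_le (hn : 3 ≤ n) {M : ℝ}
    (hp : ∀ x ∈ frontier E, Real.sqrt ((n : ℝ) - 2) ≤ inner ℝ x (normal E x))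
    (hM : ∀ x ∈ frontier E, M ≤ inner ℝ x (normal E x))
    (hH : ∀ᵐ x ∂boundaryMeasure E, meanCurvature E x ≤ M)
    (hi : Integrable (curvatureDensity E) (boundaryMeasure E)) :
    curvatureEnergy E ≤ ((n : ℝ) - 1) *
      ∫ x, inner ℝ x (normal E x) / ‖x‖ ^ 2 * Real.exp (-‖x‖ ^ 2 / 2) ∂boundaryMeasure E := by
  have hn0 : 0 < n := by omega
  have hn3 : (3 : ℝ) ≤ n := by exact_mod_cast hn
  have hr := hE.integrable_radialDensity hi
  have hwA : Integrable (fun x => ((n : ℝ) - 1) * weight x - tangentialTerm E x)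
      (boundaryMeasure E) :=
    ((hE.integrable_weight hn0).const_mul _).sub (hE.integrable_tangentialTerm hn0)
  have hq : Integrable (fun x => ((n : ℝ) - 1) *
      (inner ℝ x (normal E x) / ‖x‖ ^ 2 * Real.exp (-‖x‖ ^ 2 / 2))) (boundaryMeasure E) :=
    (hE.integrable_inner_div_sq hn0).const_mul _
  have hdiff : ∫ x, curvatureDensity E x - radialDensity E x ∂boundaryMeasure E ≤
      ∫ x, ((n : ℝ) - 1) * (inner ℝ x (normal E x) / ‖x‖ ^ 2 * Real.exp (-‖x‖ ^ 2 / 2)) -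
        (((n : ℝ) - 1) * weight x - tangentialTerm E x) ∂boundaryMeasure E := by
    refine integral_mono_ae (hi.sub hr) (hq.sub hwA) ?_
    filter_upwards [ae_boundaryMeasure_mem, hH] with x hx hHx
    have ht := hE.norm_pos_of_mem hx
    have hpt := hE.inner_le_norm hx
    have hp0 := hE.inner_pos hx
    have hps := hp x hx
    have hMx := hM x hx
    simp only [weight, tangentialTerm, radialDensity, curvatureDensity]
    generalize inner ℝ x (normal E x) = p at *
    generalize meanCurvature E x = H at *
    generalize ‖x‖ = t at *
    have hp2 : (n : ℝ) - 2 ≤ p ^ 2 := by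
      rw [← Real.sq_sqrt (by linarith : (0 : ℝ) ≤ (n : ℝ) - 2)]
      gcongr
    have hHt : H ≤ t := by linarith
    -- Replacing `H` by its upper bound `t` leaves `t (t p - (n - 2)) + p` in the second factor, and
    -- `t p ≥ p² ≥ n - 2`.
    have hmain : 0 ≤ (t - p) * ((t ^ 2 + 1) * (t + p) - ((n : ℝ) - 1) * t - t ^ 2 * H) := by
      refine mul_nonneg (sub_nonneg.2 hpt) ?_
      have h1 : t ^ 2 * H ≤ t ^ 2 * t := by gcongr
      have h2 : p ^ 2 ≤ t * p := by nlinarith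
      nlinarith
    have hid : ((n : ℝ) - 1) * (p / t ^ 2 * Real.exp (-t ^ 2 / 2)) -
        (((n : ℝ) - 1) * (Real.exp (-t ^ 2 / 2) / t) -
          (1 / t + 1 / t ^ 3) * (t ^ 2 - p ^ 2) * Real.exp (-t ^ 2 / 2)) -
        (H * Real.exp (-t ^ 2 / 2) - p / t * (H * Real.exp (-t ^ 2 / 2))) =
        (t - p) * ((t ^ 2 + 1) * (t + p) - ((n : ℝ) - 1) * t - t ^ 2 * H) *
          (Real.exp (-t ^ 2 / 2) / t ^ 3) := by
      field_simp
      ring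
    have := mul_nonneg hmain (by positivity : 0 ≤ Real.exp (-t ^ 2 / 2) / t ^ 3)
    linarith
  rw [integral_sub hi hr, integral_sub hq hwA, ← hE.radialEnergy_eq (by omega) hi,
    integral_const_mul] at hdiff
  rw [curvatureEnergy]
  rw [radialEnergy] at hdiff
  linarith

theorem integrable_curvatureDensity (hn : 0 < n) {M : ℝ}
    (hH : ∀ᵐ x ∂boundaryMeasure E, |meanCurvature E x| ≤ M) :
    Integrable (curvatureDensity E) (boundaryMeasure E) := by
  refine ((hE.integrable_exp hn).const_mul M).mono'
    ((hE.aestronglyMeasurable_meanCurvature hn).mul (Continuous.aestronglyMeasurable (by fun_prop)))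
    ?_
  filter_upwards [hH] with x hx
  rw [curvatureDensity, norm_mul, Real.norm_of_nonneg (Real.exp_nonneg _)]
  exact mul_le_mul hx (exp_neg_half_le x) (Real.exp_nonneg _) ((abs_nonneg _).trans hx)

end IsRegularConvex

end GaussianCurvature

end

/-! ### The two inequalities -/

theorem theorem4p4 (n : ℕ) (hn : 3 ≤ n) (m r : ℝ) (hr : 0 < r)
    (hball : GaussianCurvature.gaussianVolume (Metric.ball (0 : GaussianCurvature.Space n) r) = m) :
    (∀ M : ℝ, 0 < M →
      max (GaussianCurvature.psi (2 * M)) (GaussianCurvature.psi (Real.sqrt ((n : ℝ) - 2))) ≤ m →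
      ∀ E : Set (GaussianCurvature.Space n),
        Convex ℝ E → GaussianCurvature.IsClassC2 E → (0 : GaussianCurvature.Space n) ∈ E →
        GaussianCurvature.gaussianVolume E = m →
        eLpNorm (GaussianCurvature.meanCurvature E) ⊤ (GaussianCurvature.boundaryMeasure E)
          ≤ ENNReal.ofReal M →
        Integrable (GaussianCurvature.curvatureDensity E) (GaussianCurvature.boundaryMeasure E) ∧
        GaussianCurvature.curvatureEnergy E ≤
          GaussianCurvature.curvatureEnergy (Metric.ball (0 : GaussianCurvature.Space n) r)) ∧
    (GaussianCurvature.psi (Real.sqrt ((n : ℝ) - 2)) ≤ m →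
      ∀ E : Set (GaussianCurvature.Space n),
        Convex ℝ E → GaussianCurvature.IsClassC11 E → (0 : GaussianCurvature.Space n) ∈ E →
        GaussianCurvature.gaussianVolume E = m →
        Integrable (GaussianCurvature.curvatureDensity E) (GaussianCurvature.boundaryMeasure E) →
        Integrable (GaussianCurvature.radialDensity E) (GaussianCurvature.boundaryMeasure E) ∧
        GaussianCurvature.radialEnergy E ≤
          GaussianCurvature.radialEnergy (Metric.ball (0 : GaussianCurvature.Space n) r)) := by
  have hn0 : 0 < n := by omega
  have ha : 0 < Real.sqrt ((n : ℝ) - 2) := by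
    have : (3 : ℝ) ≤ n := by exact_mod_cast hn
    exact Real.sqrt_pos.2 (by linarith)
  constructor
  · intro M hM hm E hc hC2 h0 hγ hess
    have hD := hC2.hasDefiningFunctions
    have hγa := (le_max_right _ _).trans (hm.trans_eq hγ.symm)
    have hγM := (le_max_left _ _).trans (hm.trans_eq hγ.symm)
    have hE := hD.isRegularConvex hc h0 ha hγa
    have habs : ∀ᵐ x ∂GaussianCurvature.boundaryMeasure E,
        |GaussianCurvature.meanCurvature E x| ≤ M := by
      rw [eLpNorm_exponent_top] at hess
      filter_upwards [ae_le_eLpNormEssSup (f := GaussianCurvature.meanCurvature E)] with x hx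
      have := hx.trans hess
      rw [Real.enorm_eq_ofReal_abs] at this
      exact (ENNReal.ofReal_le_ofReal_iff hM.le).1 this
    have hi := hE.integrable_curvatureDensity hn0 habs
    refine ⟨hi, (hE.curvatureEnergy_le hn (fun x hx => hD.le_inner_normal hc hγa hx) (M := M)
      (fun x hx => ?_) (habs.mono fun x hx => (le_abs_self _).trans hx) hi).trans
      (hE.le_curvatureEnergy_ball hn hr (hγ.trans hball.symm))⟩
    -- The volume bound gives `2 * M ≤ ⟨x, ν⟩`, which implies `M ≤ ⟨x, ν⟩` as `M > 0`.
    linarith [hD.le_inner_normal hc hγM hx]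
  · intro hm E hc hC11 h0 hγ hi
    have hD := hC11.hasDefiningFunctions
    have hγa := hm.trans_eq hγ.symm
    have hE := hD.isRegularConvex hc h0 ha hγa
    exact ⟨hE.integrable_radialDensity hi,
      (hE.radialEnergy_le hn (fun x hx => hD.le_inner_normal hc hγa hx) hi).trans
      ((hE.le_curvatureEnergy_ball hn hr (hγ.trans hball.symm)).trans_eq
        (GaussianCurvature.radialEnergy_ball hr).symm)⟩
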